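/- A CNF formula is a finite conjunction of clauses, a clause being a finite disjunction of literals. The variables of a formula $\varphi$ are those that appear in it, and assignments of $\varphi$ map this set of variables to $\{0,1\}$. A $(2,2)$-CNF formula is a CNF formula with at most two literals per clause in which each variable appears in at most two clauses. Exact Differ 2-SAT is the following problem: given a 2-CNF formula $\varphi$ and an integer $d\ge 0$, decide whether $\varphi$ has two satisfying assignments (possibly equal, if $d=0$) that differ on exactly $d$ variables. **Theorem.** (1) Exact Differ 2-SAT is solvable in polynomial time on $(2,2)$-CNF formulas: there is a (multi-stack) Turing machine that, given any $(2,2)$-CNF formula $\varphi$ and any integer $d\ge 0$, written as a string with variable names and $d$ in binary, decides in time polynomial in the length of this string whether $\varphi$ has two satisfying assignments that differ on exactly $d$ variables. (2) Let $\varphi$ be a $(2,2)$-CNF formula in which every clause consists of two literals on two distinct variables. Let $G$ be the graph with two vertices $x[0],x[1]$ for every variable $x$, a *matching-edge* $\{x[0],x[1]\}$ for every variable $x$, and, for every clause, a *clause-edge* that joins the vertices of its two literals, where the literal $x$ is represented by $x[1]$ and the literal $\neg x$ by $x[0]$ (repeated clauses give one edge). For a connected component $C$ of $G$ let $\mathrm{vars}(C)$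 be the set of variables that appear in it, and let $\Delta(C)$ be the set of all numbers of variables of $C$ on which two (possibly equal) assignments that satisfy all clauses corresponding to clause-edges of $C$ can differ. Then every component $C$ is of at least one of the following four kinds, and, whenever it is of a given kind, $\Delta(C)$ is as stated: - $C$ is path-like, i.e. a path, possibly with pendant matching-edges attached to its vertices: $\Delta(C)=\{0,1,\dots,|\mathrm{vars}(C)|\}$; - $C$ is even-cycle-like with pendants, i.e. a cycle of even length with at least one pendant matching-edge attached: $\Delta(C)=\{0,1,\dots,|\mathrm{vars}(C)|\}$; - $C$ is odd-cycle-like, i.e. a cycle of odd length, possibly with pendant matching-edges attached: $\Delta(C)=\{0,1,\dots,|\mathrm{vars}(C)|-1\}$; - $C$ is a pure even cycle, i.e. a cycle of even length without pendants: $\Delta(C)=\{0,|\mathrm{vars}(C)|\}$. Moreover, let $D$ be the sum of $|\mathrm{vars}(C)|$ over all components $C$ of the first two kinds plus the sum of $|\mathrm{vars}(C)|-1$ over all odd-cycle-like components. For every integer $d\ge 0$, the formula $\varphi$ has two satisfying assignments that differ on exactly $d$ variables if and only if there are an integer $0\le d'\le D$ and a set $S$ of pure even cycle components of $G$ with $d'+\sum_{C\in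 S}|\mathrm{vars}(C)|=d$. -/

import Mathlib

namespace DifferSAT

/-- A literal: `(x, true)` is the positive literal `x`, `(x, false)` is `¬ x`. -/
abbrev Literal : Type := ℕ × Bool

/-- A clause is the disjunction of the listed literals. -/
abbrev Clause : Type := List Literal

/-- A CNF formula is the conjunction of the listed clauses. -/
abbrev CNF : Type := List Clause

/-- The variables of a formula, i.e. those that appear in it. -/
def vars (φ : CNF) : Finset ℕ := (φ.flatten.map Prod.fst).toFinset

/-- At most two literals per clause, and each variable appears in at most two clauses. -/
def IsTwoTwoCNF (φ : CNF) : Prop :=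
  (∀ c ∈ φ, c.length ≤ 2) ∧ ∀ x : ℕ, φ.countP (fun c => x ∈ c.map Prod.fst) ≤ 2

/-- `σ` satisfies `φ`: every clause has a literal that is true under `σ`. Only the values of `σ` on
the variables of `φ` matter. -/
def Satisfies (σ : ℕ → Bool) (φ : CNF) : Prop :=
  ∀ c ∈ φ, ∃ l ∈ c, σ l.1 = l.2

/-- The number of variables in `S` on which `σ` and `τ` differ. -/
def diffCount (S : Finset ℕ) (σ τ : ℕ → Bool) : ℕ :=
  (S.filter fun x => σ x ≠ τ x).card

/-- `(φ, d)` is a YES instance of Exact Differ SAT. -/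
def ExactDiffer (φ : CNF) (d : ℕ) : Prop :=
  ∃ σ τ : ℕ → Bool, Satisfies σ φ ∧ Satisfies τ φ ∧ diffCount (vars φ) σ τ = d

/-! ### Instances as strings, and polynomial time -/

open Computability in
/-- A natural number in binary, as a string. -/
def encodeNumber (n : ℕ) : List Γ' := (encodeNat n).map Γ'.bit

open Computability in
/-- A sign bit, the name of the variable in binary, and a comma. -/
def encodeLiteral (l : Literal) : List Γ' := Γ'.bit l.2 :: (encodeNumber l.1 ++ [Γ'.comma])

open Computability in
/-- The literals between brackets. -/
def encodeClause (c : Clause) : List Γ' := Γ'.bra :: (c.flatMap encodeLiteral ++ [Γ'.ket])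

open Computability in
/-- The instance `(φ, d)` as a string: `d` in binary, followed by the clauses of `φ`. -/
def encodeInstance (φ : CNF) (d : ℕ) : List Γ' := encodeNumber d ++ φ.flatMap encodeClause

open Classical in
/-- Membership in `P` is decided, for all inputs in `α` (written as strings by `enc`), by a
multi-stack Turing machine in time polynomial in the length of the input string. -/
def PolyTimeDecidable {α Γ : Type} (enc : α → List Γ) (P : α → Prop) : Prop :=
  Nonempty (Turing.TM2ComputableInPolyTime enc Computability.encodeBool
    (fun a => decide (P a)))

/-! ### The graph of a formula -/

/-- Every clause consists of two literals on two distinct variables. -/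
def IsProper (φ : CNF) : Prop :=
  ∀ c ∈ φ, ∃ l m : Literal, c = [l, m] ∧ l.1 ≠ m.1

/-- The two vertices `x[0]`, `x[1]` for every variable `x` of `φ`. -/
abbrev Vertex (φ : CNF) : Type := {x : ℕ // x ∈ vars φ} × Bool

/-- The vertex `x[1]` stands for the literal `x`, and `x[0]` for `¬ x`. -/
def Vertex.lit {φ : CNF} (a : Vertex φ) : Literal := (a.1.1, a.2)

/-- Two distinct vertices are joined if they belong to the same variable (matching-edge) or if
their literals form a clause of `φ` (clause-edge). -/
def graph (φ : CNF) : SimpleGraph (Vertex φ) :=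
  SimpleGraph.fromRel fun a b => a.1 = b.1 ∨ [Vertex.lit a, Vertex.lit b] ∈ φ

/-- The connected components of the graph of `φ`. -/
abbrev Component (φ : CNF) : Type := (graph φ).ConnectedComponent

noncomputable instance (φ : CNF) : Fintype (Component φ) :=
  haveI : Finite (Component φ) := Quot.finite _
  Fintype.ofFinite _

open Classical in
/-- The variables that appear in a component. -/
noncomputable def compVars {φ : CNF} (C : Component φ) : Finset ℕ :=
  (vars φ).filter fun x => ∃ a ∈ C.supp, a.1.1 = x

/-- The component `C` consists of the walk `p` and of pendant matching-edges attached to vertices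
of `p`: every edge of `C` is an edge of `p`, or a matching-edge with exactly one endpoint on `p`. -/
def IsCore {φ : CNF} (C : Component φ) {u v : Vertex φ} (p : (graph φ).Walk u v) : Prop :=
  u ∈ C.supp ∧ ∀ a ∈ C.supp, ∀ b, (graph φ).Adj a b →
    s(a, b) ∈ p.edges ∨ (a.1 = b.1 ∧ Xor (a ∈ p.support) (b ∈ p.support))

/-- A path, possibly with pendant matching-edges. -/
def IsPathLike {φ : CNF} (C : Component φ) : Prop :=
  ∃ (u v : Vertex φ) (p : (graph φ).Walk u v), p.IsPath ∧ IsCore C p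

/-- A cycle of odd length, possibly with pendant matching-edges. -/
def IsOddCycleLike {φ : CNF} (C : Component φ) : Prop :=
  ∃ (u : Vertex φ) (p : (graph φ).Walk u u), p.IsCycle ∧ IsCore C p ∧ Odd p.length

/-- A cycle of even length with at least one pendant matching-edge. -/
def IsPendantEvenCycleLike {φ : CNF} (C : Component φ) : Prop :=
  ∃ (u : Vertex φ) (p : (graph φ).Walk u u), p.IsCycle ∧ IsCore C p ∧ Even p.length ∧
    ∃ a ∈ C.supp, a ∉ p.support

/-- A cycle of even length, without pendants. -/
def IsPureEvenCycle {φ : CNF} (C : Component φ) : Prop :=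
  ∃ (u : Vertex φ) (p : (graph φ).Walk u u), p.IsCycle ∧ IsCore C p ∧ Even p.length ∧
    ∀ a ∈ C.supp, a ∈ p.support

/-- `σ` satisfies all clauses that correspond to clause-edges of `C`. -/
def SatisfiesOn {φ : CNF} (σ : ℕ → Bool) (C : Component φ) : Prop :=
  ∀ a ∈ C.supp, ∀ b : Vertex φ, [Vertex.lit a, Vertex.lit b] ∈ φ →
    σ a.1.1 = a.2 ∨ σ b.1.1 = b.2

/-- The achievable difference counts on `C`: the numbers of variables of `C` on which two
assignments that satisfy all clauses corresponding to clause-edges of `C` can differ. -/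
def compDiffs {φ : CNF} (C : Component φ) : Set ℕ :=
  {μ | ∃ σ τ : ℕ → Bool, SatisfiesOn σ C ∧ SatisfiesOn τ C ∧ diffCount (compVars C) σ τ = μ}

open Classical in
/-- The sum of `|vars(C)|` over the path-like components and the even-cycle-like components with
pendants, plus the sum of `|vars(C)| - 1` over the odd-cycle-like components. -/
noncomputable def flexibleTotal (φ : CNF) : ℕ :=
  (∑ C : Component φ with IsPathLike C ∨ IsPendantEvenCycleLike C, (compVars C).card) +
    ∑ C : Component φ with IsOddCycleLike C, ((compVars C).card - 1)

end DifferSAT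

/-! Part (1) is a dynamic programme over a frontier. Clauses are processed one at a time; the
frontier consists of the variables that occur both in a processed and in an unprocessed clause. For
each pair of assignments that satisfy the processed clauses, only the two restrictions to the
frontier and the number of differences so far are kept. The next clause is one that meets the
frontier, whenever there is one. A frontier variable in it has then used up its two clauses and
leaves, and the clause brings in at most one other variable, so the frontier never exceeds two
variables (`searchStep_spec`). Hence there are at most `16 * (n + 1)` distinct rows over `n`
variables (`length_rows_le`), and every state has polynomial size. The Turing machine comes from
structured programs on five stacks, compiled step for step (`Runs.steps`). The functions in `PT` are
closed under composition, pairing, branching and folds with polynomially bounded accumulators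
(`PT.foldl`), and the whole algorithm belongs to `PT` (`PT.accepts`).

Part (2) rests on one local fact: the two vertices of a variable together have at most two
clause-edges, called half-edges (`half_edges`). Two properties of a component decide everything. It
is pure if every vertex lies on a clause-edge, and balanced if some assignment makes exactly one
literal of each clause-edge true, which amounts to a proper 2-colouring. All variables can differ at
once iff the component is balanced (`card_mem_compDiffs_iff`). If it is not pure, a vertex without
clause-edges lets its variable satisfy all its clauses for free; the other variables can be peeled
off one by one, each with at most one clause to those left, which yields every smaller count
(`exists_diff`). If it is pure, counting true and false vertices leaves exactly one true literal per
clause (`IsPure.exactly_one`), so one variable determines the others and only the extreme counts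
occur.

As for the shapes, any cycle of a component is its core (`isCore_of_isCycle`), and in an acyclic
component a longest path is. Paths and even cycles are 2-colourable and odd cycles are not; the pure
components are exactly the pure even cycles. Finally, components share neither variables nor
clauses, so counts add up: the intervals sum to an interval, and each pure even cycle contributes
nothing or all of its variables. -/

namespace DifferSAT

/-! ### Structured stack programs and their compilation to multi-stack Turing machines -/

/-- Programs that operate on five stacks of bits. -/
inductive Prog : Type
  | skip : Prog
  | push (k : Fin 5) (b : Bool) : Prog
  | seq (P Q : Prog) : Prog
  /-- Pop stack `k`; the continuation depends on whether it was empty, or which bit was popped. -/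
  | case (k : Fin 5) (P Q R : Prog) : Prog
  /-- Pop stack `k`; if the bit `true` was popped, run the body and repeat. -/
  | loop (k : Fin 5) (P : Prog) : Prog

namespace Prog

/-- The contents of the five stacks. -/
abbrev Store : Type := Fin 5 → List Bool

/-- `Runs P S S' n`: started with the stacks `S`, the program `P` stops after `n` steps with the
stacks `S'`. -/
inductive Runs : Prog → Store → Store → ℕ → Prop
  | skip (S : Store) : Runs skip S S 1
  | push (k : Fin 5) (b : Bool) (S : Store) : Runs (push k b) S (Function.update S k (b :: S k)) 1
  | seq {P Q : Prog} {S T U : Store} {m n : ℕ} : Runs P S T m → Runs Q T U n →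
      Runs (seq P Q) S U (m + n)
  | case_nil {k : Fin 5} {P Q R : Prog} {S T : Store} {n : ℕ} : S k = [] → Runs P S T n →
      Runs (case k P Q R) S T (n + 1)
  | case_false {k : Fin 5} {P Q R : Prog} {S T : Store} {n : ℕ} {l : List Bool} :
      S k = false :: l → Runs Q (Function.update S k l) T n → Runs (case k P Q R) S T (n + 1)
  | case_true {k : Fin 5} {P Q R : Prog} {S T : Store} {n : ℕ} {l : List Bool} :
      S k = true :: l → Runs R (Function.update S k l) T n → Runs (case k P Q R) S T (n + 1)
  | loop_nil {k : Fin 5} {P : Prog} {S : Store} : S k = [] → Runs (loop k P) S S 1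
  | loop_false {k : Fin 5} {P : Prog} {S : Store} {l : List Bool} : S k = false :: l →
      Runs (loop k P) S (Function.update S k l) 1
  | loop_true {k : Fin 5} {P : Prog} {S T U : Store} {l : List Bool} {m n : ℕ} :
      S k = true :: l → Runs P (Function.update S k l) T m → Runs (loop k P) T U n →
      Runs (loop k P) S U (m + n + 1)

/-- The labels of a program. -/
def Lab : Prog → Type
  | skip => Unit
  | push _ _ => Unit
  | seq P Q => P.Lab ⊕ Q.Lab
  | case _ P Q R => Option (P.Lab ⊕ (Q.Lab ⊕ R.Lab))
  | loop _ P => Option P.Lab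

instance Lab.finite : (P : Prog) → Finite P.Lab
  | skip => inferInstanceAs (Finite Unit)
  | push _ _ => inferInstanceAs (Finite Unit)
  | seq P Q =>
    haveI := Lab.finite P
    haveI := Lab.finite Q
    inferInstanceAs (Finite (P.Lab ⊕ Q.Lab))
  | case _ P Q R =>
    haveI := Lab.finite P
    haveI := Lab.finite Q
    haveI := Lab.finite R
    inferInstanceAs (Finite (Option (P.Lab ⊕ (Q.Lab ⊕ R.Lab))))
  | loop _ P =>
    haveI := Lab.finite P
    inferInstanceAs (Finite (Option P.Lab))

/-- The label at which a program starts. -/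
def start : (P : Prog) → P.Lab
  | skip => ()
  | push _ _ => ()
  | seq P _ => Sum.inl P.start
  | case _ _ _ _ => none
  | loop _ _ => none

open Computability in
/-- The alphabets of the machine: an input stack, and five stacks of bits. -/
abbrev Alphabet : Option (Fin 5) → Type
  | none => Γ'
  | some _ => Bool

open Computability in
/-- The internal memory of the machine: the symbol popped last. -/
abbrev Memory : Type := Option Γ'

open Computability Turing.TM2.Stmt in
/-- The statements of the machine that runs `P`, with its labels embedded by `e`, and then jumps
to `x`. -/
def stmt {Λ : Type} : (P : Prog) → (P.Lab → Λ) → Λ → P.Lab → Turing.TM2.Stmt Alphabet Λ Memory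
  | skip, _, x, _ => goto fun _ => x
  | push k b, _, x, _ => Turing.TM2.Stmt.push (some k) (fun _ => b) (goto fun _ => x)
  | seq P Q, e, _, Sum.inl l => stmt P (e ∘ Sum.inl) (e (Sum.inr Q.start)) l
  | seq _ Q, e, x, Sum.inr l => stmt Q (e ∘ Sum.inr) x l
  | case k P Q R, e, _, none =>
    pop (some k) (fun _ (o : Option Bool) => o.map Γ'.bit)
      (branch (fun v => decide (v = none))
        (load (fun _ => none) (goto fun _ => e (some (Sum.inl P.start))))
        (branch (fun v => decide (v = some (Γ'.bit false)))
          (load (fun _ => none) (goto fun _ => e (some (Sum.inr (Sum.inl Q.start)))))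
          (load (fun _ => none) (goto fun _ => e (some (Sum.inr (Sum.inr R.start)))))))
  | case _ P _ _, e, x, some (Sum.inl l) => stmt P (fun l => e (some (Sum.inl l))) x l
  | case _ _ Q _, e, x, some (Sum.inr (Sum.inl l)) =>
    stmt Q (fun l => e (some (Sum.inr (Sum.inl l)))) x l
  | case _ _ _ R, e, x, some (Sum.inr (Sum.inr l)) =>
    stmt R (fun l => e (some (Sum.inr (Sum.inr l)))) x l
  | loop k P, e, x, none =>
    pop (some k) (fun _ (o : Option Bool) => o.map Γ'.bit)
      (branch (fun v => decide (v = some (Γ'.bit true)))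
        (load (fun _ => none) (goto fun _ => e (some P.start)))
        (load (fun _ => none) (goto fun _ => x)))
  | loop _ P, e, _, some l => stmt P (fun l => e (some l)) (e none) l

/-- The stacks of the machine, when the input has been read. -/
def Store.full (S : Store) : ∀ k, List (Alphabet k)
  | none => []
  | some k => S k

theorem Store.update_full (S : Store) (k : Fin 5) (l : List Bool) :
    Function.update S.full (some k) l = Store.full (Function.update S k l) := by
  funext i
  cases i with
  | none => simp [Store.full]
  | some i =>
    by_cases h : i = k
    · subst h; simp [Store.full]
    · rw [Function.update_of_ne (by simpa using h)]
      simp [Store.full, Function.update_of_ne h]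

/-- The machine with program `M` goes from the first to the second configuration in `n` steps. -/
def Steps {Λ : Type} (M : Λ → Turing.TM2.Stmt Alphabet Λ Memory)
    (a b : Turing.TM2.Cfg Alphabet Λ Memory) (n : ℕ) : Prop :=
  (flip bind (Turing.TM2.step M))^[n] (some a) = some b

theorem Steps.trans {Λ : Type} {M : Λ → Turing.TM2.Stmt Alphabet Λ Memory}
    {a b c : Turing.TM2.Cfg Alphabet Λ Memory} {m n : ℕ} (h : Steps M a b m) (h' : Steps M b c n) :
    Steps M a c (m + n) := by
  unfold Steps at *
  rw [add_comm, Function.iterate_add_apply, h, h']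

theorem Steps.one {Λ : Type} {M : Λ → Turing.TM2.Stmt Alphabet Λ Memory}
    {l : Λ} {v : Memory} {S : ∀ k, List (Alphabet k)} {b : Turing.TM2.Cfg Alphabet Λ Memory}
    (h : Turing.TM2.stepAux (M l) v S = b) : Steps M ⟨some l, v, S⟩ b 1 := by
  subst h; rfl

/-- The step counts of `Runs` are exact because compilation adds no glue: the exit label of the
first part of a `seq` is the start of the second, a loop body exits to the loop head, and a pop
together with its branching is a single statement. The memory is reset to `none` after each pop, so
that all parts start alike. -/
theorem Runs.steps {Λ : Type} {M : Λ → Turing.TM2.Stmt Alphabet Λ Memory} {P : Prog}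
    {S T : Store} {n : ℕ} (h : Runs P S T n) (e : P.Lab → Λ) (x : Λ)
    (hM : ∀ l, M (e l) = P.stmt e x l) :
    Steps M ⟨some (e P.start), none, S.full⟩ ⟨some x, none, T.full⟩ n := by
  induction h generalizing x with
  | skip S => exact Steps.one (by rw [hM]; rfl)
  | push k b S =>
    refine Steps.one ?_
    rw [hM]
    simp only [stmt, Turing.TM2.stepAux]
    rw [← Store.update_full]; rfl
  | seq _ _ ih₁ ih₂ =>
    exact (ih₁ (e ∘ Sum.inl) _ fun l => hM (Sum.inl l)).trans
      (ih₂ (e ∘ Sum.inr) x fun l => hM (Sum.inr l))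
  | @case_nil k P Q R S T n hk _ ih =>
    rw [add_comm]
    refine (Steps.one ?_).trans (ih (fun l => e (some (Sum.inl l))) x fun l => hM (some (Sum.inl l)))
    have : S.full (some k) = [] := hk
    rw [hM, start, stmt]
    simp only [Turing.TM2.stepAux, this]
    have h2 : Function.update S.full (some k) [] = S.full := by rw [← this]; simp
    simpa using h2
  | @case_false k P Q R S T n l hk _ ih =>
    rw [add_comm]
    refine (Steps.one ?_).trans
      (ih (fun l => e (some (Sum.inr (Sum.inl l)))) x fun l => hM (some (Sum.inr (Sum.inl l))))
    have : S.full (some k) = false :: l := hk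
    rw [hM, start, stmt]
    simp only [Turing.TM2.stepAux, this]
    simp [← Store.update_full]
  | @case_true k P Q R S T n l hk _ ih =>
    rw [add_comm]
    refine (Steps.one ?_).trans
      (ih (fun l => e (some (Sum.inr (Sum.inr l)))) x fun l => hM (some (Sum.inr (Sum.inr l))))
    have : S.full (some k) = true :: l := hk
    rw [hM, start, stmt]
    simp only [Turing.TM2.stepAux, this]
    simp [← Store.update_full]
  | @loop_nil k P S hk =>
    refine Steps.one ?_
    have : S.full (some k) = [] := hk
    rw [hM, start, stmt]
    simp only [Turing.TM2.stepAux, this]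
    have h2 : Function.update S.full (some k) [] = S.full := by rw [← this]; simp
    simpa using h2
  | @loop_false k P S l hk =>
    refine Steps.one ?_
    have : S.full (some k) = false :: l := hk
    rw [hM, start, stmt]
    simp only [Turing.TM2.stepAux, this]
    simp [← Store.update_full]
  | @loop_true k P S T U l m n hk _ _ ih₁ ih₂ =>
    rw [add_comm]
    refine (Steps.one ?_).trans
      ((ih₁ (fun l => e (some l)) (e none) fun l => hM (some l)).trans (ih₂ e x hM))
    have : S.full (some k) = true :: l := hk
    rw [hM, start, stmt]
    simp only [Turing.TM2.stepAux, this]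
    simp [← Store.update_full]

end Prog

end DifferSAT

namespace DifferSAT

/-! ### Runs with a bounded number of steps, and explicit stores. -/

namespace Prog

/-- `Within P S T n`: started with the stacks `S`, the program `P` stops after at most `n` steps
with the stacks `T`. -/
def Within (P : Prog) (S T : Store) (n : ℕ) : Prop := ∃ m ≤ n, Runs P S T m

theorem Within.mono {P : Prog} {S T : Store} {m n : ℕ} (h : Within P S T m) (hmn : m ≤ n) :
    Within P S T n := by
  obtain ⟨k, hk, h⟩ := h
  exact ⟨k, hk.trans hmn, h⟩

theorem within_skip (S : Store) : Within skip S S 1 := ⟨1, le_rfl, Runs.skip S⟩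

theorem within_push (k : Fin 5) (b : Bool) (S : Store) :
    Within (push k b) S (Function.update S k (b :: S k)) 1 := ⟨1, le_rfl, Runs.push k b S⟩

theorem Within.andThen {P Q : Prog} {S T U : Store} {m n : ℕ} (h : Within P S T m)
    (h' : Within Q T U n) : Within (seq P Q) S U (m + n) := by
  obtain ⟨m', hm, h⟩ := h
  obtain ⟨n', hn, h'⟩ := h'
  exact ⟨m' + n', add_le_add hm hn, Runs.seq h h'⟩

theorem within_case_nil {k : Fin 5} {P Q R : Prog} {S T : Store} {n : ℕ} (hS : S k = [])
    (h : Within P S T n) : Within (case k P Q R) S T (n + 1) := by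
  obtain ⟨m, hm, h⟩ := h
  exact ⟨m + 1, by lia, Runs.case_nil hS h⟩

theorem within_case_false {k : Fin 5} {P Q R : Prog} {S T : Store} {n : ℕ} {l : List Bool}
    (hS : S k = false :: l) (h : Within Q (Function.update S k l) T n) :
    Within (case k P Q R) S T (n + 1) := by
  obtain ⟨m, hm, h⟩ := h
  exact ⟨m + 1, by lia, Runs.case_false hS h⟩

theorem within_case_true {k : Fin 5} {P Q R : Prog} {S T : Store} {n : ℕ} {l : List Bool}
    (hS : S k = true :: l) (h : Within R (Function.update S k l) T n) :
    Within (case k P Q R) S T (n + 1) := by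
  obtain ⟨m, hm, h⟩ := h
  exact ⟨m + 1, by lia, Runs.case_true hS h⟩

theorem within_loop_nil {k : Fin 5} {P : Prog} {S : Store} (hS : S k = []) :
    Within (loop k P) S S 1 := ⟨1, le_rfl, Runs.loop_nil hS⟩

theorem within_loop_true {k : Fin 5} {P : Prog} {S T U : Store} {l : List Bool} {m n : ℕ}
    (hS : S k = true :: l) (h : Within P (Function.update S k l) T m)
    (h' : Within (loop k P) T U n) : Within (loop k P) S U (m + n + 1) := by
  obtain ⟨m', hm, h⟩ := h
  obtain ⟨n', hn, h'⟩ := h'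
  exact ⟨m' + n' + 1, by lia, Runs.loop_true hS h h'⟩

/-- The store with the given stacks. -/
def st (a b c d e : List Bool) : Store := ![a, b, c, d, e]

section st
variable (a b c d e l : List Bool)

@[simp] theorem st_zero : st a b c d e 0 = a := rfl
@[simp] theorem st_one : st a b c d e 1 = b := rfl
@[simp] theorem st_two : st a b c d e 2 = c := rfl
@[simp] theorem st_three : st a b c d e 3 = d := rfl
@[simp] theorem st_four : st a b c d e 4 = e := rfl
@[simp] theorem update_st_zero : Function.update (st a b c d e) 0 l = st l b c d e := by
  funext i; fin_cases i <;> rfl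
@[simp] theorem update_st_one : Function.update (st a b c d e) 1 l = st a l c d e := by
  funext i; fin_cases i <;> rfl
@[simp] theorem update_st_two : Function.update (st a b c d e) 2 l = st a b l d e := by
  funext i; fin_cases i <;> rfl
@[simp] theorem update_st_three : Function.update (st a b c d e) 3 l = st a b c l e := by
  funext i; fin_cases i <;> rfl
@[simp] theorem update_st_four : Function.update (st a b c d e) 4 l = st a b c d l := by
  funext i; fin_cases i <;> rfl

end st

end Prog

/-- Binary trees, the data on which programs operate. -/
inductive BTree : Type
  | leaf : BTree
  | node (l r : BTree) : BTree

namespace BTree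

/-- The prefix code of a tree. -/
def code : BTree → List Bool
  | leaf => [false]
  | node l r => true :: (code l ++ code r)

/-- The code is prefix-free, so trees can lie on a stack one above the other without separators. -/
theorem code_append_inj : ∀ {x y : BTree} {s t : List Bool}, code x ++ s = code y ++ t →
    x = y ∧ s = t
  | leaf, leaf, s, t, h => by simpa [code] using h
  | leaf, node _ _, s, t, h => by simp [code] at h
  | node _ _, leaf, s, t, h => by simp [code] at h
  | node a b, node c d, s, t, h => by
    simp only [code, List.cons_append, List.append_assoc, List.cons.injEq, true_and] at h
    obtain ⟨h₁, h⟩ := code_append_inj h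
    obtain ⟨h₂, h⟩ := code_append_inj h
    exact ⟨by rw [h₁, h₂], h⟩

theorem code_injective : Function.Injective code := fun x y h =>
  (code_append_inj (s := []) (t := []) (by simpa using h)).1

end BTree

/-! ### Moving, copying, deleting and comparing coded trees. -/

open BTree

namespace Prog

/-- The body of the loop that moves one tree from stack `k` to stack `j`, reversing its code; stack
`4` counts the subtrees still to be read. -/
def scanBody (k j : Fin 5) : Prog :=
  case k skip (push j false) (seq (push j true) (seq (push 4 true) (push 4 true)))

/-- Move one tree from stack `k` to stack `j`, reversing its code. -/
def scan (k j : Fin 5) : Prog := seq (push 4 true) (loop 4 (scanBody k j))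

/-- Stack `4` holds one `true` per subtree still to be read: a leaf removes one, an inner node
removes one and adds two. Stating the result for an arbitrary continuation of the loop lets the
induction chain the two subtrees of a node. The factor 5 is the cost of a node bit: two pops and
three pushes. -/
theorem within_scanBody {k j : Fin 5} (hkj : k ≠ j) (hk : k ≠ 4) (hj : j ≠ 4) (x : BTree) :
    ∀ {S T : Store} {c s : List Bool} {n : ℕ}, S k = code x ++ s → S 4 = true :: c →
    Within (loop 4 (scanBody k j)) (Function.update (Function.update (Function.update S 4 c) k s) j
      ((code x).reverse ++ S j)) T n →
    Within (loop 4 (scanBody k j)) S T (n + 5 * (code x).length) := by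
  induction x with
  | leaf =>
    intro S T c s n hS hc h
    refine (within_loop_true hc (within_case_false (l := s) ?_ (within_push j false _)) ?_).mono
      (m := (1 + 1) + n + 1) (by simp [code]; lia)
    · simp [Function.update_of_ne hk, hS, code]
    · refine Eq.mp (congrArg (fun U => Within _ U T n) ?_) h
      funext i
      simp only [Function.update_apply]
      split_ifs <;> simp_all [code]
  | node a b iha ihb =>
    intro S T c s n hS hc h
    refine (within_loop_true hc (within_case_true (l := code a ++ (code b ++ s)) ?_
      ((within_push j true _).andThen ((within_push 4 true _).andThen (within_push 4 true _))))
      (iha (c := true :: c) (s := code b ++ s) ?_ ?_ (ihb (c := c) (s := s) ?_ ?_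
      (n := n) ?_))).mono ?_
    · simp [Function.update_of_ne hk, hS, code]
    · simp [Function.update_of_ne hk, Function.update_of_ne hkj]
    · simp [Function.update_of_ne hk.symm, Function.update_of_ne hj.symm]
    · simp [Function.update_of_ne hkj]
    · simp [Function.update_of_ne hk.symm, Function.update_of_ne hj.symm]
    · refine Eq.mp (congrArg (fun U => Within _ U T n) ?_) h
      funext i
      simp only [Function.update_apply]
      split_ifs <;> simp_all [code]
    · simp [code]; lia

theorem within_scan {k j : Fin 5} (hkj : k ≠ j) (hk : k ≠ 4) (hj : j ≠ 4) {x : BTree} {S : Store}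
    {s : List Bool} (hS : S k = code x ++ s) (h4 : S 4 = []) :
    Within (scan k j) S (Function.update (Function.update S k s) j ((code x).reverse ++ S j))
      (5 * (code x).length + 2) := by
  have key := ((within_push 4 true S).andThen (within_scanBody hkj hk hj x (c := []) (s := s) ?_ ?_
    (within_loop_nil ?_) (n := 1))).mono (n := 5 * (code x).length + 2) (by lia)
  · refine Eq.mp (congrArg (fun U => Within _ S U _) ?_) key
    funext i
    simp only [Function.update_apply]
    split_ifs <;> simp_all
  · simp [Function.update_of_ne hk, hS]
  · simp [h4]
  · simp [Function.update_of_ne hk.symm, Function.update_of_ne hj.symm]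

/-- The body of the loop that empties stack `k`, executing `P b` for every bit `b`. -/
def drainBody (k : Fin 5) (P : Bool → Prog) : Prog :=
  case k skip (seq (P false) (push 4 true)) (seq (P true) (push 4 true))

/-- Empty stack `k`, executing `P b` for every bit `b`. -/
def drain (k : Fin 5) (P : Bool → Prog) : Prog := seq (push 4 true) (loop 4 (drainBody k P))

/-- Since `loop` also stops at a bit `false`, the loop is driven by a flag on stack `4`, renewed
after every bit. `F r l` is the store when the bits `r` have been handled, the latest first, and `l`
is left. Each bit costs `c` plus two pops and the renewal of the flag. -/
theorem within_drain {k : Fin 5} (P : Bool → Prog) (F : List Bool → List Bool → Store)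
    (c : ℕ) (hF : ∀ r l, F r l k = l) (h4 : ∀ r l, F r l 4 = [])
    (hP : ∀ b r l, Within (P b) (Function.update (F r (b :: l)) k l) (F (b :: r) l) c)
    (r l : List Bool) :
    Within (drain k P) (F r l) (F (l.reverse ++ r) []) ((c + 3) * l.length + 5) := by
  have hempty : ∀ r l, Function.update (F r l) 4 [] = F r l := fun r l => by
    rw [← h4 r l, Function.update_eq_self]
  have key : ∀ l r, Within (loop 4 (drainBody k P)) (Function.update (F r l) 4 [true])
      (F (l.reverse ++ r) []) ((c + 3) * l.length + 4) := by
    intro l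
    induction l with
    | nil =>
      intro r
      refine (within_loop_true (T := F r []) (l := []) (by simp) (m := 2) (n := 1) ?_
        (within_loop_nil (h4 _ _))).mono (by simp)
      rw [Function.update_idem, hempty]
      exact within_case_nil (hF _ _) (within_skip _)
    | cons b l ih =>
      intro r
      have ih := ih (b :: r)
      refine (within_loop_true (T := Function.update (F (b :: r) l) 4 [true]) (l := []) (by simp)
        (m := c + 1 + 1) (n := (c + 3) * l.length + 4) ?_ ?_).mono
        (by simp only [List.length_cons]; lia)
      · rw [Function.update_idem, hempty]
        have hq : Within (seq (P b) (push 4 true)) (Function.update (F r (b :: l)) k l)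
            (Function.update (F (b :: r) l) 4 [true]) (c + 1) := by
          have := (hP b r l).andThen (within_push 4 true (F (b :: r) l))
          rwa [h4] at this
        cases b with
        | false => exact within_case_false (hF _ _) hq
        | true => exact within_case_true (hF _ _) hq
      · simpa using ih
  have := (within_push 4 true (F r l)).andThen (by rw [h4]; exact key l r)
  exact this.mono (by lia)

section operations
variable {x y : BTree} {s t : List Bool}

/-- Move one tree from stack `0` to stack `1`. -/
def save : Prog := seq (scan 0 2) (drain 2 fun b => push 1 b)

/-- `scan` leaves the code reversed on stack `2`, and draining that stack reverses it again. The
factor 9 is 5 for scanning and 4 for draining. -/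
theorem within_save : Within save (st (code x ++ s) t [] [] []) (st s (code x ++ t) [] [] [])
    (9 * (code x).length + 7) := by
  have h₁ := within_scan (k := 0) (j := 2) (by decide) (by decide) (by decide) (x := x) (s := s)
    (S := st (code x ++ s) t [] [] []) rfl rfl
  have h₂ := within_drain (k := 2) (fun b => push 1 b)
    (fun r l => st s (r ++ t) l [] []) 1 (fun _ _ => rfl) (fun _ _ => rfl)
    (fun b r l => by simpa using within_push 1 b (st s (r ++ t) l [] [])) [] (code x).reverse
  simp only [update_st_zero, update_st_two, st_two, List.append_nil, List.reverse_reverse,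
    List.nil_append] at h₁ h₂
  exact (h₁.andThen h₂).mono (by rw [List.length_reverse]; lia)

/-- Move one tree from stack `1` to stack `0`. -/
def restore : Prog := seq (scan 1 2) (drain 2 fun b => push 0 b)

theorem within_restore : Within restore (st s (code x ++ t) [] [] []) (st (code x ++ s) t [] [] [])
    (9 * (code x).length + 7) := by
  have h₁ := within_scan (k := 1) (j := 2) (by decide) (by decide) (by decide) (x := x) (s := t)
    (S := st s (code x ++ t) [] [] []) rfl rfl
  have h₂ := within_drain (k := 2) (fun b => push 0 b)
    (fun r l => st (r ++ s) t l [] []) 1 (fun _ _ => rfl) (fun _ _ => rfl)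
    (fun b r l => by simpa using within_push 0 b (st (r ++ s) t l [] [])) [] (code x).reverse
  simp only [update_st_one, update_st_two, st_two, List.append_nil, List.reverse_reverse,
    List.nil_append] at h₁ h₂
  exact (h₁.andThen h₂).mono (by rw [List.length_reverse]; lia)

/-- Copy one tree from stack `0` to stack `1`. -/
def copy : Prog := seq (scan 0 2) (drain 2 fun b => seq (push 0 b) (push 1 b))

theorem within_copy : Within copy (st (code x ++ s) t [] [] [])
    (st (code x ++ s) (code x ++ t) [] [] []) (10 * (code x).length + 7) := by
  have h₁ := within_scan (k := 0) (j := 2) (by decide) (by decide) (by decide) (x := x) (s := s)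
    (S := st (code x ++ s) t [] [] []) rfl rfl
  have h₂ := within_drain (k := 2) (fun b => seq (push 0 b) (push 1 b))
    (fun r l => st (r ++ s) (r ++ t) l [] []) 2 (fun _ _ => rfl) (fun _ _ => rfl)
    (fun b r l => by
      simpa using (within_push 0 b (st (r ++ s) (r ++ t) l [] [])).andThen (within_push 1 b _)) [] (code x).reverse
  simp only [update_st_zero, update_st_two, st_two, List.append_nil, List.reverse_reverse,
    List.nil_append] at h₁ h₂
  exact (h₁.andThen h₂).mono (by rw [List.length_reverse]; lia)

/-- Delete one tree from stack `0`. -/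
def drop : Prog := seq (scan 0 2) (drain 2 fun _ => skip)

theorem within_drop : Within drop (st (code x ++ s) t [] [] []) (st s t [] [] [])
    (9 * (code x).length + 7) := by
  have h₁ := within_scan (k := 0) (j := 2) (by decide) (by decide) (by decide) (x := x) (s := s)
    (S := st (code x ++ s) t [] [] []) rfl rfl
  have h₂ := within_drain (k := 2) (fun _ => Prog.skip)
    (fun r l => st s t l [] []) 1 (fun _ _ => rfl) (fun _ _ => rfl)
    (fun b r l => by simpa using within_skip (st s t l [] [])) [] (code x).reverse
  simp only [update_st_zero, update_st_two, st_two, List.append_nil] at h₁ h₂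
  exact (h₁.andThen h₂).mono (by rw [List.length_reverse]; lia)

/-- Push a list of bits on stack `0`. -/
def pushList : List Bool → Prog
  | [] => skip
  | b :: l => seq (pushList l) (push 0 b)

theorem within_pushList {c d e : List Bool} : ∀ l : List Bool,
    Within (pushList l) (st s t c d e) (st (l ++ s) t c d e) (l.length + 1)
  | [] => within_skip _
  | b :: l => by
    simpa [pushList] using (within_pushList l).andThen (within_push 0 b (st (l ++ s) t c d e))

/-- Pop one bit from stack `0`. -/
def pop : Prog := case 0 skip skip skip

theorem within_pop {b : Bool} {c d e : List Bool} : Within pop (st (b :: s) t c d e) (st s t c d e) 2 := by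
  cases b
  · exact within_case_false (l := s) rfl (by simpa using within_skip _)
  · exact within_case_true (l := s) rfl (by simpa using within_skip _)

/-- The tree that represents a truth value. -/
def _root_.DifferSAT.BTree.ofBool : Bool → BTree
  | false => leaf
  | true => node leaf leaf

/-- Answer `false`, after emptying the stacks `2` and `3`. -/
def reject : Prog :=
  seq (drain 2 fun _ => skip) (seq (drain 3 fun _ => skip) (push 0 false))

theorem within_reject {u v : List Bool} :
    Within reject (st s t u v []) (st (code (ofBool false) ++ s) t [] [] [])
      (4 * u.length + 4 * v.length + 11) := by
  have h₁ := within_drain (k := 2) (fun _ => Prog.skip)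
    (fun r l => st s t l v []) 1 (fun _ _ => rfl) (fun _ _ => rfl)
    (fun b r l => by simpa using within_skip (st s t l v [])) [] u
  have h₂ := within_drain (k := 3) (fun _ => Prog.skip)
    (fun r l => st s t [] l []) 1 (fun _ _ => rfl) (fun _ _ => rfl)
    (fun b r l => by simpa using within_skip (st s t [] l [])) [] v
  have h := h₁.andThen (h₂.andThen (within_push 0 false _))
  simp only [update_st_zero, st_zero] at h
  refine Within.mono h ?_
  lia

/-- The body of the loop that compares the stacks `2` and `3`. -/
def compareBody : Prog :=
  case 2 (case 3 (pushList (code (ofBool true))) reject reject)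
    (case 3 reject (push 4 true) reject) (case 3 reject reject (push 4 true))

/-- Compare the stacks `2` and `3`, which are emptied. -/
def compare : Prog := seq (push 4 true) (loop 4 compareBody)

/-- The flag on stack `4` is renewed only if the two heads agree. At the first disagreement `reject`
empties what is left of both stacks, so either outcome leaves just the answer. -/
theorem within_compareLoop : ∀ u v : List Bool,
    Within (loop 4 compareBody) (st s t u v [true]) (st (code (ofBool (decide (u = v))) ++ s) t
      [] [] []) (4 * u.length + 4 * v.length + 20)
  | [], [] => (within_loop_true (P := compareBody) (l := []) (by rfl) (m := 6)
      (within_case_nil (by rfl) (within_case_nil (by rfl)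
        (by simpa [code, ofBool] using within_pushList (code (ofBool true)))))
      (within_loop_nil (by rfl))).mono (by simp)
  | [], b :: v => by
    refine (within_loop_true (P := compareBody) (l := []) (by rfl) (m := 4 * v.length + 13)
      (within_case_nil (by rfl) ?_)
      (within_loop_nil (by rfl))).mono (by simp; lia)
    cases b
    · exact within_case_false (l := v) (by rfl) (by simpa using within_reject (u := []) (v := v))
    · exact within_case_true (l := v) (by rfl) (by simpa using within_reject (u := []) (v := v))
  | b :: u, [] => by
    refine (within_loop_true (P := compareBody) (l := []) (by rfl) (m := 4 * u.length + 13) ?_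
      (within_loop_nil (by rfl))).mono (by simp; lia)
    cases b
    · exact within_case_false (l := u) (by rfl) (within_case_nil (by rfl)
        (by simpa using within_reject (u := u) (v := [])))
    · exact within_case_true (l := u) (by rfl) (within_case_nil (by rfl)
        (by simpa using within_reject (u := u) (v := [])))
  | false :: u, false :: v => by
    refine (within_loop_true (P := compareBody) (l := []) (by rfl) (m := 3) (within_case_false (l := u) (by rfl)
      (within_case_false (l := v) (by rfl) (within_push 4 true _)))
      (by simpa using within_compareLoop u v)).mono (by simp; lia)
  | true :: u, true :: v => by
    refine (within_loop_true (P := compareBody) (l := []) (by rfl) (m := 3) (within_case_true (l := u) (by rfl)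
      (within_case_true (l := v) (by rfl) (within_push 4 true _)))
      (by simpa using within_compareLoop u v)).mono (by simp; lia)
  | false :: u, true :: v => by
    refine (within_loop_true (P := compareBody) (l := []) (by rfl) (within_case_false (l := u) (by rfl)
      (within_case_true (l := v) (by rfl) (by simpa using within_reject (u := u) (v := v))))
      (within_loop_nil (by rfl))).mono (by simp; lia)
  | true :: u, false :: v => by
    refine (within_loop_true (P := compareBody) (l := []) (by rfl) (within_case_true (l := u) (by rfl)
      (within_case_false (l := v) (by rfl) (by simpa using within_reject (u := u) (v := v))))
      (within_loop_nil (by rfl))).mono (by simp; lia)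

/-- Compare the two halves of the tree on stack `0`. -/
def eqTest : Prog := seq pop (seq (scan 0 2) (seq (scan 0 3) compare))

open Classical in
theorem within_eqTest : Within eqTest (st (code (node x y) ++ s) t [] [] [])
    (st (code (ofBool (decide (x = y))) ++ s) t [] [] []) (9 * (code (node x y)).length + 27) := by
  have h₁ := within_pop (b := true) (s := code x ++ (code y ++ s)) (t := t) (c := []) (d := [])
    (e := [])
  have h₂ := within_scan (k := 0) (j := 2) (by decide) (by decide) (by decide) (x := x)
    (s := code y ++ s) (S := st (code x ++ (code y ++ s)) t [] [] []) rfl rfl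
  have h₃ := within_scan (k := 0) (j := 3) (by decide) (by decide) (by decide) (x := y)
    (s := s) (S := st (code y ++ s) t (code x).reverse [] []) rfl rfl
  -- Both codes arrive reversed, which does not affect whether they are equal.
  have h₄ : Within compare (st s t (code x).reverse (code y).reverse []) _ _ :=
    (within_push 4 true _).andThen
      (by simpa using within_compareLoop (s := s) (t := t) (code x).reverse (code y).reverse)
  simp only [update_st_zero, update_st_two, update_st_three, st_two, st_three,
    List.append_nil] at h₂ h₃
  have : decide (x = y) = decide (code x = code y) := by
    simp [code_injective.eq_iff]
  rw [this]
  have h := h₁.andThen (h₂.andThen (h₃.andThen h₄))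
  simp only [code, List.cons_append, List.append_assoc] at h ⊢
  refine Within.mono h ?_
  simp only [List.length_cons, List.length_append]
  lia

end operations
end Prog

end DifferSAT

namespace DifferSAT

open BTree Prog Polynomial

/-! ### Functions computed by programs in polynomial time -/

/-- Types whose elements are represented by trees. -/
class Enc (α : Type) where
  /-- The tree that represents an element. -/
  enc : α → BTree
  enc_injective : Function.Injective enc

theorem BTree.ofBool_injective : Function.Injective ofBool := by
  intro a b h
  cases a <;> cases b <;> simp [ofBool] at h ⊢

/-- The tree that represents a list. -/
def BTree.ofList {α : Type} (f : α → BTree) : List α → BTree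
  | [] => leaf
  | a :: l => node (f a) (ofList f l)

theorem BTree.ofList_injective {α : Type} {f : α → BTree} (hf : Function.Injective f) :
    Function.Injective (ofList f) := by
  intro l
  induction l with
  | nil => intro m h; cases m <;> simp [ofList] at h ⊢
  | cons a l ih =>
    intro m h
    cases m with
    | nil => simp [ofList] at h
    | cons b m =>
      simp only [ofList, node.injEq] at h
      rw [hf h.1, ih h.2]

instance : Enc Bool := ⟨ofBool, ofBool_injective⟩

instance {α β : Type} [Enc α] [Enc β] : Enc (α × β) where
  enc x := node (Enc.enc x.1) (Enc.enc x.2)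
  enc_injective x y h := by
    simp only [node.injEq] at h
    exact Prod.ext (Enc.enc_injective h.1) (Enc.enc_injective h.2)

instance {α : Type} [Enc α] : Enc (List α) := ⟨ofList Enc.enc, ofList_injective Enc.enc_injective⟩

/-- The string of bits that represents an element. -/
def bits {α : Type} [Enc α] (a : α) : List Bool := code (Enc.enc a)

/-- The length of the string that represents an element. -/
def size {α : Type} [Enc α] (a : α) : ℕ := (bits a).length

variable {α β γ σ : Type} [Enc α] [Enc β] [Enc γ] [Enc σ]

@[simp] theorem bits_pair (a : α) (b : β) : bits (a, b) = true :: (bits a ++ bits b) := rfl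
@[simp] theorem bits_nil : bits ([] : List α) = [false] := rfl
@[simp] theorem bits_cons (a : α) (l : List α) : bits (a :: l) = true :: (bits a ++ bits l) := rfl
@[simp] theorem size_pair (a : α) (b : β) : size (a, b) = size a + size b + 1 := by simp [size]
@[simp] theorem size_nil : size ([] : List α) = 1 := rfl
@[simp] theorem size_cons (a : α) (l : List α) : size (a :: l) = size a + size l + 1 := by
  simp [size]

theorem size_pos (a : α) : 0 < size a := by
  unfold size bits
  cases Enc.enc a <;> simp [code]

theorem size_bool (b : Bool) : size b ≤ 3 := by cases b <;> decide

theorem size_append (l m : List α) : size (l ++ m) + 1 = size l + size m := by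
  induction l with
  | nil => simp [add_comm]
  | cons a l ih => simp; lia

theorem size_reverse (l : List α) : size l.reverse = size l := by
  induction l with
  | nil => rfl
  | cons a l ih =>
    have := size_append l.reverse [a]
    simp at this ⊢; lia

theorem length_le_size (l : List α) : l.length ≤ size l := by
  induction l with
  | nil => simp
  | cons a l ih => simp; lia

theorem size_le_of_mem {l : List α} {a : α} (h : a ∈ l) : size a ≤ size l := by
  induction l with
  | nil => simp at h
  | cons b l ih =>
    rcases List.mem_cons.1 h with rfl | h
    · simp; lia
    · have := ih h; simp; lia

theorem size_le_of_forall {l : List α} {n : ℕ} (h : ∀ a ∈ l, size a ≤ n) :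
    size l ≤ l.length * (n + 1) + 1 := by
  induction l with
  | nil => simp
  | cons b l ih =>
    have h₁ := ih fun a ha => h a (List.mem_cons_of_mem _ ha)
    have h₂ := h b List.mem_cons_self
    simp only [size_cons, List.length_cons, add_mul, one_mul]; lia

/-- Coefficients in `ℕ` are nonnegative. Monotonicity is what allows a size bound to be substituted
into a time bound. -/
theorem eval_mono (p : ℕ[X]) {m n : ℕ} (h : m ≤ n) : p.eval m ≤ p.eval n := by
  rw [eval_eq_sum_range, eval_eq_sum_range]
  gcongr

/-- `f` is computed by a program in polynomial time. The program finds its argument on top of stack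
`0` and replaces it by the value of `f`. -/
def PT (f : α → β) : Prop := ∃ (P : Prog) (p : ℕ[X]), ∀ a, size (f a) ≤ p.eval (size a) ∧
  ∀ s t, Within P (st (bits a ++ s) t [] [] []) (st (bits (f a) ++ s) t [] [] []) (p.eval (size a))

theorem PT.of_eq {f g : α → β} (h : PT f) (hfg : ∀ a, f a = g a) : PT g := by
  rwa [← show f = g from funext hfg]

/-- A change of type that leaves the code alone costs nothing; this covers coercions from subtypes,
and `cons`, whose code is that of a pair. -/
theorem PT.of_bits {f : α → β} (h : ∀ a, bits (f a) = bits a) : PT f := by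
  refine ⟨Prog.skip, X + 1, fun a => ⟨by simp [size, h], fun s t => ?_⟩⟩
  rw [h]
  exact (within_skip _).mono (by simp)

protected theorem PT.id : PT (fun a : α => a) := PT.of_bits fun _ => rfl

/-- The output size bound in `PT` is needed here: the second program runs on an input of size at
most `p.eval (size a)`. -/
theorem PT.comp {g : β → γ} {f : α → β} (hg : PT g) (hf : PT f) : PT (fun a => g (f a)) := by
  obtain ⟨P, p, hP⟩ := hf
  obtain ⟨Q, q, hQ⟩ := hg
  refine ⟨Prog.seq P Q, p + q.comp p, fun a => ⟨?_, fun s t => ?_⟩⟩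
  · have := (hQ (f a)).1.trans (eval_mono q (hP a).1)
    simp; lia
  · exact (((hP a).2 s t).andThen ((hQ (f a)).2 s t)).mono
      (by simpa using eval_mono q (hP a).1)

/-- The argument is saved on stack `1` while `g` is computed, then restored on top of the result for
`f`; a final bit `true` joins the two codes. The second component comes first because it must end up
below. This uses that programs respect whatever lies underneath on the stacks `0` and `1`. -/
theorem PT.pair {f : α → β} {g : α → γ} (hf : PT f) (hg : PT g) : PT (fun a => (f a, g a)) := by
  obtain ⟨P, p, hP⟩ := hf
  obtain ⟨Q, q, hQ⟩ := hg
  refine ⟨Prog.seq copy (Prog.seq Q (Prog.seq restore (Prog.seq P (Prog.push 0 true)))),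
    p + q + 19 * X + 15, fun a => ⟨?_, fun s t => ?_⟩⟩
  · have h₁ := (hP a).1
    have h₂ := (hQ a).1
    simp; lia
  · have h := (within_copy (x := Enc.enc a) (s := s) (t := t)).andThen
      (((hQ a).2 s (bits a ++ t)).andThen
      ((within_restore (x := Enc.enc a) (s := bits (g a) ++ s) (t := t)).andThen
      (((hP a).2 (bits (g a) ++ s) t).andThen (within_push 0 true _))))
    simp only [update_st_zero, st_zero] at h
    simp only [bits_pair, List.cons_append, List.append_assoc]
    refine Within.mono h ?_
    simp [size, bits]; lia

/-- Replace a pair on stack `0` by its first component. -/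
def Prog.fst : Prog :=
  Prog.case 0 Prog.skip (Prog.push 0 false) (Prog.seq save (Prog.seq drop restore))

/-- Replace a pair on stack `0` by its second component. -/
def Prog.snd : Prog := Prog.case 0 Prog.skip (Prog.push 0 false) drop

section
variable {x y : BTree} {s t : List Bool}

theorem Prog.within_fst : Within Prog.fst (st (code (node x y) ++ s) t [] [] [])
    (st (code x ++ s) t [] [] []) (18 * (code (node x y)).length + 22) := by
  have h := (within_save (x := x) (s := code y ++ s) (t := t)).andThen
    ((within_drop (x := y) (s := s) (t := code x ++ t)).andThen
    (within_restore (x := x) (s := s) (t := t)))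
  refine (within_case_true (l := code x ++ (code y ++ s)) (by simp [code])
    (by simpa using h)).mono ?_
  simp [code]; lia

theorem Prog.within_snd : Within Prog.snd (st (code (node x y) ++ s) t [] [] [])
    (st (code y ++ s) t [] [] []) (18 * (code (node x y)).length + 22) := by
  refine (within_case_true (l := code x ++ (code y ++ s)) (by simp [code])
    (by simpa using within_drop (x := x) (s := code y ++ s) (t := t))).mono ?_
  simp [code]; lia

theorem Prog.within_fst_leaf : Within Prog.fst (st (code leaf ++ s) t [] [] [])
    (st (code leaf ++ s) t [] [] []) 2 :=
  within_case_false (l := s) rfl (by simpa [code] using within_push 0 false (st s t [] [] []))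

theorem Prog.within_snd_leaf : Within Prog.snd (st (code leaf ++ s) t [] [] [])
    (st (code leaf ++ s) t [] [] []) 2 :=
  within_case_false (l := s) rfl (by simpa [code] using within_push 0 false (st s t [] [] []))

end

protected theorem PT.fst : PT (Prod.fst : α × β → α) := by
  refine ⟨Prog.fst, 18 * X + 22, fun ⟨a, b⟩ => ⟨by simp; lia, fun s t => ?_⟩⟩
  exact (Prog.within_fst (x := Enc.enc a) (y := Enc.enc b) (s := s) (t := t)).mono
    (le_of_eq (by simp only [eval_add, eval_mul, eval_ofNat, eval_X]; rfl))

protected theorem PT.snd : PT (Prod.snd : α × β → β) := by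
  refine ⟨Prog.snd, 18 * X + 22, fun ⟨a, b⟩ => ⟨by simp; lia, fun s t => ?_⟩⟩
  exact (Prog.within_snd (x := Enc.enc a) (y := Enc.enc b) (s := s) (t := t)).mono
    (le_of_eq (by simp only [eval_add, eval_mul, eval_ofNat, eval_X]; rfl))

/-- A nonempty list has the code of the pair of its head and tail, and `Prog.snd` puts a leaf, the
code of `[]`, back unchanged. -/
theorem PT.tail : PT (List.tail : List α → List α) := by
  refine ⟨Prog.snd, 18 * X + 22, fun l => ⟨?_, fun s t => ?_⟩⟩
  · cases l <;> simp; lia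
  · cases l with
    | nil => exact Prog.within_snd_leaf.mono (by simp)
    | cons a l =>
      exact (Prog.within_snd (x := Enc.enc a) (y := Enc.enc l) (s := s) (t := t)).mono
        (le_of_eq (by simp only [eval_add, eval_mul, eval_ofNat, eval_X]; rfl))

/-- For lists of lists the default `[]` is a leaf, exactly what `Prog.fst` leaves when the list is
empty. -/
theorem PT.headD : PT (fun l : List (List α) => l.headD []) := by
  refine ⟨Prog.fst, 18 * X + 22, fun l => ⟨?_, fun s t => ?_⟩⟩
  · cases l <;> simp; lia
  · cases l with
    | nil => exact Prog.within_fst_leaf.mono (by simp)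
    | cons a l =>
      exact (Prog.within_fst (x := Enc.enc a) (y := Enc.enc l) (s := s) (t := t)).mono
        (le_of_eq (by simp only [eval_add, eval_mul, eval_ofNat, eval_X]; rfl))

theorem PT.const (b : β) : PT (fun _ : α => b) := by
  refine ⟨Prog.seq drop (pushList (bits b)), 9 * X + C (size b + 8), fun a => ⟨by simp; lia,
    fun s t => ?_⟩⟩
  refine ((within_drop (x := Enc.enc a)).andThen (within_pushList (bits b))).mono ?_
  simp [size, bits]
  lia

theorem PT.eq [DecidableEq β] {f g : α → β} (hf : PT f) (hg : PT g) :
    PT (fun a => decide (f a = g a)) := by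
  have : PT (fun x : β × β => decide (x.1 = x.2)) := by
    refine ⟨eqTest, 9 * X + 27, fun a => ⟨(size_bool _).trans (by simp), fun s t => ?_⟩⟩
    classical
    have h := within_eqTest (x := Enc.enc a.1) (y := Enc.enc a.2) (s := s) (t := t)
    have h' : decide (a.1 = a.2) = @decide (Enc.enc a.1 = Enc.enc a.2) (Classical.propDecidable _) := by
      simp [Enc.enc_injective.eq_iff]
    change Within eqTest _ (st (bits (decide (a.1 = a.2)) ++ s) t [] [] []) _
    rw [h']
    exact Within.mono h (le_of_eq (by simp only [eval_add, eval_mul, eval_ofNat, eval_X]; rfl))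
  exact this.comp (hf.pair hg)

theorem PT.ite {c : α → Bool} {f g : α → β} (hc : PT c) (hf : PT f) (hg : PT g) :
    PT (fun a => if c a then f a else g a) := by
  obtain ⟨R, r, hR⟩ := hc
  obtain ⟨P, p, hP⟩ := hf
  obtain ⟨Q, q, hQ⟩ := hg
  -- The code of `true` has three bits: after `case` has popped the first, two leaf bits remain to
  -- be popped.
  refine ⟨Prog.seq copy (Prog.seq R (Prog.case 0 Prog.skip (Prog.seq restore Q)
    (Prog.seq pop (Prog.seq pop (Prog.seq restore P))))),
    r + p + q + 19 * X + 19, fun a => ⟨?_, fun s t => ?_⟩⟩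
  · have h₁ := (hP a).1
    have h₂ := (hQ a).1
    dsimp only
    split <;> simp <;> lia
  · refine ((within_copy (x := Enc.enc a) (s := s) (t := t)).andThen
      (((hR a).2 s (bits a ++ t)).andThen (U := st (bits (if c a then f a else g a) ++ s) t [] [] [])
      (n := 9 * size a + 12 + p.eval (size a) + q.eval (size a)) ?_)).mono ?_
    · have h₀ : Within restore (st s (bits a ++ t) [] [] []) _ _ :=
        within_restore (x := Enc.enc a) (s := s) (t := t)
      cases c a with
      | false =>
        have h := h₀.andThen ((hQ a).2 s t)
        refine (within_case_false (l := s) rfl (by simpa using h)).mono ?_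
        simp [size, bits]; lia
      | true =>
        have h := (within_pop (b := false)).andThen ((within_pop (b := false)).andThen
          (h₀.andThen ((hP a).2 s t)))
        refine (within_case_true (l := false :: false :: s) rfl (by simpa using h)).mono ?_
        simp [size, bits]; lia
    · simp [size, bits]; lia

/-- Push `true` on stack `4` if the first component of the pair on stack `0` is not a leaf. -/
def Prog.testFst : Prog :=
  Prog.seq pop (Prog.case 0 Prog.skip (Prog.seq (Prog.push 0 false) (Prog.push 0 true))
    (Prog.seq (Prog.push 0 true) (Prog.seq (Prog.push 0 true) (Prog.push 4 true))))

theorem Prog.within_testFst (l : List α) (b : β) (s t : List Bool) :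
    Within testFst (st (bits (l, b) ++ s) t [] [] [])
      (st (bits (l, b) ++ s) t [] [] (if l = [] then [] else [true])) 6 := by
  have h₀ := within_pop (b := true) (s := bits l ++ (bits b ++ s)) (t := t) (c := []) (d := [])
    (e := [])
  cases l with
  | nil =>
    have h := h₀.andThen (within_case_false (k := 0) (P := Prog.skip)
      (R := Prog.seq (Prog.push 0 true) (Prog.seq (Prog.push 0 true) (Prog.push 4 true)))
      (l := bits b ++ s) rfl ((within_push 0 false _).andThen (within_push 0 true _)))
    exact Within.mono (by simpa [testFst] using h) (by simp)
  | cons a l =>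
    have h := h₀.andThen (within_case_true (k := 0) (P := Prog.skip)
      (Q := Prog.seq (Prog.push 0 false) (Prog.push 0 true))
      (l := bits a ++ (bits l ++ (bits b ++ s))) (by simp)
      ((within_push 0 true _).andThen ((within_push 0 true _).andThen (within_push 4 true _))))
    exact Within.mono (by simpa [testFst] using h) (by simp)

/-- Iterating a polynomial-time step can blow up exponentially, so a polynomial bound on all
intermediate accumulators is assumed. The loop works on the remaining list, the accumulator and the
parameter `x`, which is carried along; `testFst` sets the flag for another round while the list is
nonempty. -/
theorem PT.foldl {l : γ → List α} {i : γ → σ} {g : (α × σ) × γ → σ} (hl : PT l) (hi : PT i)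
    (hg : PT g) (q : ℕ[X]) (hq : ∀ x l₁ l₂, l x = l₁ ++ l₂ →
      size (l₁.foldl (fun s a => g ((a, s), x)) (i x)) ≤ q.eval (size x)) :
    PT (fun x => (l x).foldl (fun s a => g ((a, s), x)) (i x)) := by
  have hI : PT (fun x => (l x, (i x, x))) := hl.pair (hi.pair PT.id)
  have hB : PT (fun y : (α × List α) × (σ × γ) => (y.1.2, (g ((y.1.1, y.2.1), y.2.2), y.2.2))) :=
    (PT.snd.comp PT.fst).pair ((hg.comp (((PT.fst.comp PT.fst).pair (PT.fst.comp PT.snd)).pair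
      (PT.snd.comp PT.snd))).pair (PT.snd.comp PT.snd))
  have hE : PT (fun y : List α × (σ × γ) => y.2.1) := PT.fst.comp PT.snd
  obtain ⟨I, pI, hI⟩ := hI
  obtain ⟨B, pB, hB⟩ := hB
  obtain ⟨E, pE, hE⟩ := hE
  obtain ⟨_, pl, hl⟩ := hl
  have key : ∀ x s t l₂ l₁, l x = l₁ ++ l₂ →
      Within (loop 4 (Prog.seq B testFst))
        (st (bits (l₂, (l₁.foldl (fun s a => g ((a, s), x)) (i x), x)) ++ s) t [] []
          (if l₂ = [] then [] else [true]))
        (st (bits (([] : List α), ((l x).foldl (fun s a => g ((a, s), x)) (i x), x)) ++ s) t [] [] [])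
        -- A round runs the body, `testFst` in 6 steps, and one pop of the flag; the final 1 is the
        -- pop that ends the loop.
        (l₂.length * (pB.eval (pl.eval (size x) + q.eval (size x) + size x + 2) + 7) + 1) := by
    intro x s t l₂
    induction l₂ with
    | nil =>
      intro l₁ h
      rw [List.append_nil] at h
      rw [h]
      exact (within_loop_nil rfl).mono (by simp)
    | cons a l₂ ih =>
      intro l₁ h
      have h₁ := ih (l₁ ++ [a]) (by simp [h])
      -- The code of `a :: l₂` is that of the pair `(a, l₂)`, so the body reads head and tail
      -- directly.
      have h₂ := (hB ((a, l₂), (l₁.foldl (fun s a => g ((a, s), x)) (i x), x))).2 s t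
      have h₃ := within_testFst l₂ (g ((a, l₁.foldl (fun s a => g ((a, s), x)) (i x)), x), x) s t
      have h₄ := within_loop_true (k := 4) (l := [])
        (S := st (bits (a :: l₂, (l₁.foldl (fun s a => g ((a, s), x)) (i x), x)) ++ s) t [] [] [true])
        rfl (P := Prog.seq B testFst) (by rw [update_st_four]; exact h₂.andThen h₃)
        (by simpa using h₁)
      refine Within.mono (by simpa [-size_pair] using h₄) ?_
      have h₅ : size ((a, l₂), (l₁.foldl (fun s a => g ((a, s), x)) (i x), x)) ≤
          pl.eval (size x) + q.eval (size x) + size x + 2 := by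
        have e₁ := hq x l₁ _ h
        have e₂ := (hl x).1
        have e₃ := size_append l₁ (a :: l₂)
        have e₄ := size_pos l₁
        rw [← h] at e₃
        simp at e₃ ⊢
        lia
      have h₆ := eval_mono pB h₅
      simp only [List.length_cons, add_mul, one_mul]
      omega
  refine ⟨Prog.seq I (Prog.seq testFst (Prog.seq (loop 4 (Prog.seq B testFst)) E)),
    pI + 7 + pl * (pB.comp (pl + q + X + 2) + 7) + pE.comp (q + X + 3) + q,
    fun x => ⟨(hq x (l x) [] (by simp)).trans (by simp), fun s t => ?_⟩⟩
  have h₁ := (hI x).2 s t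
  have h₂ := within_testFst (l x) (i x, x) s t
  have h₃ := key x s t (l x) [] rfl
  have h₄ := (hE ([], ((l x).foldl (fun s a => g ((a, s), x)) (i x), x))).2 s t
  refine Within.mono (h₁.andThen (h₂.andThen (h₃.andThen h₄))) ?_
  have e₁ : size (([] : List α), ((l x).foldl (fun s a => g ((a, s), x)) (i x), x)) ≤
      q.eval (size x) + size x + 3 := by
    have := hq x (l x) [] (by simp)
    simp; lia
  have e₂ := eval_mono pE e₁
  have e₃ : (l x).length ≤ pl.eval (size x) := (length_le_size _).trans (hl x).1
  have e₄ := Nat.mul_le_mul_right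
    (pB.eval (pl.eval (size x) + q.eval (size x) + size x + 2) + 7) e₃
  simp only [eval_add, eval_mul, eval_comp, eval_X, eval_ofNat]
  omega

end DifferSAT

namespace DifferSAT

open BTree Prog Polynomial

/-! ### List operations in polynomial time. -/

section lists
variable {α β γ σ : Type} [Enc α] [Enc β] [Enc γ] [Enc σ]

theorem PT.cons {f : γ → α} {l : γ → List α} (hf : PT f) (hl : PT l) : PT (fun x => f x :: l x) :=
  PT.comp (g := fun y : α × List α => y.1 :: y.2) (PT.of_bits fun _ => rfl) (hf.pair hl)

theorem PT.reverse {l : γ → List α} (hl : PT l) : PT (fun x => (l x).reverse) := by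
  have hl' := hl
  obtain ⟨_, p, hp⟩ := hl'
  have hf : ∀ (l m : List α), l.foldl (fun s a => a :: s) m = l.reverse ++ m := by
    intro l; induction l <;> simp_all
  refine (PT.foldl (g := fun y : (α × List α) × γ => y.1.1 :: y.1.2) hl (PT.const [])
    ((PT.fst.comp PT.fst).cons (PT.snd.comp PT.fst)) p fun x l₁ l₂ h => ?_).of_eq fun x => ?_
  · have h₁ := size_append l₁ l₂
    rw [← h] at h₁
    have h₂ := (hp x).1
    have h₃ := size_pos l₂
    rw [hf, List.append_nil, size_reverse]
    lia
  · simp [hf]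

theorem PT.append {l m : γ → List α} (hl : PT l) (hm : PT m) : PT (fun x => l x ++ m x) := by
  have hl' := hl
  have hm' := hm
  obtain ⟨_, p, hp⟩ := hl'
  obtain ⟨_, q, hq⟩ := hm'
  have hf : ∀ (l m : List α), l.foldl (fun s a => a :: s) m = l.reverse ++ m := by
    intro l; induction l <;> simp_all
  refine (PT.foldl (g := fun y : (α × List α) × γ => y.1.1 :: y.1.2) hl.reverse hm
    ((PT.fst.comp PT.fst).cons (PT.snd.comp PT.fst)) (p + q) fun x l₁ l₂ h => ?_).of_eq fun x => ?_
  · have h₁ := size_append l₁ l₂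
    rw [← h, size_reverse] at h₁
    have h₂ := (hp x).1
    have h₃ := size_pos l₂
    have h₄ := (hq x).1
    have h₅ := size_append l₁.reverse (m x)
    rw [size_reverse] at h₅
    rw [hf, eval_add]
    lia
  · simp [hf]

theorem size_flatMap_le {δ : Type} {l : List δ} {g : δ → List β} {n : ℕ} (h : ∀ a ∈ l, size (g a) ≤ n) :
    size (l.flatMap g) ≤ l.length * n + 1 := by
  induction l with
  | nil => simp
  | cons a l ih =>
    have h₁ := ih fun a ha => h a (List.mem_cons_of_mem _ ha)
    have h₂ := h a List.mem_cons_self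
    have h₃ := size_append (g a) (l.flatMap g)
    simp only [List.flatMap_cons, List.length_cons, add_mul, one_mul]
    lia

/-- The fold prepends, hence runs over the reversed list. At most `p` values are joined, each of
size at most `q` of the size of a pair `(a, x)`, which is at most `p + X + 1`. -/
theorem PT.flatMap {l : γ → List α} {g : α × γ → List β} (hl : PT l) (hg : PT g) :
    PT (fun x => (l x).flatMap fun a => g (a, x)) := by
  have hl' := hl
  have hg' := hg
  obtain ⟨_, p, hp⟩ := hl'
  obtain ⟨_, q, hq⟩ := hg'
  have hf : ∀ (x : γ) (l : List α) (m : List β), l.foldl (fun s a => g (a, x) ++ s) m =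
      l.reverse.flatMap (fun a => g (a, x)) ++ m := by
    intro x l; induction l <;> simp_all
  refine (PT.foldl (g := fun y : (α × List β) × γ => g (y.1.1, y.2) ++ y.1.2) hl.reverse
    (PT.const []) ((hg.comp ((PT.fst.comp PT.fst).pair PT.snd)).append (PT.snd.comp PT.fst))
    (p * q.comp (p + X + 1) + 1) fun x l₁ l₂ h => ?_).of_eq fun x => ?_
  · rw [hf, List.append_nil]
    have h₁ : size (l₁.reverse.flatMap fun a => g (a, x)) ≤
        l₁.reverse.length * q.eval (p.eval (size x) + size x + 1) + 1 := by
      refine size_flatMap_le fun a ha => (hq _).1.trans (eval_mono q ?_)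
      have h₂ : a ∈ l x := by
        rw [← List.mem_reverse, h]; simp at ha; simp [ha]
      have h₃ := (size_le_of_mem h₂).trans (hp x).1
      simp; lia
    have h₂ : l₁.reverse.length ≤ p.eval (size x) := by
      refine le_trans ?_ ((length_le_size _).trans (hp x).1)
      rw [← List.length_reverse (as := l x), h]; simp
    refine h₁.trans ?_
    have := Nat.mul_le_mul_right (q.eval (p.eval (size x) + size x + 1)) h₂
    simpa using this
  · simp [hf]

theorem PT.map {l : γ → List α} {g : α × γ → β} (hl : PT l) (hg : PT g) :
    PT (fun x => (l x).map fun a => g (a, x)) :=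
  (PT.flatMap hl (hg.cons (PT.const []))).of_eq fun _ => (List.map_eq_flatMap ..).symm

theorem PT.filter {l : γ → List α} {c : α × γ → Bool} (hl : PT l) (hc : PT c) :
    PT (fun x => (l x).filter fun a => c (a, x)) := by
  refine (PT.flatMap hl (hc.ite (PT.fst.cons (PT.const [])) (PT.const []))).of_eq fun x => ?_
  induction l x with
  | nil => rfl
  | cons a l ih => simp only [List.flatMap_cons, List.filter_cons, ih]; split <;> rfl

theorem PT.not {c : γ → Bool} (hc : PT c) : PT (fun x => !c x) :=
  (hc.ite (PT.const false) (PT.const true)).of_eq fun x => by cases c x <;> rfl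

theorem PT.and {c d : γ → Bool} (hc : PT c) (hd : PT d) : PT (fun x => c x && d x) :=
  (hc.ite hd (PT.const false)).of_eq fun x => by cases c x <;> rfl

theorem PT.isEmpty {l : γ → List α} (hl : PT l) : PT (fun x => (l x).isEmpty) := by
  classical
  exact (PT.eq hl (PT.const [])).of_eq fun x => by cases l x <;> simp

theorem PT.any {l : γ → List α} {c : α × γ → Bool} (hl : PT l) (hc : PT c) :
    PT (fun x => (l x).any fun a => c (a, x)) := by
  refine (hl.filter hc).isEmpty.not.of_eq fun x => ?_
  induction l x with
  | nil => rfl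
  | cons a l ih => rw [List.filter_cons, List.any_cons, ← ih]; cases c (a, x) <;> simp

end lists

/-! ### The machine of a program -/

section machine

open Computability Turing.TM2.Stmt

/-- Symbols are represented by lists of bits. -/
def symbolBits : Γ' → List Bool
  | Γ'.blank => []
  | Γ'.bit b => [b]
  | Γ'.bra => [false, false]
  | Γ'.ket => [true, true]
  | Γ'.comma => [false, true]

theorem symbolBits_injective : Function.Injective symbolBits := by
  intro a b h
  cases a <;> cases b <;> simp_all [symbolBits]

instance : Enc Γ' := ⟨fun s => Enc.enc (symbolBits s), Enc.enc_injective.comp symbolBits_injective⟩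

instance {α : Type} [Enc α] (p : α → Prop) : Enc {a // p a} :=
  ⟨fun a => Enc.enc a.1, Enc.enc_injective.comp Subtype.val_injective⟩

theorem size_symbol (s : Γ') : size s ≤ 9 := by
  rcases s with _ | (_ | _) | _ | _ | _ <;> decide

theorem size_symbols (l : List Γ') : size l ≤ 10 * l.length + 1 := by
  have := size_le_of_forall (l := l) (n := 9) fun a _ => size_symbol a
  lia

/-- The labels of the machine of a program: those of the program; one for every input symbol; and
those at which the machine starts, reads an input symbol, and ends. -/
abbrev MachineLab (P : Prog) : Type := P.Lab ⊕ (Γ' ⊕ Fin 3)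

/-- Push a list of bits on stack `0`, and go on with `q`. -/
def pushBits {Λ : Type} (q : Turing.TM2.Stmt Alphabet Λ Memory) :
    List Bool → Turing.TM2.Stmt Alphabet Λ Memory
  | [] => q
  | b :: l => pushBits (Turing.TM2.Stmt.push (some 0) (fun _ => b) q) l

/-- The statements of the machine of a program. -/
def machineStmt (P : Prog) : MachineLab P → Turing.TM2.Stmt Alphabet (MachineLab P) Memory
  | Sum.inl l => P.stmt Sum.inl (Sum.inr (Sum.inr 2)) l
  | Sum.inr (Sum.inl s) =>
    pushBits (load (fun _ => none) (goto fun _ => Sum.inr (Sum.inr 1))) (true :: bits s)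
  | Sum.inr (Sum.inr 0) =>
    Turing.TM2.Stmt.push (some 0) (fun _ => false) (goto fun _ => Sum.inr (Sum.inr 1))
  | Sum.inr (Sum.inr 1) =>
    Turing.TM2.Stmt.pop none (fun _ (o : Option Γ') => o)
      (goto fun v => v.elim (Sum.inl P.start) fun s => Sum.inr (Sum.inl s))
  | Sum.inr (Sum.inr 2) =>
    Turing.TM2.Stmt.pop (some 0) (fun _ (o : Option Bool) => o.map Γ'.bit)
      (branch (fun v => decide (v = some (Γ'.bit true)))
        (load (fun _ => none) (Turing.TM2.Stmt.pop (some 0) (fun v _ => v)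
          (Turing.TM2.Stmt.pop (some 0) (fun v _ => v)
            (Turing.TM2.Stmt.push (some 0) (fun _ => true) halt))))
        (load (fun _ => none) (Turing.TM2.Stmt.push (some 0) (fun _ => false) halt)))

/-- The multi-stack Turing machine of a program. -/
noncomputable def machine (P : Prog) : Turing.FinTM2 where
  K := Option (Fin 5)
  k₀ := none
  k₁ := some 0
  Γ := Alphabet
  Λ := MachineLab P
  main := Sum.inr (Sum.inr 0)
  ΛFin := Fintype.ofFinite _
  σ := Memory
  initialState := none
  Γk₀Fin := inferInstanceAs (Fintype Γ')
  m := machineStmt P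

/-- The stacks of the machine while the input is read. -/
def tapes (i : List Γ') (a : List Bool) : ∀ k, List (Alphabet k)
  | none => i
  | some k => st a [] [] [] [] k

theorem tapes_nil (a : List Bool) : tapes [] a = Store.full (st a [] [] [] []) := by
  funext k; cases k <;> rfl

theorem update_tapes (i : List Γ') (a b : List Bool) :
    Function.update (tapes i a) (some 0) b = tapes i b := by
  funext k
  rcases k with _ | k
  · rfl
  · fin_cases k <;> rfl

theorem update_tapes_none (i j : List Γ') (a : List Bool) :
    Function.update (tapes i a) none j = tapes j a := by
  funext k
  rcases k with _ | k
  · rfl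
  · fin_cases k <;> rfl

theorem stepAux_pushBits {Λ : Type} (q : Turing.TM2.Stmt Alphabet Λ Memory) (v : Memory)
    (i : List Γ') (l a : List Bool) : Turing.TM2.stepAux (pushBits q l) v (tapes i a) =
      Turing.TM2.stepAux q v (tapes i (l ++ a)) := by
  induction l generalizing q with
  | nil => rfl
  | cons b l ih =>
    rw [pushBits, ih, Turing.TM2.stepAux, update_tapes]; rfl

/-- Stack `0` always holds the code of a list: pushing `true :: bits s` conses `s`, so the input
ends up reversed. Each symbol takes two steps, a pop and a push, and one more step detects the end.
-/
theorem steps_read (P : Prog) (i : List Γ') : ∀ l : List Γ',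
    Steps (machineStmt P) ⟨some (Sum.inr (Sum.inr 1)), none, tapes i (bits l)⟩
      ⟨some (Sum.inl P.start), none, Store.full (st (bits (i.reverse ++ l)) [] [] [] [])⟩
      (2 * i.length + 1) := by
  induction i with
  | nil =>
    intro l
    refine Steps.one ?_
    simp only [machineStmt, Turing.TM2.stepAux]
    have : tapes [] (bits l) none = [] := rfl
    rw [this, List.tail_nil, update_tapes_none, tapes_nil]
    rfl
  | cons s i ih =>
    intro l
    have h₁ : Steps (machineStmt P) ⟨some (Sum.inr (Sum.inr 1)), none, tapes (s :: i) (bits l)⟩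
        ⟨some (Sum.inr (Sum.inl s)), some s, tapes i (bits l)⟩ 1 := by
      refine Steps.one ?_
      simp only [machineStmt, Turing.TM2.stepAux]
      have : tapes (s :: i) (bits l) none = s :: i := rfl
      rw [this]
      simp [update_tapes_none]
    have h₂ : Steps (machineStmt P) ⟨some (Sum.inr (Sum.inl s)), some s, tapes i (bits l)⟩
        ⟨some (Sum.inr (Sum.inr 1)), none, tapes i (bits (s :: l))⟩ 1 := by
      refine Steps.one ?_
      simp only [machineStmt, stepAux_pushBits, Turing.TM2.stepAux]
      simp
    have h := h₁.trans (h₂.trans (ih (s :: l)))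
    have e : 1 + (1 + (2 * i.length + 1)) = 2 * (s :: i).length + 1 := by simp; lia
    rw [e] at h
    simpa using h

theorem steps_end (P : Prog) (b : Bool) :
    Steps (machineStmt P) ⟨some (Sum.inr (Sum.inr 2)), none, Store.full (st (bits b) [] [] [] [])⟩
      ⟨none, none, tapes [] [b]⟩ 1 := by
  refine Steps.one ?_
  rw [← tapes_nil]
  simp only [machineStmt, Turing.TM2.stepAux]
  have : tapes [] (bits b) (some 0) = bits b := rfl
  rw [this]
  cases b
  · simp [bits, Enc.enc, code, ofBool, update_tapes]
  · simp [bits, Enc.enc, code, ofBool, update_tapes]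

/-- The function need only be in `PT` on the reversed strings that satisfy `p`, so time bounds may
use that the input is a genuine instance. -/
theorem polyTimeDecidable_of_PT {α : Type} {en : α → List Γ'} {Q : α → Prop} {p : List Γ' → Prop}
    {f : {l // p l} → Bool} (hf : PT f) (hp : ∀ a, p (en a).reverse)
    (h : ∀ a, f ⟨(en a).reverse, hp a⟩ = true ↔ Q a) : PolyTimeDecidable en Q := by
  classical
  obtain ⟨P, t, hP⟩ := hf
  suffices key : ∀ a, Nonempty (Turing.TM2OutputsInTime (machine P)
      ((en a).map (Equiv.refl Γ').invFun)
      (some ((encodeBool (decide (Q a))).map (Equiv.refl Bool).invFun))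
      -- `10 * X + 1` bounds the code of the input; reading takes two steps per symbol. The 3 counts
      -- the first push, the pop at the end of the input, and the final output step.
      ((t.comp (10 * X + 1) + 2 * X + 3).eval (en a).length)) from
    ⟨{tm := machine P
      inputAlphabet := Equiv.refl _
      outputAlphabet := Equiv.refl _
      time := t.comp (10 * X + 1) + 2 * X + 3
      outputsFun := fun a => (key a).some}⟩
  intro a
  have h₀ : Steps (machineStmt P) ⟨some (Sum.inr (Sum.inr 0)), none, tapes (en a) []⟩
      ⟨some (Sum.inr (Sum.inr 1)), none, tapes (en a) (bits ([] : List Γ'))⟩ 1 := by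
    refine Steps.one ?_
    simp only [machineStmt, Turing.TM2.stepAux, update_tapes]
    rfl
  have h₁ := steps_read P (en a) []
  obtain ⟨n, hn, hr⟩ := (hP ⟨(en a).reverse, hp a⟩).2 [] []
  have h₂ := hr.steps (M := machineStmt P) Sum.inl (Sum.inr (Sum.inr 2)) fun l => rfl
  have h₃ := steps_end P (f ⟨(en a).reverse, hp a⟩)
  simp only [List.append_nil] at h₁ h₂
  have hs := h₀.trans (h₁.trans (h₂.trans h₃))
  refine ⟨⟨⟨1 + (2 * (en a).length + 1 + (n + 1)), ?_⟩, ?_⟩⟩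
  · have e₁ : Turing.initList (machine P) ((en a).map (Equiv.refl Γ').invFun) =
        ⟨some (Sum.inr (Sum.inr 0)), none, tapes (en a) []⟩ := by
      have : ∀ k, (Turing.initList (machine P) ((en a).map (Equiv.refl Γ').invFun)).stk k =
          tapes (en a) [] k := by
        rintro (_ | k)
        · simp [Turing.initList, machine, tapes]
          rfl
        · fin_cases k <;> rfl
      exact congrArg (Turing.TM2.Cfg.mk _ _) (funext this)
    have e₂ : Turing.haltList (machine P)
        ((encodeBool (decide (Q a))).map (Equiv.refl Bool).invFun) =
        ⟨none, none, tapes [] [f ⟨(en a).reverse, hp a⟩]⟩ := by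
      have e : decide (Q a) = f ⟨(en a).reverse, hp a⟩ := by
        rw [Bool.eq_iff_iff, h a, decide_eq_true_iff]
      rw [e]
      have : ∀ k, (Turing.haltList (machine P)
          ((encodeBool (f ⟨(en a).reverse, hp a⟩)).map (Equiv.refl Bool).invFun)).stk k =
          tapes [] [f ⟨(en a).reverse, hp a⟩] k := by
        rintro (_ | k)
        · rfl
        · fin_cases k <;> rfl
      exact congrArg (Turing.TM2.Cfg.mk _ _) (funext this)
    exact (congrArg _ (congrArg some e₁)).trans (Eq.trans hs (congrArg some e₂.symm))
  · have e₁ := size_symbols (en a).reverse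
    rw [List.length_reverse] at e₁
    have e₂ := hn.trans (eval_mono t e₁)
    simp
    lia

end machine

end DifferSAT

namespace DifferSAT

open Polynomial

/-! ### The algorithm

Variables are represented by their names in binary, and a literal is the list that consists of its
sign and of the name of its variable. A pair of assignments is represented by a row: the list of the
literals that are true under the first and the second assignment, for some of the variables, and the
number of variables on which they differ. -/

open Computability in
/-- The string that represents a literal. -/
def litBits (l : Literal) : List Bool := l.2 :: encodeNat l.1

/-- The next number in binary. -/
def incr : List Bool → List Bool
  | [] => [true]
  | false :: l => true :: l
  | true :: l => false :: incr l

/-- A list of pairs of true literals, and a number in binary. -/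
abbrev Row : Type := List (List Bool × List Bool) × List Bool

/-- The remaining clauses; the list of the variables that the rows deal with; the rows. -/
abbrev SearchState : Type := (List (List (List Bool)) × List (List Bool)) × List Row

/-- Does the clause contain one of the given variables? -/
def touches (c : List (List Bool)) (F : List (List Bool)) : Bool :=
  c.any fun l => F.any fun x => decide (l.tail = x)

/-- Does the variable occur in one of the clauses? -/
def occurs (x : List Bool) (R : List (List (List Bool))) : Bool := R.any fun c => touches c [x]

/-- The clause to be processed next: one that contains one of the given variables, if possible. -/
def selectClause (R : List (List (List Bool))) (F : List (List Bool)) : List (List Bool) :=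
  ((R.filter fun c => touches c F) ++ R).headD []

/-- The extensions of a row to a new variable. -/
def extensions (x : List Bool) (r : Row) : List Row :=
  [((false :: x, false :: x) :: r.1, r.2), ((false :: x, true :: x) :: r.1, incr r.2),
    ((true :: x, false :: x) :: r.1, incr r.2), ((true :: x, true :: x) :: r.1, r.2)]

/-- Extend the rows to a variable. -/
def introduce (x : List Bool) (s : List (List Bool) × List Row) : List (List Bool) × List Row :=
  if s.1.any fun y => decide (y = x) then s else (x :: s.1, s.2.flatMap fun r => extensions x r)

/-- Extend the rows to the variable of the first literal of a clause. -/
def introduceHead (c : List (List Bool)) (s : List (List Bool) × List Row) :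
    List (List Bool) × List Row :=
  if c.isEmpty then s else introduce (c.headD []).tail s

/-- Do both assignments satisfy the clause? -/
def rowSatisfies (c : List (List Bool)) (E : List (List Bool × List Bool)) : Bool :=
  (c.any fun l => E.any fun e => decide (e.1 = l)) && c.any fun l => E.any fun e => decide (e.2 = l)

/-- Process a clause with at most two literals. -/
def processClause (c : List (List Bool)) (s : List (List Bool) × List Row) :
    List (List Bool) × List Row :=
  ((introduceHead c.tail (introduceHead c s)).1,
    (introduceHead c.tail (introduceHead c s)).2.filter fun r => rowSatisfies c r.1)

/-- Restrict the rows to the variables that occur in the given clauses. -/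
def forget (R : List (List (List Bool))) (s : List (List Bool) × List Row) :
    List (List Bool) × List Row :=
  (s.1.filter fun x => occurs x R,
    (s.2.map fun r => (r.1.filter fun e => occurs e.1.tail R, r.2)).foldl
      (fun t r => if t.any fun r' => decide (r' = r) then t else r :: t) [])

/-- Process the given clause. -/
def searchWith (c : List (List Bool)) (s : SearchState) : SearchState :=
  ((s.1.1.filter fun c' => !decide (c' = c),
    (forget (s.1.1.filter fun c' => !decide (c' = c)) (processClause c (s.1.2, s.2))).1),
    (forget (s.1.1.filter fun c' => !decide (c' = c)) (processClause c (s.1.2, s.2))).2)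

/-- Process one of the remaining clauses. -/
def searchStep (s : SearchState) : SearchState :=
  if s.1.1.isEmpty then s else searchWith (selectClause s.1.1 s.1.2) s

/-- Process as many clauses as the list `l` is long. -/
def search (l : List (List (List Bool))) (s : SearchState) : SearchState :=
  l.foldl (fun s _ => searchStep s) s

/-! ### The steps of the search run in polynomial time. -/

section polytime
variable {γ : Type} [Enc γ]

theorem PT.touches {c F : γ → List (List Bool)} (hc : PT c) (hF : PT F) :
    PT (fun x => touches (c x) (F x)) := by
  have h : PT (fun y : List Bool × γ => (F y.2).any fun x => decide (y.1.tail = x)) :=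
    PT.any (c := fun z : List Bool × (List Bool × γ) => decide (z.2.1.tail = z.1))
      (hF.comp PT.snd) (PT.eq (PT.tail.comp (PT.fst.comp PT.snd)) PT.fst)
  exact PT.any hc h

theorem PT.occurs {v : γ → List Bool} {R : γ → List (List (List Bool))} (hv : PT v) (hR : PT R) :
    PT (fun x => occurs (v x) (R x)) :=
  PT.any (c := fun y : List (List Bool) × γ => DifferSAT.touches y.1 [v y.2]) hR
    (PT.touches PT.fst ((hv.comp PT.snd).cons (PT.const [])))

theorem PT.selectClause {R : γ → List (List (List Bool))} {F : γ → List (List Bool)} (hR : PT R)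
    (hF : PT F) : PT (fun x => selectClause (R x) (F x)) :=
  PT.headD.comp ((PT.filter (c := fun y : List (List Bool) × γ => DifferSAT.touches y.1 (F y.2)) hR
    (PT.touches PT.fst (hF.comp PT.snd))).append hR)

/-- Incrementing is one pass from the least significant bit, with a carry and the reversed output as
accumulator. Each output bit adds at most 3 for itself and 1 for its node. -/
theorem PT.incr {l : γ → List Bool} (hl : PT l) : PT (fun x => incr (l x)) := by
  have key : ∀ (l : List Bool) (b : Bool) (out : List Bool),
      (let s := l.foldl (fun (s : Bool × List Bool) a => (s.1 && a, (s.1 ^^ a) :: s.2)) (b, out)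
      (if s.1 then true :: s.2 else s.2).reverse) =
        out.reverse ++ if b then DifferSAT.incr l else l := by
    intro l
    induction l with
    | nil => intro b out; cases b <;> simp [DifferSAT.incr]
    | cons a l ih =>
      intro b out
      rw [List.foldl_cons, ih]
      cases b <;> cases a <;> simp [DifferSAT.incr]
  have hsize : ∀ (l : List Bool) (b : Bool) (out : List Bool),
      size (l.foldl (fun (s : Bool × List Bool) a => (s.1 && a, (s.1 ^^ a) :: s.2)) (b, out)) ≤
        4 * l.length + size out + 4 := by
    intro l
    induction l with
    | nil => intro b out; have := size_bool b; simp; lia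
    | cons a l ih =>
      intro b out
      have h₁ := ih (b && a) ((b ^^ a) :: out)
      have h₂ := size_bool (b ^^ a)
      simp only [List.foldl_cons, List.length_cons, size_cons] at h₁ ⊢
      lia
  obtain ⟨_, p, hp⟩ := id hl
  have hx : PT (fun y : (Bool × (Bool × List Bool)) × γ => y.1.2.1 ^^ y.1.1) :=
    ((PT.fst.comp (PT.snd.comp PT.fst)).ite (PT.fst.comp PT.fst).not (PT.fst.comp PT.fst)).of_eq
      fun y => by cases y.1.2.1 <;> simp
  have hs := PT.foldl (i := fun _ => (true, ([] : List Bool)))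
    (g := fun y : (Bool × (Bool × List Bool)) × γ => (y.1.2.1 && y.1.1, (y.1.2.1 ^^ y.1.1) :: y.1.2.2))
    hl (PT.const _) (((PT.fst.comp (PT.snd.comp PT.fst)).and (PT.fst.comp PT.fst)).pair
      (hx.cons (PT.snd.comp (PT.snd.comp PT.fst)))) (4 * p + 5) fun x l₁ l₂ h => by
        have h₁ := (length_le_size _).trans (hp x).1
        rw [h, List.length_append] at h₁
        refine (hsize l₁ true []).trans ?_
        simp; lia
  exact (((PT.fst.comp hs).ite ((PT.const true).cons (PT.snd.comp hs))
    (PT.snd.comp hs)).reverse).of_eq fun x => by simpa using key (l x) true []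

theorem PT.extensions {v : γ → List Bool} {r : γ → Row} (hv : PT v) (hr : PT r) :
    PT (fun x => extensions (v x) (r x)) := by
  have h : ∀ a b, PT (fun x => (a :: v x, b :: v x) :: (r x).1) := fun a b =>
    (((PT.const a).cons hv).pair ((PT.const b).cons hv)).cons (PT.fst.comp hr)
  have hr₂ := PT.snd.comp hr
  exact ((h false false).pair hr₂).cons (((h false true).pair hr₂.incr).cons
    (((h true false).pair hr₂.incr).cons (((h true true).pair hr₂).cons (PT.const []))))

theorem PT.introduce {v : γ → List Bool} {s : γ → List (List Bool) × List Row} (hv : PT v)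
    (hs : PT s) : PT (fun x => introduce (v x) (s x)) := by
  have h₁ : PT (fun x => (s x).1.any fun y => decide (y = v x)) :=
    PT.any (c := fun y : List Bool × γ => decide (y.1 = v y.2)) (PT.fst.comp hs)
      (PT.eq PT.fst (hv.comp PT.snd))
  have h₂ : PT (fun x => (s x).2.flatMap fun r => DifferSAT.extensions (v x) r) :=
    PT.flatMap (g := fun y : Row × γ => DifferSAT.extensions (v y.2) y.1) (PT.snd.comp hs)
      (PT.extensions (hv.comp PT.snd) PT.fst)
  exact h₁.ite hs ((hv.cons (PT.fst.comp hs)).pair h₂)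

theorem PT.introduceHead {c : γ → List (List Bool)} {s : γ → List (List Bool) × List Row}
    (hc : PT c) (hs : PT s) : PT (fun x => introduceHead (c x) (s x)) :=
  hc.isEmpty.ite hs ((PT.tail.comp (PT.headD.comp hc)).introduce hs)

theorem PT.rowSatisfies {c : γ → List (List Bool)} {E : γ → List (List Bool × List Bool)}
    (hc : PT c) (hE : PT E) : PT (fun x => rowSatisfies (c x) (E x)) := by
  have h₁ : PT (fun y : List Bool × γ => (E y.2).any fun e => decide (e.1 = y.1)) :=
    PT.any (c := fun z : (List Bool × List Bool) × (List Bool × γ) => decide (z.1.1 = z.2.1))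
      (hE.comp PT.snd) (PT.eq (PT.fst.comp PT.fst) (PT.fst.comp PT.snd))
  have h₂ : PT (fun y : List Bool × γ => (E y.2).any fun e => decide (e.2 = y.1)) :=
    PT.any (c := fun z : (List Bool × List Bool) × (List Bool × γ) => decide (z.1.2 = z.2.1))
      (hE.comp PT.snd) (PT.eq (PT.snd.comp PT.fst) (PT.fst.comp PT.snd))
  exact (PT.any hc h₁).and (PT.any hc h₂)

theorem PT.processClause {c : γ → List (List Bool)} {s : γ → List (List Bool) × List Row}
    (hc : PT c) (hs : PT s) : PT (fun x => processClause (c x) (s x)) := by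
  have h := (PT.tail.comp hc).introduceHead (hc.introduceHead hs)
  exact (PT.fst.comp h).pair (PT.filter
    (c := fun y : Row × γ => DifferSAT.rowSatisfies (c y.2) y.1.1) (PT.snd.comp h)
    ((hc.comp PT.snd).rowSatisfies (PT.fst.comp PT.fst)))

theorem PT.dedup {α : Type} [Enc α] [DecidableEq α] {l : γ → List α} (hl : PT l) :
    PT (fun x => (l x).foldl
      (fun t r => if t.any fun r' => decide (r' = r) then t else r :: t) []) := by
  obtain ⟨_, p, hp⟩ := id hl
  have hsize : ∀ l m : List α,
      size (l.foldl (fun t r => if t.any fun r' => decide (r' = r) then t else r :: t) m) + 1 ≤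
        size l + size m := by
    intro l
    induction l with
    | nil => intro m; simp [add_comm]
    | cons a l ih =>
      intro m
      refine (ih _).trans ?_
      dsimp only
      split <;> simp <;> lia
  refine PT.foldl (i := fun _ => ([] : List α)) (g := fun y : (α × List α) × γ =>
    if y.1.2.any fun r' => decide (r' = y.1.1) then y.1.2 else y.1.1 :: y.1.2)
    hl (PT.const _) (PT.ite ?_ (PT.snd.comp PT.fst) ((PT.fst.comp PT.fst).cons (PT.snd.comp PT.fst)))
    p fun x l₁ l₂ h => ?_
  · exact PT.any (c := fun z : α × ((α × List α) × γ) => decide (z.1 = z.2.1.1))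
      (PT.snd.comp PT.fst) (PT.eq PT.fst (PT.fst.comp (PT.fst.comp PT.snd)))
  · have h₁ := hsize l₁ []
    have h₂ := size_append l₁ l₂
    have h₃ := (hp x).1
    have h₄ := size_pos l₂
    rw [h] at h₃
    exact (Nat.le_of_succ_le_succ h₁).trans (by lia)

theorem PT.forget {R : γ → List (List (List Bool))} {s : γ → List (List Bool) × List Row}
    (hR : PT R) (hs : PT s) : PT (fun x => forget (R x) (s x)) := by
  have h₁ : PT (fun x => (s x).1.filter fun v => DifferSAT.occurs v (R x)) :=
    PT.filter (c := fun y : List Bool × γ => DifferSAT.occurs y.1 (R y.2)) (PT.fst.comp hs)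
      (PT.fst.occurs (hR.comp PT.snd))
  have h₂ : PT (fun y : Row × γ => y.1.1.filter fun e => DifferSAT.occurs e.1.tail (R y.2)) :=
    PT.filter (c := fun z : (List Bool × List Bool) × (Row × γ) =>
      DifferSAT.occurs z.1.1.tail (R z.2.2)) (PT.fst.comp PT.fst)
      ((PT.tail.comp (PT.fst.comp PT.fst)).occurs (hR.comp (PT.snd.comp PT.snd)))
  have h₃ : PT (fun x => (s x).2.map fun r =>
      (r.1.filter fun e => DifferSAT.occurs e.1.tail (R x), r.2)) :=
    PT.map (g := fun y : Row × γ =>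
      (y.1.1.filter fun e => DifferSAT.occurs e.1.tail (R y.2), y.1.2)) (PT.snd.comp hs)
      (h₂.pair (PT.snd.comp PT.fst))
  exact h₁.pair h₃.dedup

theorem PT.searchWith {c : γ → List (List Bool)} {s : γ → SearchState} (hc : PT c) (hs : PT s) :
    PT (fun x => searchWith (c x) (s x)) := by
  have hR : PT (fun x => (s x).1.1.filter fun c' => !decide (c' = c x)) :=
    PT.filter (c := fun y : List (List Bool) × γ => !decide (y.1 = c y.2))
      (PT.fst.comp (PT.fst.comp hs)) (PT.eq PT.fst (hc.comp PT.snd)).not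
  have h := hR.forget (hc.processClause ((PT.snd.comp (PT.fst.comp hs)).pair (PT.snd.comp hs)))
  exact (hR.pair (PT.fst.comp h)).pair (PT.snd.comp h)

theorem PT.searchStep {s : γ → SearchState} (hs : PT s) : PT (fun x => searchStep (s x)) :=
  (PT.fst.comp (PT.fst.comp hs)).isEmpty.ite hs
    (((PT.fst.comp (PT.fst.comp hs)).selectClause (PT.snd.comp (PT.fst.comp hs))).searchWith hs)

/-- A step may multiply the number of rows by a constant before duplicates are removed, so the size
bound is not automatic; it will come from the search invariant. -/
theorem PT.search {l : γ → List (List (List Bool))} {s : γ → SearchState} (hl : PT l) (hs : PT s)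
    (q : ℕ[X]) (hq : ∀ x l₁ l₂, l x = l₁ ++ l₂ → size (search l₁ (s x)) ≤ q.eval (size x)) :
    PT (fun x => search (l x) (s x)) :=
  PT.foldl (g := fun y : (List (List Bool) × SearchState) × γ => DifferSAT.searchStep y.1.2) hl hs
    (PT.searchStep (PT.snd.comp PT.fst)) q hq

end polytime

/-! ### Reading the input -/

section parsing

open Computability

/-- The clauses read so far; the literals of the current clause; the current number or literal. -/
abbrev ParseState : Type := (List (List (List Bool)) × List (List Bool)) × List Bool

/-- The literals of the current clause, including the current one. -/
def currentClause (s : ParseState) : List (List Bool) := if s.2.isEmpty then s.1.2 else s.2 :: s.1.2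

/-- Read one symbol. The input is read backwards. -/
def parseStep (a : Γ') (s : ParseState) : ParseState :=
  if decide (a = Γ'.bit false) then (s.1, false :: s.2)
  else if decide (a = Γ'.bit true) then (s.1, true :: s.2)
  else if decide (a = Γ'.comma) then ((s.1.1, currentClause s), [])
  else if decide (a = Γ'.bra) then ((currentClause s :: s.1.1, []), [])
  else s

/-- Read a string of symbols, given backwards. -/
def parse (l : List Γ') : ParseState := l.foldl (fun s a => parseStep a s) (([], []), [])

theorem PT.currentClause {γ : Type} [Enc γ] {s : γ → ParseState} (hs : PT s) :
    PT (fun x => currentClause (s x)) :=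
  (PT.snd.comp hs).isEmpty.ite (PT.snd.comp (PT.fst.comp hs))
    ((PT.snd.comp hs).cons (PT.snd.comp (PT.fst.comp hs)))

theorem size_parseStep (a : Γ') (s : ParseState) : size (parseStep a s) ≤ size s + 4 := by
  obtain ⟨⟨D, cl⟩, cur⟩ := s
  have h := size_bool false
  have h' := size_bool true
  have h₁ := size_pos cur
  have h₂ := size_pos cl
  unfold parseStep
  split_ifs <;> simp [DifferSAT.currentClause] <;> try split_ifs
  all_goals (try simp); lia

theorem PT.parse {γ : Type} [Enc γ] {l : γ → List Γ'} (hl : PT l) : PT (fun x => parse (l x)) := by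
  obtain ⟨_, p, hp⟩ := id hl
  have hsize : ∀ (l : List Γ') (s : ParseState),
      size (l.foldl (fun s a => parseStep a s) s) ≤ 4 * l.length + size s := by
    intro l
    induction l with
    | nil => intro s; simp
    | cons a l ih =>
      intro s
      have h₁ := ih (parseStep a s)
      have h₂ := size_parseStep a s
      simp only [List.foldl_cons, List.length_cons]
      lia
  have hs : PT (fun y : (Γ' × ParseState) × γ => y.1.2) := PT.snd.comp PT.fst
  have he : ∀ b : Γ', PT (fun y : (Γ' × ParseState) × γ => decide (y.1.1 = b)) := fun b =>
    PT.eq (PT.fst.comp PT.fst) (PT.const b)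
  refine PT.foldl (g := fun y : (Γ' × ParseState) × γ => parseStep y.1.1 y.1.2) hl (PT.const _)
    ((he _).ite ((PT.fst.comp hs).pair ((PT.const _).cons (PT.snd.comp hs)))
      ((he _).ite ((PT.fst.comp hs).pair ((PT.const _).cons (PT.snd.comp hs)))
      ((he _).ite (((PT.fst.comp (PT.fst.comp hs)).pair hs.currentClause).pair (PT.const []))
      ((he _).ite (((hs.currentClause.cons (PT.fst.comp (PT.fst.comp hs))).pair (PT.const [])).pair
        (PT.const [])) hs)))) (4 * p + 5) fun x l₁ l₂ h => ?_
  have h₁ := (length_le_size _).trans (hp x).1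
  rw [h, List.length_append] at h₁
  refine (hsize l₁ _).trans ?_
  simp; lia

/-- The machine delivers the string reversed, so consing restores the order. Read backwards, a comma
comes before its literal and thus closes the previous one, an opening bracket completes a clause,
and `d`, written first, is read last and stays in the slot of the current word. -/
theorem parse_encodeInstance (φ : CNF) (d : ℕ) : parse (encodeInstance φ d).reverse =
    ((φ.map fun c => c.map litBits, []), encodeNat d) := by
  have hbit : ∀ (b : Bool) (s : ParseState), parseStep (Γ'.bit b) s = (s.1, b :: s.2) := by
    intro b s; cases b <;> simp [parseStep]
  have hbits : ∀ (l : List Bool) (s : ParseState),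
      (l.map Γ'.bit).foldr parseStep s = (s.1, l ++ s.2) := by
    intro l s
    induction l with
    | nil => rfl
    | cons b l ih => rw [List.map_cons, List.foldr_cons, ih, hbit]; rfl
  have hlit : ∀ (l : Literal) (s : ParseState), (encodeLiteral l).foldr parseStep s =
      ((s.1.1, currentClause s), litBits l) := by
    intro l s
    have : parseStep Γ'.comma s = ((s.1.1, currentClause s), []) := by simp [parseStep]
    rw [encodeLiteral, List.foldr_cons, List.foldr_append, List.foldr_cons, List.foldr_nil, this,
      encodeNumber, hbits, hbit, List.append_nil, litBits]
  have hlits : ∀ (c : Clause) (D : List (List (List Bool))), ∃ s : ParseState, s.1.1 = D ∧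
      currentClause s = c.map litBits ∧ (c.flatMap encodeLiteral).foldr parseStep ((D, []), []) = s := by
    intro c D
    induction c with
    | nil => exact ⟨_, rfl, rfl, rfl⟩
    | cons l c ih =>
      obtain ⟨s, h₁, h₂, h₃⟩ := ih
      rw [List.flatMap_cons, List.foldr_append, h₃, hlit]
      -- Because of its sign bit a literal is never the empty word, so `currentClause` does not
      -- overlook it.
      exact ⟨((s.1.1, currentClause s), litBits l), h₁, by simp [currentClause, litBits, ← h₂], rfl⟩
  have hclause : ∀ (c : Clause) (D : List (List (List Bool))),
      (encodeClause c).foldr parseStep ((D, []), []) = ((c.map litBits :: D, []), []) := by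
    intro c D
    obtain ⟨s, h₁, h₂, h₃⟩ := hlits c D
    have : parseStep Γ'.ket ((D, []), []) = ((D, []), []) := by simp [parseStep]
    rw [encodeClause, List.foldr_cons, List.foldr_append, List.foldr_cons, List.foldr_nil, this, h₃]
    simp [parseStep, h₁, h₂]
  have hclauses : ∀ φ : CNF, (φ.flatMap encodeClause).foldr parseStep (([], []), []) =
      ((φ.map fun c => c.map litBits, []), []) := by
    intro φ
    induction φ with
    | nil => rfl
    | cons c φ ih => rw [List.flatMap_cons, List.foldr_append, ih, hclause]; rfl
  rw [parse, List.foldl_reverse, encodeInstance, List.foldr_append, hclauses, encodeNumber, hbits]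
  simp

end parsing

end DifferSAT

namespace DifferSAT

open Polynomial Computability

/-! ### Correctness of the algorithm -/

theorem encodeNat_injective : Function.Injective encodeNat :=
  Function.LeftInverse.injective decode_encodeNat

theorem litBits_injective : Function.Injective litBits := by
  rintro ⟨x, b⟩ ⟨y, c⟩ h
  simp only [litBits, List.cons.injEq] at h
  rw [h.1, encodeNat_injective h.2]

theorem incr_encodeNat (n : ℕ) : incr (encodeNat n) = encodeNat (n + 1) := by
  have h : ∀ p : PosNum, incr (encodePosNum p) = encodePosNum p.succ := by
    intro p
    induction p with
    | one => rfl
    | bit0 p ih => rfl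
    | bit1 p ih => simp [encodePosNum, PosNum.succ, incr, ih]
  unfold encodeNat
  rw [Nat.cast_succ, Num.add_one]
  cases (n : Num) with
  | zero => rfl
  | pos p => exact h p

theorem length_incr_le (l : List Bool) : (incr l).length ≤ l.length + 1 := by
  induction l with
  | nil => simp [incr]
  | cons b l ih => cases b <;> simp [incr]; lia

theorem length_encodeNat_le (n : ℕ) : (encodeNat n).length ≤ n := by
  induction n with
  | zero => rfl
  | succ n ih =>
    rw [← incr_encodeNat]
    exact (length_incr_le _).trans (by lia)

/-- The list of strings that represents a clause. -/
def clauseBits (c : Clause) : List (List Bool) := c.map litBits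

theorem clauseBits_injective : Function.Injective clauseBits :=
  List.map_injective_iff.2 litBits_injective

theorem mem_vars {φ : CNF} {x : ℕ} : x ∈ vars φ ↔ ∃ c ∈ φ, x ∈ c.map Prod.fst := by
  simp only [vars, List.mem_toFinset, List.mem_map, List.mem_flatten]
  constructor
  · rintro ⟨l, ⟨c, hc, hl⟩, rfl⟩
    exact ⟨c, hc, l, hl, rfl⟩
  · rintro ⟨c, hc, l, hl, rfl⟩
    exact ⟨l, ⟨c, hc, hl⟩, rfl⟩

theorem vars_cons (c : Clause) (φ : CNF) : vars (c :: φ) = (c.map Prod.fst).toFinset ∪ vars φ := by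
  ext x; simp [mem_vars]

theorem touches_iff {c : Clause} {F : List ℕ} :
    touches (clauseBits c) (F.map encodeNat) = true ↔ ∃ x ∈ F, x ∈ c.map Prod.fst := by
  simp only [touches, clauseBits, List.any_eq_true, List.mem_map, decide_eq_true_eq]
  constructor
  · rintro ⟨_, ⟨l, hl, rfl⟩, _, ⟨x, hx, rfl⟩, h⟩
    exact ⟨x, hx, l, hl, encodeNat_injective h⟩
  · rintro ⟨x, hx, l, hl, rfl⟩
    exact ⟨_, ⟨l, hl, rfl⟩, _, ⟨l.1, hx, rfl⟩, rfl⟩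

theorem occurs_iff {x : ℕ} {R : CNF} :
    occurs (encodeNat x) (R.map clauseBits) = true ↔ x ∈ vars R := by
  have h (c : Clause) := touches_iff (c := c) (F := [x])
  simp only [List.map_cons, List.map_nil, List.mem_singleton, exists_eq_left] at h
  simp [occurs, mem_vars, h]

theorem selectClause_spec {R : CNF} (hR : R ≠ []) (F : List ℕ) :
    ∃ c ∈ R, selectClause (R.map clauseBits) (F.map encodeNat) = clauseBits c ∧
      ((∃ x ∈ F, x ∈ vars R) → ∃ x ∈ F, x ∈ c.map Prod.fst) := by
  have h : selectClause (R.map clauseBits) (F.map encodeNat) =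
      ((R.filter (fun c => touches (clauseBits c) (F.map encodeNat)) ++ R).map clauseBits).headD
        [] := by
    rw [selectClause, List.filter_map, List.map_append]; rfl
  rw [h]
  cases hf : R.filter fun c => touches (clauseBits c) (F.map encodeNat) with
  | nil =>
    obtain ⟨c, R', rfl⟩ := List.exists_cons_of_ne_nil hR
    refine ⟨c, List.mem_cons_self, rfl, ?_⟩
    rintro ⟨x, hx, hxR⟩
    obtain ⟨c', hc', hxc⟩ := mem_vars.1 hxR
    exact absurd (touches_iff.2 ⟨x, hx, hxc⟩) (List.filter_eq_nil_iff.1 hf c' hc')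
  | cons c L =>
    have hc : c ∈ R.filter fun c => touches (clauseBits c) (F.map encodeNat) := by
      rw [hf]; exact List.mem_cons_self
    rw [List.mem_filter] at hc
    exact ⟨c, hc.1, rfl, fun _ => touches_iff.1 hc.2⟩

/-- The row of two assignments that differ on `k` variables. -/
def rowOf (F : List ℕ) (σ τ : ℕ → Bool) (k : ℕ) : Row :=
  (F.map fun x => (litBits (x, σ x), litBits (x, τ x)), encodeNat k)

/-- The rows are those of the pairs of assignments that satisfy `P`, where differences are counted
on `V`. -/
def RowsFor (P : CNF) (V : Finset ℕ) (F : List ℕ) (rows : List Row) : Prop :=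
  ∀ r, r ∈ rows ↔ ∃ σ τ, Satisfies σ P ∧ Satisfies τ P ∧ r = rowOf F σ τ (diffCount V σ τ)

theorem satisfies_congr {P : CNF} {σ σ' : ℕ → Bool} (h : ∀ x ∈ vars P, σ x = σ' x)
    (hσ : Satisfies σ P) : Satisfies σ' P := by
  intro c hc
  obtain ⟨l, hl, hσl⟩ := hσ c hc
  exact ⟨l, hl, by rw [← h l.1 (mem_vars.2 ⟨c, hc, List.mem_map_of_mem hl⟩), hσl]⟩

theorem diffCount_congr {V : Finset ℕ} {σ σ' τ τ' : ℕ → Bool} (h : ∀ x ∈ V, σ x = σ' x)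
    (h' : ∀ x ∈ V, τ x = τ' x) : diffCount V σ τ = diffCount V σ' τ' := by
  unfold diffCount
  congr 1
  exact Finset.filter_congr fun x hx => by rw [h x hx, h' x hx]

theorem diffCount_insert {V : Finset ℕ} {x : ℕ} (hx : x ∉ V) (σ τ : ℕ → Bool) :
    diffCount (insert x V) σ τ = diffCount V σ τ + if σ x = τ x then 0 else 1 := by
  unfold diffCount
  rw [Finset.filter_insert]
  by_cases h : σ x = τ x
  · simp [h]
  · rw [if_pos h, if_neg h, Finset.card_insert_of_notMem (by simp [hx])]

/-- A variable outside the frontier is new, so its values can be changed without affecting `P` or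
the count on `V`: all four extensions of each row occur, and the two unequal ones add a difference.
-/
theorem introduce_spec {P : CNF} {V : Finset ℕ} {F : List ℕ} {rows : List Row} {x : ℕ}
    (h : RowsFor P V F rows) (hP : vars P ⊆ V) (hF : ∀ y ∈ F, y ∈ V) (hx : x ∉ F → x ∉ V)
    (hF' : F.Nodup) :
    ∃ F' rows', introduce (encodeNat x) (F.map encodeNat, rows) = (F'.map encodeNat, rows') ∧
      F'.Nodup ∧ (∀ y, y ∈ F' ↔ y = x ∨ y ∈ F) ∧ RowsFor P (insert x V) F' rows' := by
  have hany : ((F.map encodeNat).any fun y => decide (y = encodeNat x)) = true ↔ x ∈ F := by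
    simp [encodeNat_injective.eq_iff]
  unfold introduce
  by_cases hxF : x ∈ F
  · refine ⟨F, rows, by rw [if_pos (hany.2 hxF)], hF', fun y => ?_, ?_⟩
    · constructor
      · exact Or.inr
      · rintro (rfl | h) <;> assumption
    · rwa [Finset.insert_eq_of_mem (hF x hxF)]
  refine ⟨x :: F, _, by rw [if_neg (by rwa [hany])]; rfl, List.nodup_cons.2 ⟨hxF, hF'⟩,
    fun y => by simp, fun r => ?_⟩
  have hxV := hx hxF
  have hFx : ∀ y ∈ F, y ≠ x := fun y hy e => hxF (e ▸ hy)
  simp only [List.mem_flatMap]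
  constructor
  · rintro ⟨r₀, hr₀, hr⟩
    obtain ⟨σ, τ, hσ, hτ, rfl⟩ := (h r₀).1 hr₀
    have key : ∀ a b : Bool,
        r = ((a :: encodeNat x, b :: encodeNat x) :: (rowOf F σ τ (diffCount V σ τ)).1,
          encodeNat (diffCount V σ τ + if a = b then 0 else 1)) →
        ∃ σ τ, Satisfies σ P ∧ Satisfies τ P ∧
          r = rowOf (x :: F) σ τ (diffCount (insert x V) σ τ) := by
      intro a b hr
      have hu : ∀ (σ : ℕ → Bool) (a : Bool), ∀ y ∈ V, σ y = Function.update σ x a y := by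
        intro σ a y hy
        rw [Function.update_of_ne (by rintro rfl; exact hxV hy)]
      refine ⟨Function.update σ x a, Function.update τ x b,
        satisfies_congr (fun y hy => hu σ a y (hP hy)) hσ,
        satisfies_congr (fun y hy => hu τ b y (hP hy)) hτ, ?_⟩
      rw [hr, diffCount_insert hxV, ← diffCount_congr (hu σ a) (hu τ b)]
      have : F.map (fun y => (litBits (y, Function.update σ x a y),
          litBits (y, Function.update τ x b y))) =
          F.map fun y => (litBits (y, σ y), litBits (y, τ y)) :=
        List.map_congr_left fun y hy => by simp [Function.update_of_ne (hFx y hy)]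
      unfold rowOf
      rw [List.map_cons, this]
      simp [litBits]
    simp only [extensions, List.mem_cons, List.not_mem_nil, or_false] at hr
    rcases hr with hr | hr | hr | hr
    · exact key false false hr
    · exact key false true (by simpa [← incr_encodeNat, rowOf] using hr)
    · exact key true false (by simpa [← incr_encodeNat, rowOf] using hr)
    · exact key true true hr
  · rintro ⟨σ, τ, hσ, hτ, rfl⟩
    refine ⟨_, (h _).2 ⟨σ, τ, hσ, hτ, rfl⟩, ?_⟩
    rw [diffCount_insert hxV]
    cases hσx : σ x <;> cases hτx : τ x <;>
      simp [rowOf, extensions, litBits, hσx, hτx, ← incr_encodeNat]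

theorem rowSatisfies_iff {c : Clause} {F : List ℕ} (hF : ∀ x ∈ c.map Prod.fst, x ∈ F)
    (σ τ : ℕ → Bool) (k : ℕ) : rowSatisfies (clauseBits c) (rowOf F σ τ k).1 = true ↔
      (∃ l ∈ c, σ l.1 = l.2) ∧ ∃ l ∈ c, τ l.1 = l.2 := by
  have key : ∀ ρ : ℕ → Bool, (∃ l ∈ c, ∃ x ∈ F, litBits (x, ρ x) = litBits l) ↔
      ∃ l ∈ c, ρ l.1 = l.2 := by
    intro ρ
    constructor
    · rintro ⟨l, hl, x, hx, h⟩
      have h := litBits_injective h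
      exact ⟨l, hl, by rw [← h]⟩
    · rintro ⟨l, hl, h⟩
      exact ⟨l, hl, l.1, hF _ (List.mem_map_of_mem hl), by rw [h]⟩
  rw [← key, ← key]
  simp [rowSatisfies, clauseBits, rowOf]

theorem rowsFor_filter {P : CNF} {V : Finset ℕ} {F : List ℕ} {rows : List Row} {c : Clause}
    (h : RowsFor P V F rows) (hF : ∀ x ∈ c.map Prod.fst, x ∈ F) :
    RowsFor (c :: P) V F (rows.filter fun r => rowSatisfies (clauseBits c) r.1) := by
  have hs : ∀ σ, Satisfies σ (c :: P) ↔ (∃ l ∈ c, σ l.1 = l.2) ∧ Satisfies σ P := by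
    intro σ; simp [Satisfies]
  intro r
  rw [List.mem_filter, h]
  constructor
  · rintro ⟨⟨σ, τ, hσ, hτ, rfl⟩, hc⟩
    rw [rowSatisfies_iff hF] at hc
    exact ⟨σ, τ, (hs σ).2 ⟨hc.1, hσ⟩, (hs τ).2 ⟨hc.2, hτ⟩, rfl⟩
  · rintro ⟨σ, τ, hσ, hτ, rfl⟩
    rw [rowSatisfies_iff hF]
    exact ⟨⟨σ, τ, ((hs σ).1 hσ).2, ((hs τ).1 hτ).2, rfl⟩, ((hs σ).1 hσ).1, ((hs τ).1 hτ).1⟩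

theorem processClause_spec {P : CNF} {F : List ℕ} {rows : List Row} {c : Clause}
    (hc : c.length ≤ 2) (h : RowsFor P (vars P) F rows) (hF : ∀ y ∈ F, y ∈ vars P)
    (hnew : ∀ x ∈ c.map Prod.fst, x ∉ F → x ∉ vars P) (hnd : F.Nodup) :
    ∃ F' rows', processClause (clauseBits c) (F.map encodeNat, rows) = (F'.map encodeNat, rows') ∧
      F'.Nodup ∧ (∀ y, y ∈ F' ↔ y ∈ F ∨ y ∈ c.map Prod.fst) ∧
      RowsFor (c :: P) (vars (c :: P)) F' rows' := by
  suffices hs : ∃ F' rows', introduceHead (clauseBits c).tail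
      (introduceHead (clauseBits c) (F.map encodeNat, rows)) = (F'.map encodeNat, rows') ∧
      F'.Nodup ∧ (∀ y, y ∈ F' ↔ y ∈ F ∨ y ∈ c.map Prod.fst) ∧
      RowsFor P (vars (c :: P)) F' rows' by
    obtain ⟨F', rows', h₁, h₂, h₃, h₄⟩ := hs
    refine ⟨F', _, by rw [processClause, h₁], h₂, h₃, rowsFor_filter h₄ fun x hx => ?_⟩
    exact (h₃ x).2 (Or.inr hx)
  match c, hc with
  | [], _ => exact ⟨F, rows, rfl, hnd, by simp, by simpa [vars_cons] using h⟩
  | [l], _ =>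
    obtain ⟨F₁, rows₁, e₁, hn₁, hF₁, h₁⟩ := introduce_spec (x := l.1) h subset_rfl hF
      (hnew l.1 (by simp)) hnd
    refine ⟨F₁, rows₁, e₁, hn₁, fun y => by rw [hF₁]; simp [or_comm], ?_⟩
    rw [vars_cons]
    have : (([l] : Clause).map Prod.fst).toFinset ∪ vars P = insert l.1 (vars P) := by
      ext y; simp
    rwa [this]
  | [l, m], _ =>
    obtain ⟨F₁, rows₁, e₁, hn₁, hF₁, h₁⟩ := introduce_spec (x := l.1) h subset_rfl hF
      (hnew l.1 (by simp)) hnd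
    obtain ⟨F₂, rows₂, e₂, hn₂, hF₂, h₂⟩ := introduce_spec (x := m.1) h₁
      (Finset.subset_insert _ _) (fun y hy => by
        rw [Finset.mem_insert]
        exact ((hF₁ y).1 hy).imp_right (hF y)) (fun hm => by
        rw [hF₁, not_or] at hm
        rw [Finset.mem_insert, not_or]
        exact ⟨hm.1, hnew m.1 (by simp) hm.2⟩) hn₁
    refine ⟨F₂, rows₂, ?_, hn₂, fun y => by rw [hF₂, hF₁]; simp; tauto, ?_⟩
    · rw [← e₂, ← e₁]; rfl
    · rw [vars_cons]
      have : (([l, m] : Clause).map Prod.fst).toFinset ∪ vars P = insert m.1 (insert l.1 (vars P)) := by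
        ext y; simp; tauto
      rwa [this]

theorem mem_dedup {α : Type} [DecidableEq α] (l m : List α) (a : α) :
    a ∈ l.foldl (fun t r => if t.any fun r' => decide (r' = r) then t else r :: t) m ↔
      a ∈ l ∨ a ∈ m := by
  induction l generalizing m with
  | nil => simp
  | cons b l ih =>
    rw [List.foldl_cons, ih]
    split_ifs with h
    · have : b ∈ m := by simpa using h
      simp only [List.mem_cons]
      constructor
      · tauto
      · rintro ((rfl | h) | h) <;> tauto
    · simp only [List.mem_cons]; tauto

theorem nodup_dedup {α : Type} [DecidableEq α] (l : List α) {m : List α} (hm : m.Nodup) :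
    (l.foldl (fun t r => if t.any fun r' => decide (r' = r) then t else r :: t) m).Nodup := by
  induction l generalizing m with
  | nil => exact hm
  | cons b l ih =>
    rw [List.foldl_cons]
    split_ifs with h
    · exact ih hm
    · exact ih (List.nodup_cons.2 ⟨by simpa using h, hm⟩)

/-- Restricting a row to fewer variables keeps the underlying pair of assignments and its count.
Removing duplicates afterwards is what keeps the number of rows polynomial. -/
theorem forget_spec {P R : CNF} {V : Finset ℕ} {F : List ℕ} {rows : List Row}
    (h : RowsFor P V F rows) : ∃ rows', forget (R.map clauseBits) (F.map encodeNat, rows) =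
      ((F.filter (· ∈ vars R)).map encodeNat, rows') ∧ rows'.Nodup ∧
      RowsFor P V (F.filter (· ∈ vars R)) rows' := by
  have ho : ∀ x : ℕ, occurs (encodeNat x) (R.map clauseBits) = decide (x ∈ vars R) := fun x => by
    rw [Bool.eq_iff_iff, occurs_iff, decide_eq_true_iff]
  refine ⟨_, Prod.ext ?_ rfl, nodup_dedup _ List.nodup_nil, fun r => ?_⟩
  · simp only [forget, List.filter_map]
    congr 1
    exact List.filter_congr fun x _ => ho x
  rw [forget, mem_dedup]
  simp only [List.mem_map, List.not_mem_nil, or_false]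
  have hrow : ∀ σ τ k, ((rowOf F σ τ k).1.filter fun e => occurs e.1.tail (R.map clauseBits),
      (rowOf F σ τ k).2) = rowOf (F.filter (· ∈ vars R)) σ τ k := by
    intro σ τ k
    simp only [rowOf, List.filter_map, Prod.mk.injEq, and_true]
    congr 1
    exact List.filter_congr fun x _ => ho x
  constructor
  · rintro ⟨r₀, hr₀, rfl⟩
    obtain ⟨σ, τ, hσ, hτ, rfl⟩ := (h r₀).1 hr₀
    exact ⟨σ, τ, hσ, hτ, hrow _ _ _⟩
  · rintro ⟨σ, τ, hσ, hτ, rfl⟩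
    exact ⟨_, (h _).2 ⟨σ, τ, hσ, hτ, rfl⟩, hrow _ _ _⟩

/-- The clauses of `φ` that do not occur in `P`. -/
def remaining (φ P : CNF) : CNF := φ.filter fun c => decide (c ∉ P)

/-- The state of the search when the clauses `P` of `φ` have been processed. -/
def SearchInv (φ P : CNF) (s : SearchState) : Prop :=
  P ⊆ φ ∧ ∃ (F : List ℕ) (rows : List Row),
    s = (((remaining φ P).map clauseBits, F.map encodeNat), rows) ∧ F.Nodup ∧
    (∀ x, x ∈ F ↔ x ∈ vars P ∧ x ∈ vars (remaining φ P)) ∧ F.length ≤ 2 ∧ rows.Nodup ∧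
    RowsFor P (vars P) F rows

theorem searchInv_init (φ : CNF) :
    SearchInv φ [] ((φ.map clauseBits, []), [([], [])]) := by
  refine ⟨by simp, [], [([], [])], by simp [remaining], by simp, by simp [vars], by simp, by simp,
    fun r => ?_⟩
  have : encodeNat 0 = [] := rfl
  simp [Satisfies, rowOf, diffCount, vars, this]

theorem mem_remaining {φ P : CNF} {c : Clause} : c ∈ remaining φ P ↔ c ∈ φ ∧ c ∉ P := by
  simp [remaining]

theorem not_three_clauses {φ : CNF} (hφ : IsTwoTwoCNF φ) {x : ℕ} {c₁ c₂ c₃ : Clause}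
    (h₁ : c₁ ∈ φ) (h₂ : c₂ ∈ φ) (h₃ : c₃ ∈ φ) (h₁₂ : c₁ ≠ c₂) (h₁₃ : c₁ ≠ c₃) (h₂₃ : c₂ ≠ c₃)
    (hx₁ : x ∈ c₁.map Prod.fst) (hx₂ : x ∈ c₂.map Prod.fst) (hx₃ : x ∈ c₃.map Prod.fst) :
    False := by
  have h := hφ.2 x
  rw [List.countP_eq_length_filter] at h
  have hn : [c₁, c₂, c₃].Nodup := by simp [h₁₂, h₁₃, h₂₃]
  have hs : [c₁, c₂, c₃] ⊆ φ.filter fun c => decide (x ∈ c.map Prod.fst) := by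
    intro c hc
    rw [List.mem_filter, decide_eq_true_iff]
    simp only [List.mem_cons, List.not_mem_nil, or_false] at hc
    rcases hc with rfl | rfl | rfl
    · exact ⟨h₁, hx₁⟩
    · exact ⟨h₂, hx₂⟩
    · exact ⟨h₃, hx₃⟩
  have := (List.subperm_of_subset hn hs).length_le
  simp at this h
  lia

theorem card_toFinset_clause_le {c : Clause} (hc : c.length ≤ 2) {x : ℕ}
    (hx : x ∈ c.map Prod.fst) : ∃ y, ∀ z ∈ c.map Prod.fst, z = x ∨ z = y := by
  match c, hc with
  | [], _ => simp at hx
  | [l], _ => exact ⟨x, fun z hz => by simp_all⟩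
  | [l, m], _ =>
    simp only [List.map_cons, List.map_nil, List.mem_cons, List.not_mem_nil, or_false] at hx ⊢
    rcases hx with rfl | rfl
    · exact ⟨m.1, fun z hz => hz⟩
    · exact ⟨l.1, fun z hz => hz.symm⟩

/-- If the frontier is empty, the new one lies in a single clause. Otherwise the selected clause `c`
contains a frontier variable `x`, which also occurs in a processed clause; a remaining clause with
`x` would be a third one. So `x` leaves, and `c` contributes at most one other variable `y`. -/
theorem searchStep_spec {φ P : CNF} (hφ : IsTwoTwoCNF φ) {s : SearchState}
    (h : SearchInv φ P s) (hR : remaining φ P ≠ []) :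
    ∃ c ∈ φ, c ∉ P ∧ SearchInv φ (c :: P) (searchStep s) := by
  obtain ⟨hP, F, rows, rfl, hnd, hF, hF₂, hrn, hrows⟩ := h
  obtain ⟨c, hc, hsel, htouch⟩ := selectClause_spec hR F
  have hcφ := (mem_remaining.1 hc).1
  have hcP := (mem_remaining.1 hc).2
  have hstep : searchStep (((remaining φ P).map clauseBits, F.map encodeNat), rows) =
      searchWith (clauseBits c) (((remaining φ P).map clauseBits, F.map encodeNat), rows) := by
    rw [searchStep, if_neg (by simpa using hR), hsel]
  have hrem : ((remaining φ P).map clauseBits).filter (fun c' => !decide (c' = clauseBits c)) =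
      (remaining φ (c :: P)).map clauseBits := by
    rw [List.filter_map, remaining, List.filter_filter, remaining]
    congr 1
    refine List.filter_congr fun c' _ => ?_
    rw [Bool.eq_iff_iff]
    simp [clauseBits_injective.eq_iff]
  obtain ⟨F₁, rows₁, e₁, hn₁, hF₁, h₁⟩ := processClause_spec (hφ.1 c hcφ) hrows
    (fun y hy => ((hF y).1 hy).1)
    -- A processed variable of `c` also occurs among the remaining clauses, hence lies in the
    -- frontier; any other variable of `c` is new.
    (fun x hx hxF hxP => hxF ((hF x).2 ⟨hxP, mem_vars.2 ⟨c, hc, hx⟩⟩)) hnd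
  obtain ⟨rows₂, e₂, hn₂, h₂⟩ := forget_spec (R := remaining φ (c :: P)) h₁
  have hsub : vars (remaining φ (c :: P)) ⊆ vars (remaining φ P) := by
    intro x hx
    obtain ⟨c', hc', hx⟩ := mem_vars.1 hx
    rw [mem_remaining] at hc'
    exact mem_vars.2 ⟨c', mem_remaining.2 ⟨hc'.1, fun h => hc'.2 (List.mem_cons_of_mem _ h)⟩, hx⟩
  refine ⟨c, hcφ, hcP, List.cons_subset.2 ⟨hcφ, hP⟩,
    F₁.filter (· ∈ vars (remaining φ (c :: P))), rows₂, ?_, hn₁.filter _, ?_, ?_, hn₂, h₂⟩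
  · rw [hstep, searchWith, hrem, e₁, e₂]
  · intro x
    rw [List.mem_filter, hF₁, decide_eq_true_iff, vars_cons, Finset.mem_union, List.mem_toFinset,
      hF]
    constructor
    · tauto
    · rintro ⟨h₁ | h₁, h₂⟩
      · exact ⟨Or.inr h₁, h₂⟩
      · exact ⟨Or.inl ⟨h₁, hsub h₂⟩, h₂⟩
  · have hcard : (F₁.filter (· ∈ vars (remaining φ (c :: P)))).toFinset.card =
        (F₁.filter (· ∈ vars (remaining φ (c :: P)))).length :=
      List.toFinset_card_of_nodup (hn₁.filter _)
    rw [← hcard]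
    by_cases hFe : F = []
    · refine le_trans (Finset.card_le_card (t := (c.map Prod.fst).toFinset) ?_)
        ((List.toFinset_card_le _).trans (by simpa using hφ.1 c hcφ))
      intro x hx
      simp only [List.mem_toFinset, List.mem_filter, hF₁, hFe, List.not_mem_nil, false_or] at hx ⊢
      exact hx.1
    · obtain ⟨x₀, hx₀⟩ := List.exists_mem_of_ne_nil F hFe
      obtain ⟨x, hx, hxc⟩ := htouch ⟨x₀, hx₀, ((hF x₀).1 hx₀).2⟩
      obtain ⟨y, hy⟩ := card_toFinset_clause_le (hφ.1 c hcφ) hxc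
      have hxR : x ∉ vars (remaining φ (c :: P)) := by
        intro hxR
        obtain ⟨c₁, hc₁, hx₁⟩ := mem_vars.1 ((hF x).1 hx).1
        obtain ⟨c₂, hc₂, hx₂⟩ := mem_vars.1 hxR
        rw [mem_remaining, List.mem_cons, not_or] at hc₂
        exact not_three_clauses hφ (hP hc₁) hcφ hc₂.1 (fun e => hcP (e ▸ hc₁))
          (fun e => hc₂.2.2 (e ▸ hc₁)) (fun e => hc₂.2.1 e.symm) hx₁ hxc hx₂
      have hle : (insert y (F.toFinset.erase x)).card ≤ 2 := by
        refine (Finset.card_insert_le _ _).trans ?_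
        rw [Finset.card_erase_of_mem (by simpa using hx)]
        have := List.toFinset_card_le F
        lia
      refine le_trans (Finset.card_le_card ?_) hle
      intro z hz
      simp only [List.mem_toFinset, List.mem_filter, hF₁, decide_eq_true_iff] at hz
      have hzx : z ≠ x := fun e => hxR (e ▸ hz.2)
      simp only [Finset.mem_insert, Finset.mem_erase, List.mem_toFinset]
      rcases hz.1 with h | h
      · exact Or.inr ⟨hzx, h⟩
      · exact Or.inl ((hy z h).resolve_left hzx)

/-- Each step removes some clause with all its copies as long as one remains, so `l` serves only as
a counter. -/
theorem search_spec {φ : CNF} (hφ : IsTwoTwoCNF φ) (l : List (List (List Bool))) :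
    ∀ {P : CNF} {s : SearchState}, SearchInv φ P s → ∃ P', SearchInv φ P' (search l s) ∧
      (remaining φ P').length ≤ (remaining φ P).length - l.length := by
  induction l with
  | nil => intro P s h; exact ⟨P, h, le_rfl⟩
  | cons a l ih =>
    intro P s h
    by_cases hR : remaining φ P = []
    · have hstep : searchStep s = s := by
        obtain ⟨_, F, rows, rfl, _⟩ := h
        simp [searchStep, hR]
      obtain ⟨P', h₁, h₂⟩ := ih h
      refine ⟨P', ?_, by rw [hR] at h₂ ⊢; simpa using h₂⟩
      rwa [search, List.foldl_cons, hstep]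
    · obtain ⟨c, hc, hcP, h₁⟩ := searchStep_spec hφ h hR
      obtain ⟨P', h₂, h₃⟩ := ih h₁
      refine ⟨P', h₂, h₃.trans ?_⟩
      have hlt : (remaining φ (c :: P)).length < (remaining φ P).length := by
        have hs : (remaining φ (c :: P)).Sublist (remaining φ P) := by
          have : remaining φ (c :: P) = (remaining φ P).filter fun c' => decide (c' ≠ c) := by
            simp [remaining, List.filter_filter]
          rw [this]; exact List.filter_sublist
        refine lt_of_le_of_ne hs.length_le fun e => ?_
        have := hs.eq_of_length e
        have hm : c ∈ remaining φ (c :: P) := this ▸ mem_remaining.2 ⟨hc, hcP⟩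
        simp [mem_remaining] at hm
      simp only [List.length_cons]
      lia

theorem search_accepts {φ : CNF} (hφ : IsTwoTwoCNF φ) (d : ℕ) :
    ((search (φ.map clauseBits) ((φ.map clauseBits, []), [([], [])])).2.any
      fun r => decide (r.2 = encodeNat d)) = true ↔ ExactDiffer φ d := by
  obtain ⟨P, ⟨hP, F, rows, e, _, hF, _, _, h⟩, hlen⟩ :=
    search_spec hφ (φ.map clauseBits) (searchInv_init φ)
  have hR : remaining φ P = [] := by
    rw [← List.length_eq_zero_iff]
    simpa [remaining] using hlen
  have hφP : ∀ c, c ∈ P ↔ c ∈ φ := fun c => ⟨fun h => hP h, fun h => by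
    by_contra hc
    have : c ∈ remaining φ P := mem_remaining.2 ⟨h, hc⟩
    simp [hR] at this⟩
  have hsat : ∀ σ, Satisfies σ P ↔ Satisfies σ φ := fun σ => by simp [Satisfies, hφP]
  have hvars : vars P = vars φ := by ext x; simp [mem_vars, hφP]
  rw [e, List.any_eq_true]
  constructor
  · rintro ⟨r, hr, hd⟩
    obtain ⟨σ, τ, hσ, hτ, rfl⟩ := (h r).1 hr
    rw [decide_eq_true_iff] at hd
    exact ⟨σ, τ, (hsat σ).1 hσ, (hsat τ).1 hτ, by rw [← hvars]; exact encodeNat_injective hd⟩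
  · rintro ⟨σ, τ, hσ, hτ, rfl⟩
    exact ⟨_, (h _).2 ⟨σ, τ, (hsat σ).2 hσ, (hsat τ).2 hτ, rfl⟩, by simp [rowOf, hvars]⟩

/-! ### The running time of the algorithm -/

theorem size_bits_le (l : List Bool) : size l ≤ 4 * l.length + 1 := by
  have := size_le_of_forall (l := l) (n := 3) fun b _ => size_bool b
  lia

theorem size_le_of_sublist {α : Type} [Enc α] {l m : List α} (h : l.Sublist m) :
    size l ≤ size m := by
  induction h with
  | slnil => exact le_rfl
  | cons a _ ih => simp; lia
  | cons_cons a _ ih => simp; lia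

theorem card_vars_le (φ : CNF) : (vars φ).card ≤ size (φ.map clauseBits) := by
  induction φ with
  | nil => simp [vars]
  | cons c φ ih =>
    have h₁ : ((c.map Prod.fst).toFinset).card ≤ size (clauseBits c) :=
      (List.toFinset_card_le _).trans (le_trans (by simp [clauseBits]) (length_le_size _))
    rw [vars_cons]
    refine (Finset.card_union_le _ _).trans ?_
    simp
    lia

theorem size_name_le {φ : CNF} {x : ℕ} (hx : x ∈ vars φ) :
    size (encodeNat x) ≤ size (φ.map clauseBits) := by
  obtain ⟨c, hc, hx⟩ := mem_vars.1 hx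
  obtain ⟨l, hl, rfl⟩ := List.mem_map.1 hx
  have h₁ : size (clauseBits c) ≤ size (φ.map clauseBits) := size_le_of_mem (List.mem_map_of_mem hc)
  have h₂ : size (litBits l) ≤ size (clauseBits c) := size_le_of_mem (List.mem_map_of_mem hl)
  have h₃ : size (litBits l) = size l.2 + size (encodeNat l.1) + 1 := size_cons _ _
  lia

/-- A row is determined by a pair of bits for each of at most two variables and by a count between
`0` and `V.card`. -/
theorem length_rows_le {P : CNF} {V : Finset ℕ} {F : List ℕ} {rows : List Row}
    (h : RowsFor P V F rows) (hF : F.length ≤ 2) (hn : rows.Nodup) :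
    rows.length ≤ 16 * (V.card + 1) := by
  rw [← List.toFinset_card_of_nodup hn]
  let f : ((Bool × Bool) × (Bool × Bool)) × ℕ → Row := fun z =>
    (List.zipWith (fun x (p : Bool × Bool) => (litBits (x, p.1), litBits (x, p.2))) F
      [z.1.1, z.1.2], encodeNat z.2)
  have hs : rows.toFinset ⊆ ((Finset.univ : Finset ((Bool × Bool) × (Bool × Bool))) ×ˢ
      Finset.range (V.card + 1)).image f := by
    intro r hr
    obtain ⟨σ, τ, -, -, rfl⟩ := (h r).1 (List.mem_toFinset.1 hr)
    have hd : diffCount V σ τ < V.card + 1 := Nat.lt_succ_of_le (Finset.card_filter_le _ _)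
    rw [Finset.mem_image]
    rcases F with _ | ⟨x, _ | ⟨y, _ | ⟨z, F⟩⟩⟩
    -- For a shorter frontier the superfluous bits are padded with `false`; `zipWith` ignores them.
    · exact ⟨(((false, false), (false, false)), diffCount V σ τ), by simpa using hd, rfl⟩
    · exact ⟨(((σ x, τ x), (false, false)), diffCount V σ τ), by simpa using hd, rfl⟩
    · exact ⟨(((σ x, τ x), (σ y, τ y)), diffCount V σ τ), by simpa using hd, rfl⟩
    · simp at hF
  refine (Finset.card_le_card hs).trans (Finset.card_image_le.trans ?_)
  rw [Finset.card_product, Finset.card_range]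
  exact le_of_eq rfl

theorem size_searchState_le {φ P : CNF} {s : SearchState} (h : SearchInv φ P s) {n : ℕ}
    (hn : size (φ.map clauseBits) = n) : size s ≤ 16 * (n + 1) * (10 * n + 40) + 4 * n + 10 := by
  obtain ⟨hP, F, rows, rfl, hnd, hF, hF₂, hrn, hrows⟩ := h
  have hPφ : vars P ⊆ vars φ := fun x hx => by
    obtain ⟨c, hc, hx⟩ := mem_vars.1 hx
    exact mem_vars.2 ⟨c, hP hc, hx⟩
  have hname : ∀ x ∈ F, size (encodeNat x) ≤ n := fun x hx =>
    hn ▸ size_name_le (hPφ ((hF x).1 hx).1)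
  have hcard : (vars P).card ≤ n := (Finset.card_le_card hPφ).trans (hn ▸ card_vars_le φ)
  have h₁ : size ((remaining φ P).map clauseBits) ≤ n :=
    hn ▸ size_le_of_sublist (List.filter_sublist.map _)
  have h₂ : size (F.map encodeNat) ≤ 2 * (n + 1) + 1 := by
    refine (size_le_of_forall (n := n) ?_).trans ?_
    · intro a ha
      obtain ⟨x, hx, rfl⟩ := List.mem_map.1 ha
      exact hname x hx
    · rw [List.length_map]
      have := Nat.mul_le_mul_right (n + 1) hF₂
      lia
  have h₃ : size rows ≤ 16 * (n + 1) * (10 * n + 40) + 1 := by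
    refine (size_le_of_forall (n := 10 * n + 39) ?_).trans ?_
    · intro r hr
      obtain ⟨σ, τ, -, -, rfl⟩ := (hrows r).1 hr
      have e₁ : size (rowOf F σ τ (diffCount (vars P) σ τ)).1 ≤ 2 * (2 * n + 9 + 1) + 1 := by
        -- Each of the two literals has a sign of size at most 3, a name of size at most `n` and a
        -- node; one more node pairs them.
        refine (size_le_of_forall (n := 2 * n + 9) ?_).trans ?_
        · intro e he
          obtain ⟨x, hx, rfl⟩ := List.mem_map.1 he
          have h₁ : size (litBits (x, σ x)) = size (σ x) + size (encodeNat x) + 1 := size_cons _ _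
          have h₂ : size (litBits (x, τ x)) = size (τ x) + size (encodeNat x) + 1 := size_cons _ _
          have h₃ := size_bool (σ x)
          have h₄ := size_bool (τ x)
          have h₅ := hname x hx
          rw [size_pair]
          lia
        · rw [rowOf, List.length_map]
          have := Nat.mul_le_mul_right (2 * n + 9 + 1) hF₂
          lia
      have e₂ : size (rowOf F σ τ (diffCount (vars P) σ τ)).2 ≤ 4 * n + 1 := by
        refine (size_bits_le _).trans ?_
        have h₁ : diffCount (vars P) σ τ ≤ (vars P).card := Finset.card_filter_le _ _
        have h₂ := length_encodeNat_le (diffCount (vars P) σ τ)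
        rw [rowOf]
        lia
      have e₃ : size (rowOf F σ τ (diffCount (vars P) σ τ)) =
          size (rowOf F σ τ (diffCount (vars P) σ τ)).1 +
            size (rowOf F σ τ (diffCount (vars P) σ τ)).2 + 1 := size_pair _ _
      rw [e₃]
      lia
    · have e := length_rows_le hrows hF₂ hrn
      have e' := Nat.mul_le_mul_right (10 * n + 40) (e.trans (Nat.mul_le_mul_left 16
        (Nat.add_le_add_right hcard 1)))
      exact Nat.add_le_add_right e' 1
  rw [size_pair, size_pair]
  lia

/-- The strings, given backwards, that represent an instance. -/
def IsInput (l : List Γ') : Prop :=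
  ∃ (φ : CNF) (d : ℕ), IsTwoTwoCNF φ ∧ l = (encodeInstance φ d).reverse

/-- The decision of the algorithm. -/
def accepts (l : {l // IsInput l}) : Bool :=
  (search (parse l.1).1.1 (((parse l.1).1.1, []), [([], [])])).2.any
    fun r => decide (r.2 = (parse l.1).2)

/-- The domain consists of genuine inputs because the bound on the search states depends on the
(2,2)-condition. -/
theorem PT.accepts : PT DifferSAT.accepts := by
  have h₀ : PT (fun l : {l // IsInput l} => DifferSAT.parse l.1) :=
    PT.parse (PT.of_bits fun _ => rfl)
  have hφ := PT.fst.comp (PT.fst.comp h₀)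
  obtain ⟨_, p, hp⟩ := id hφ
  have hs := hφ.search ((hφ.pair (PT.const ([] : List (List Bool)))).pair
    (PT.const ([([], [])] : List Row))) (16 * (p + 1) * (10 * p + 40) + 4 * p + 10) <| by
      rintro ⟨l, φ, d, h, rfl⟩ l₁ l₂ -
      obtain ⟨P, hP, -⟩ := search_spec h l₁ (searchInv_init φ)
      have hsize := (hp ⟨(encodeInstance φ d).reverse, φ, d, h, rfl⟩).1
      simp only [parse_encodeInstance] at hsize ⊢
      refine (size_searchState_le hP rfl).trans ?_
      simp only [eval_add, eval_mul, eval_ofNat, eval_one]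
      have e : size (φ.map clauseBits) ≤ _ := hsize
      gcongr
  exact PT.any (c := fun y : Row × {l // IsInput l} => decide (y.1.2 = (DifferSAT.parse y.2.1).2))
    (PT.snd.comp hs) (PT.eq (PT.snd.comp PT.fst) (PT.snd.comp (h₀.comp PT.snd)))

theorem polyTimeDecidable_exactDiffer : PolyTimeDecidable
    (fun I : {φ : CNF // IsTwoTwoCNF φ} × ℕ => encodeInstance I.1.1 I.2)
    (fun I => ExactDiffer I.1.1 I.2) := by
  refine polyTimeDecidable_of_PT PT.accepts (fun I => ⟨I.1.1, I.2, I.1.2, rfl⟩) fun I => ?_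
  rw [accepts, parse_encodeInstance]
  exact search_accepts I.1.2 I.2

end DifferSAT

namespace DifferSAT

/-! ### Achievable difference counts -/

/-- The other vertex of the same variable. -/
def Vertex.partner {φ : CNF} (a : Vertex φ) : Vertex φ := (a.1, !a.2)

/-- The literals of the two vertices form a clause. -/
def ClauseAdj {φ : CNF} (a b : Vertex φ) : Prop :=
  [Vertex.lit a, Vertex.lit b] ∈ φ ∨ [Vertex.lit b, Vertex.lit a] ∈ φ

section

variable {φ : CNF}

theorem ClauseAdj.symm {a b : Vertex φ} (h : ClauseAdj a b) : ClauseAdj b a := Or.symm h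

theorem Vertex.partner_partner (a : Vertex φ) : a.partner.partner = a := by
  simp [Vertex.partner]

theorem Vertex.partner_ne (a : Vertex φ) : a.partner ≠ a := by
  simp [Vertex.partner, Prod.ext_iff]

theorem Vertex.eq_or_eq_partner {a b : Vertex φ} (h : b.1 = a.1) : b = a ∨ b = a.partner := by
  obtain ⟨x, s⟩ := a
  obtain ⟨y, t⟩ := b
  simp only at h
  subst h
  cases s <;> cases t <;> simp [Vertex.partner]

theorem ClauseAdj.ne (hp : IsProper φ) {a b : Vertex φ} (h : ClauseAdj a b) : a.1.1 ≠ b.1.1 := by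
  rcases h with h | h <;> obtain ⟨l, m, hc, hlm⟩ := hp _ h <;>
    simp only [List.cons.injEq, and_true] at hc <;> obtain ⟨rfl, rfl⟩ := hc
  · exact hlm
  · exact hlm.symm

theorem graph_adj (hp : IsProper φ) {a b : Vertex φ} :
    (graph φ).Adj a b ↔ b = a.partner ∨ ClauseAdj a b := by
  simp only [graph, SimpleGraph.fromRel_adj]
  constructor
  · rintro ⟨hne, (h | h) | (h | h)⟩
    · exact .inl ((Vertex.eq_or_eq_partner h.symm).resolve_left hne.symm)
    · exact .inr (.inl h)
    · exact .inl ((Vertex.eq_or_eq_partner h).resolve_left hne.symm)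
    · exact .inr (.inr h)
  · rintro (rfl | h)
    · exact ⟨(Vertex.partner_ne a).symm, .inl (.inl rfl)⟩
    · refine ⟨fun hab => h.ne hp (by rw [hab]), ?_⟩
      rcases h with h | h
      · exact .inl (.inr h)
      · exact .inr (.inr h)

theorem ClauseAdj.exists_clause {a b : Vertex φ} (h : ClauseAdj a b) :
    ∃ c ∈ φ, c = [a.lit, b.lit] ∨ c = [b.lit, a.lit] := by
  rcases h with h | h
  · exact ⟨_, h, .inl rfl⟩
  · exact ⟨_, h, .inr rfl⟩

theorem Vertex.lit_injective : Function.Injective (Vertex.lit (φ := φ)) := by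
  rintro ⟨⟨x, hx⟩, s⟩ ⟨⟨y, hy⟩, t⟩ h
  simp only [Vertex.lit, Prod.mk.injEq] at h
  obtain ⟨rfl, rfl⟩ := h
  rfl

/-- A variable lies in at most two clauses, so two of any three of its half-edges coincide. -/
theorem half_edges (hφ : IsTwoTwoCNF φ) (hp : IsProper φ) {a₁ b₁ a₂ b₂ a₃ b₃ : Vertex φ}
    (h₁ : ClauseAdj a₁ b₁) (h₂ : ClauseAdj a₂ b₂) (h₃ : ClauseAdj a₃ b₃)
    (e₂ : a₂.1.1 = a₁.1.1) (e₃ : a₃.1.1 = a₁.1.1) :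
    (a₁ = a₂ ∧ b₁ = b₂) ∨ (a₁ = a₃ ∧ b₁ = b₃) ∨ (a₂ = a₃ ∧ b₂ = b₃) := by
  -- Half-edges of one variable that come from the same clause coincide, since the two variables of
  -- a clause are distinct.
  have key : ∀ {a b a' b' : Vertex φ} {c : Clause}, ClauseAdj a b → a'.1.1 = a.1.1 →
      (c = [a.lit, b.lit] ∨ c = [b.lit, a.lit]) → (c = [a'.lit, b'.lit] ∨ c = [b'.lit, a'.lit]) →
      a = a' ∧ b = b' := by
    intro a b a' b' c h e hc hc'
    have hne := h.ne hp
    rcases hc with rfl | rfl <;> rcases hc' with hc' | hc' <;>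
      simp only [List.cons.injEq, and_true] at hc' <;>
      obtain ⟨h1, h2⟩ := hc' <;> have h1 := Vertex.lit_injective h1 <;>
      have h2 := Vertex.lit_injective h2 <;> subst h1 <;> subst h2
    · exact ⟨rfl, rfl⟩
    · exact absurd e.symm hne
    · exact absurd e.symm hne
    · exact ⟨rfl, rfl⟩
  obtain ⟨c₁, m₁, hc₁⟩ := h₁.exists_clause
  obtain ⟨c₂, m₂, hc₂⟩ := h₂.exists_clause
  obtain ⟨c₃, m₃, hc₃⟩ := h₃.exists_clause
  have mem : ∀ {a b : Vertex φ} {c : Clause}, a.1.1 = a₁.1.1 →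
      (c = [a.lit, b.lit] ∨ c = [b.lit, a.lit]) → a₁.1.1 ∈ c.map Prod.fst := by
    rintro a b c e (rfl | rfl) <;> simp [Vertex.lit, e]
  by_contra hcon
  simp only [not_or] at hcon
  refine not_three_clauses hφ m₁ m₂ m₃ ?_ ?_ ?_ (mem rfl hc₁) (mem e₂ hc₂) (mem e₃ hc₃)
  · rintro rfl
    exact hcon.1 (key h₁ e₂ hc₁ hc₂)
  · rintro rfl
    exact hcon.2.1 (key h₁ e₃ hc₁ hc₃)
  · rintro rfl
    exact hcon.2.2 (key h₂ (e₃.trans e₂.symm) hc₂ hc₃)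

/-- `σ` satisfies all clauses whose variables belong to `W`. -/
def SatisfiesWithin (φ : CNF) (σ : ℕ → Bool) (W : Finset ℕ) : Prop :=
  ∀ a b : Vertex φ, ClauseAdj a b → a.1.1 ∈ W → b.1.1 ∈ W → σ a.1.1 = a.2 ∨ σ b.1.1 = b.2

theorem SatisfiesWithin.update (hp : IsProper φ) {σ : ℕ → Bool} {W : Finset ℕ} {x : ℕ}
    (h : SatisfiesWithin φ σ (W.erase x)) {v : Bool}
    (hv : ∀ a b : Vertex φ, ClauseAdj a b → a.1.1 = x → b.1.1 ∈ W → v = a.2 ∨ σ b.1.1 = b.2) :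
    SatisfiesWithin φ (Function.update σ x v) W := by
  have key : ∀ a b : Vertex φ, ClauseAdj a b → a.1.1 = x → b.1.1 ∈ W →
      Function.update σ x v a.1.1 = a.2 ∨ Function.update σ x v b.1.1 = b.2 := by
    intro a b hab ha hb
    have hne : b.1.1 ≠ x := fun hbx => hab.ne hp (ha.trans hbx.symm)
    rw [Function.update_of_ne hne, ha, Function.update_self]
    exact hv a b hab ha hb
  intro a b hab ha hb
  by_cases hax : a.1.1 = x
  · exact key a b hab hax hb
  by_cases hbx : b.1.1 = x
  · exact (key b a hab.symm hbx ha).symm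
  rw [Function.update_of_ne hax, Function.update_of_ne hbx]
  exact h a b hab (Finset.mem_erase.2 ⟨hax, ha⟩) (Finset.mem_erase.2 ⟨hbx, hb⟩)

theorem diffCount_update {W : Finset ℕ} {x : ℕ} (hx : x ∈ W) (σ τ : ℕ → Bool) (v w : Bool) :
    diffCount W (Function.update σ x v) (Function.update τ x w) =
      diffCount (W.erase x) σ τ + if v = w then 0 else 1 := by
  conv_lhs => rw [← Finset.insert_erase hx]
  rw [diffCount_insert (Finset.notMem_erase x W)]
  simp only [Function.update_self]
  congr 1
  refine diffCount_congr (fun y hy => ?_) (fun y hy => ?_) <;>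
    exact Function.update_of_ne (Finset.ne_of_mem_erase hy) _ _

theorem diffCount_le (W : Finset ℕ) (σ τ : ℕ → Bool) : diffCount W σ τ ≤ W.card :=
  Finset.card_filter_le _ _

theorem diffCount_eq_card_iff {W : Finset ℕ} {σ τ : ℕ → Bool} :
    diffCount W σ τ = W.card ↔ ∀ x ∈ W, σ x ≠ τ x :=
  Finset.card_filter_eq_iff

/-- At most one half-edge at the variable `x` leads to a variable in `T`. -/
def HalfEdgeUnique (φ : CNF) (x : ℕ) (T : Finset ℕ) : Prop :=
  ∀ a b a' b' : Vertex φ, ClauseAdj a b → ClauseAdj a' b' → a.1.1 = x → a'.1.1 = x →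
    b.1.1 ∈ T → b'.1.1 ∈ T → a = a' ∧ b = b'

/-- Peel off a variable `x` with at most one half-edge into `W`. If fewer than `W.card` differences
are wanted, `x` gets the same value in both assignments, one that satisfies that clause. If all
variables must differ, the neighbour already differs, so its literal is true in exactly one of the
assignments, and `x` has to help only in the other. -/
theorem exists_diff (hp : IsProper φ) (W : Finset ℕ)
    (hW : ∀ T ⊆ W, T.Nonempty → ∃ x ∈ T, HalfEdgeUnique φ x T) :
    ∀ μ ≤ W.card, ∃ σ τ : ℕ → Bool,
      SatisfiesWithin φ σ W ∧ SatisfiesWithin φ τ W ∧ diffCount W σ τ = μ := by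
  induction W using Finset.strongInduction with
  | H W ih =>
  intro μ hμ
  rcases W.eq_empty_or_nonempty with rfl | hne
  · refine ⟨fun _ => true, fun _ => true, ?_, ?_, ?_⟩
    · intro a b _ ha; simp at ha
    · intro a b _ ha; simp at ha
    · simp only [Finset.card_empty, Nat.le_zero] at hμ
      simp [diffCount, hμ]
  obtain ⟨x, hx, hu⟩ := hW W subset_rfl hne
  have ih' := ih (W.erase x) (Finset.erase_ssubset hx)
    (fun T hT => hW T (hT.trans (Finset.erase_subset _ _)))
  have hcard := Finset.card_erase_add_one hx
  rcases Nat.lt_or_ge (W.erase x).card μ with hlt | hle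
  · obtain ⟨σ, τ, hσ, hτ, hd⟩ := ih' _ le_rfl
    rw [diffCount_eq_card_iff] at hd
    by_cases he : ∃ a b : Vertex φ, ClauseAdj a b ∧ a.1.1 = x ∧ b.1.1 ∈ W
    · obtain ⟨a, b, hab, ha, hb⟩ := he
      have hbx : b.1.1 ∈ W.erase x :=
        Finset.mem_erase.2 ⟨fun h => hab.ne hp (ha.trans h.symm), hb⟩
      have hneq := hd _ hbx
      have hval : ∀ ρ : ℕ → Bool, ∀ v : Bool, (v = a.2 ∨ ρ b.1.1 = b.2) →
          ∀ a' b' : Vertex φ, ClauseAdj a' b' → a'.1.1 = x → b'.1.1 ∈ W →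
            v = a'.2 ∨ ρ b'.1.1 = b'.2 := by
        intro ρ v h a' b' hab' ha' hb'
        obtain ⟨rfl, rfl⟩ := hu a b a' b' hab hab' ha ha' hb hb'
        exact h
      -- The literal of `a` is made false in the assignment where `b` is true, and true where `b` is
      -- false.
      refine ⟨_, _, hσ.update hp (v := if σ b.1.1 = b.2 then !a.2 else a.2) (hval σ _ ?_),
        hτ.update hp (v := if σ b.1.1 = b.2 then a.2 else !a.2) (hval τ _ ?_), ?_⟩
      · by_cases h : σ b.1.1 = b.2 <;> simp [h]
      · by_cases h : σ b.1.1 = b.2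
        · simp [h]
        · right
          revert h hneq
          cases σ b.1.1 <;> cases τ b.1.1 <;> cases b.2 <;> simp
      · rw [diffCount_update hx, diffCount_eq_card_iff.2 hd]
        have : ¬ ((if σ b.1.1 = b.2 then !a.2 else a.2) =
            if σ b.1.1 = b.2 then a.2 else !a.2) := by
          by_cases h : σ b.1.1 = b.2 <;> simp [h]
        rw [if_neg this]
        omega
    · have hno : ∀ ρ : ℕ → Bool, ∀ v : Bool, ∀ a' b' : Vertex φ, ClauseAdj a' b' →
          a'.1.1 = x → b'.1.1 ∈ W → v = a'.2 ∨ ρ b'.1.1 = b'.2 :=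
        fun ρ v a' b' hab' ha' hb' => absurd ⟨a', b', hab', ha', hb'⟩ he
      refine ⟨_, _, hσ.update hp (v := true) (hno σ _), hτ.update hp (v := false) (hno τ _), ?_⟩
      rw [diffCount_update hx, diffCount_eq_card_iff.2 hd]
      simp only [Bool.true_eq_false, if_false]
      omega
  · obtain ⟨σ, τ, hσ, hτ, hd⟩ := ih' μ hle
    obtain ⟨v, hv⟩ : ∃ v : Bool, ∀ a b : Vertex φ, ClauseAdj a b → a.1.1 = x → b.1.1 ∈ W →
        v = a.2 := by
      by_cases he : ∃ a b : Vertex φ, ClauseAdj a b ∧ a.1.1 = x ∧ b.1.1 ∈ W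
      · obtain ⟨a, b, hab, ha, hb⟩ := he
        refine ⟨a.2, fun a' b' hab' ha' hb' => ?_⟩
        rw [(hu a b a' b' hab hab' ha ha' hb hb').1]
      · exact ⟨true, fun a' b' hab' ha' hb' => absurd ⟨a', b', hab', ha', hb'⟩ he⟩
    refine ⟨_, _, hσ.update hp (v := v) (fun a b h1 h2 h3 => .inl (hv a b h1 h2 h3)),
      hτ.update hp (v := v) (fun a b h1 h2 h3 => .inl (hv a b h1 h2 h3)), ?_⟩
    rw [diffCount_update hx, hd]
    simp

/-! ### Components and their variables. -/

theorem mem_supp_of_adj {C : Component φ} {a b : Vertex φ} (ha : a ∈ C.supp)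
    (h : (graph φ).Adj a b) : b ∈ C.supp := by
  rw [SimpleGraph.ConnectedComponent.mem_supp_iff] at ha ⊢
  rw [← ha]
  exact (SimpleGraph.ConnectedComponent.connectedComponentMk_eq_of_adj h).symm

theorem partner_mem_supp (hp : IsProper φ) {C : Component φ} {a : Vertex φ} (ha : a ∈ C.supp) :
    a.partner ∈ C.supp :=
  mem_supp_of_adj ha ((graph_adj hp).2 (.inl rfl))

theorem mem_of_adj_closed {C : Component φ} {P : Vertex φ → Prop} {a : Vertex φ}
    (ha : a ∈ C.supp) (hPa : P a) (hP : ∀ b c, b ∈ C.supp → P b → (graph φ).Adj b c → P c)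
    {b : Vertex φ} (hb : b ∈ C.supp) : P b := by
  have hr : (graph φ).Reachable a b := by
    rw [SimpleGraph.ConnectedComponent.mem_supp_iff] at ha hb
    exact SimpleGraph.ConnectedComponent.exact (ha.trans hb.symm)
  obtain ⟨p⟩ := hr
  induction p with
  | nil => exact hPa
  | cons h q ih =>
    exact ih (mem_supp_of_adj ha h) (hP _ _ ha hPa h) hb

theorem mem_compVars (hp : IsProper φ) {C : Component φ} {a : Vertex φ} :
    a.1.1 ∈ compVars C ↔ a ∈ C.supp := by
  classical
  simp only [compVars, Finset.mem_filter]
  constructor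
  · rintro ⟨-, b, hb, hba⟩
    rcases Vertex.eq_or_eq_partner (Subtype.ext hba.symm : a.1 = b.1) with rfl | rfl
    · exact hb
    · exact partner_mem_supp hp hb
  · exact fun h => ⟨a.1.2, a, h, rfl⟩

theorem exists_vertex_of_mem_compVars {C : Component φ} {x : ℕ} (hx : x ∈ compVars C) :
    ∃ a ∈ C.supp, a.1.1 = x := by
  classical
  simp only [compVars, Finset.mem_filter] at hx
  exact hx.2

theorem satisfiesOn_iff (hp : IsProper φ) {C : Component φ} {σ : ℕ → Bool} :
    SatisfiesOn σ C ↔ SatisfiesWithin φ σ (compVars C) := by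
  constructor
  · rintro h a b (hab | hab) ha hb
    · exact h a ((mem_compVars hp).1 ha) b hab
    · exact (h b ((mem_compVars hp).1 hb) a hab).symm
  · intro h a ha b hab
    have hab' : ClauseAdj a b := .inl hab
    exact h a b hab' ((mem_compVars hp).2 ha)
      ((mem_compVars hp).2 (mem_supp_of_adj ha ((graph_adj hp).2 (.inr hab'))))

/-! ### Pure and balanced components. -/

/-- Every vertex of `C` lies on a clause-edge. -/
def IsPure (C : Component φ) : Prop := ∀ a ∈ C.supp, ∃ b, ClauseAdj a b

/-- Some assignment satisfies exactly one literal of every clause-edge of `C`. -/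
def IsBalanced (C : Component φ) : Prop :=
  ∃ σ : ℕ → Bool, ∀ a ∈ C.supp, ∀ b, ClauseAdj a b → (σ a.1.1 = a.2 ↔ σ b.1.1 ≠ b.2)

/-- At a vertex `w` without clause-edges, making the partner literal true satisfies every clause of
that variable. On the other variables `exists_diff` applies: a set `T` without a peelable variable
would be closed under adjacency, hence contain the variable of `w`. -/
theorem mem_compDiffs_of_not_isPure (hφ : IsTwoTwoCNF φ) (hp : IsProper φ) {C : Component φ}
    (h : ¬ IsPure C) {μ : ℕ} (hμ : μ ≤ (compVars C).card - 1) : μ ∈ compDiffs C := by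
  simp only [IsPure, not_forall, not_exists] at h
  obtain ⟨w, hw, hno⟩ := h
  have hx := (mem_compVars hp).2 hw
  obtain ⟨σ, τ, hσ, hτ, hd⟩ := exists_diff hp ((compVars C).erase w.1.1) (by
    intro T hT hne
    by_contra hcon
    simp only [not_exists, not_and] at hcon
    obtain ⟨y, hy⟩ := hne
    obtain ⟨a, ha, rfl⟩ := exists_vertex_of_mem_compVars (Finset.mem_of_mem_erase (hT hy))
    have hwT : w.1.1 ∈ T := mem_of_adj_closed (P := fun v => v.1.1 ∈ T) ha hy (by
      intro b c hb hbT hbc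
      rcases (graph_adj hp).1 hbc with rfl | hbc
      · exact hbT
      · have := hcon _ hbT
        simp only [HalfEdgeUnique, not_forall] at this
        obtain ⟨a₁, b₁, a₂, b₂, h₁, h₂, e₁, e₂, m₁, m₂, hne⟩ := this
        -- Two distinct half-edges at this variable lead into `T`; there is no third one, so the
        -- given edge is one of them.
        rcases half_edges hφ hp hbc h₁ h₂ e₁ e₂ with ⟨-, rfl⟩ | ⟨-, rfl⟩ | hh
        · exact m₁
        · exact m₂
        · exact absurd hh hne) hw
    exact absurd rfl (Finset.ne_of_mem_erase (hT hwT))) μ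
    (by rwa [Finset.card_erase_of_mem hx])
  have hval : ∀ ρ : ℕ → Bool, ∀ a b : Vertex φ, ClauseAdj a b → a.1.1 = w.1.1 →
      b.1.1 ∈ compVars C → (!w.2) = a.2 ∨ ρ b.1.1 = b.2 := by
    intro ρ a b hab ha _
    rcases Vertex.eq_or_eq_partner (Subtype.ext ha : a.1 = w.1) with rfl | rfl
    · exact absurd hab (hno b)
    · exact .inl rfl
  refine ⟨_, _, (satisfiesOn_iff hp).2 (hσ.update hp (hval σ)),
    (satisfiesOn_iff hp).2 (hτ.update hp (hval τ)), ?_⟩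
  rw [diffCount_update hx, hd]
  simp

theorem le_card_of_mem_compDiffs {C : Component φ} {μ : ℕ} (h : μ ∈ compDiffs C) :
    μ ≤ (compVars C).card := by
  obtain ⟨σ, τ, -, -, rfl⟩ := h
  exact diffCount_le _ _ _

/-- Assignments that differ everywhere are complementary, and a clause holds under both exactly when
one of its literals is true and the other false. -/
theorem card_mem_compDiffs_iff (hp : IsProper φ) {C : Component φ} :
    (compVars C).card ∈ compDiffs C ↔ IsBalanced C := by
  constructor
  · rintro ⟨σ, τ, hσ, hτ, hd⟩
    rw [diffCount_eq_card_iff] at hd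
    rw [satisfiesOn_iff hp] at hσ hτ
    refine ⟨σ, fun a ha b hab => ?_⟩
    have ha' := (mem_compVars hp).2 ha
    have hb' := (mem_compVars hp).2 (mem_supp_of_adj ha ((graph_adj hp).2 (.inr hab)))
    have h1 := hσ a b hab ha' hb'
    have h2 := hτ a b hab ha' hb'
    have h3 := hd _ ha'
    have h4 := hd _ hb'
    revert h1 h2 h3 h4
    cases σ a.1.1 <;> cases τ a.1.1 <;> cases σ b.1.1 <;> cases τ b.1.1 <;> cases a.2 <;>
      cases b.2 <;> simp
  · rintro ⟨σ, hσ⟩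
    refine ⟨σ, fun x => !σ x, ?_, ?_, ?_⟩
    · intro a ha b hab
      have := hσ a ha b (.inl hab)
      tauto
    · intro a ha b hab
      have := hσ a ha b (.inl hab)
      revert this
      dsimp only
      cases σ a.1.1 <;> cases σ b.1.1 <;> cases a.2 <;> cases b.2 <;> simp
    · rw [diffCount_eq_card_iff]
      intro x _
      simp

theorem compDiffs_of_isBalanced (hφ : IsTwoTwoCNF φ) (hp : IsProper φ) {C : Component φ}
    (h : ¬ IsPure C) (hb : IsBalanced C) : compDiffs C = {μ | μ ≤ (compVars C).card} := by
  ext μ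
  refine ⟨le_card_of_mem_compDiffs, fun hμ => ?_⟩
  rcases Nat.lt_or_eq_of_le hμ with hlt | rfl
  · exact mem_compDiffs_of_not_isPure hφ hp h (by omega)
  · exact (card_mem_compDiffs_iff hp).2 hb

theorem compDiffs_of_not_isBalanced (hφ : IsTwoTwoCNF φ) (hp : IsProper φ) {C : Component φ}
    (h : ¬ IsPure C) (hb : ¬ IsBalanced C) :
    compDiffs C = {μ | μ ≤ (compVars C).card - 1} := by
  ext μ
  refine ⟨fun hμ => ?_, fun hμ => mem_compDiffs_of_not_isPure hφ hp h hμ⟩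
  have h1 := le_card_of_mem_compDiffs hμ
  have h2 : μ ≠ (compVars C).card := by
    rintro rfl
    exact hb ((card_mem_compDiffs_iff hp).1 hμ)
  change μ ≤ _
  omega

/-- The partner vertex uses one of the two half-edges of the variable, which leaves only one for
`a`. -/
theorem IsPure.clauseAdj_unique (hφ : IsTwoTwoCNF φ) (hp : IsProper φ) {C : Component φ}
    (h : IsPure C) {a b b' : Vertex φ} (ha : a ∈ C.supp) (hb : ClauseAdj a b)
    (hb' : ClauseAdj a b') : b = b' := by
  obtain ⟨c, hc⟩ := h _ (partner_mem_supp hp ha)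
  rcases half_edges hφ hp hb hb' hc rfl rfl with h | h | h
  · exact h.2
  · exact absurd h.1.symm a.partner_ne
  · exact absurd h.1.symm a.partner_ne

/-- In a pure component, a satisfying assignment makes exactly one literal of each clause true:
the clause-edges inject the false vertices into the true ones, and there are equally many. -/
theorem IsPure.exactly_one (hφ : IsTwoTwoCNF φ) (hp : IsProper φ) {C : Component φ}
    (h : IsPure C) {σ : ℕ → Bool} (hσ : SatisfiesOn σ C) {a b : Vertex φ} (ha : a ∈ C.supp)
    (hab : ClauseAdj a b) : σ a.1.1 = a.2 ↔ σ b.1.1 ≠ b.2 := by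
  classical
  rw [satisfiesOn_iff hp] at hσ
  have hcl : ∀ {a b : Vertex φ}, a ∈ C.supp → ClauseAdj a b → b ∈ C.supp :=
    fun ha hab => mem_supp_of_adj ha ((graph_adj hp).2 (.inr hab))
  have hsat : ∀ {a b : Vertex φ}, a ∈ C.supp → ClauseAdj a b → σ a.1.1 = a.2 ∨ σ b.1.1 = b.2 :=
    fun ha hab => hσ _ _ hab ((mem_compVars hp).2 ha) ((mem_compVars hp).2 (hcl ha hab))
  let F : Finset (Vertex φ) := Finset.univ.filter fun v => v ∈ C.supp ∧ σ v.1.1 ≠ v.2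
  let T : Finset (Vertex φ) := Finset.univ.filter fun v => v ∈ C.supp ∧ σ v.1.1 = v.2
  have hF : ∀ v, v ∈ F ↔ v ∈ C.supp ∧ σ v.1.1 ≠ v.2 := fun v => by simp [F]
  have hT : ∀ v, v ∈ T ↔ v ∈ C.supp ∧ σ v.1.1 = v.2 := fun v => by simp [T]
  choose! f hf using h
  -- Partners of true vertices are false.
  have hcard : T.card ≤ F.card := by
    refine Finset.card_le_card_of_injOn Vertex.partner (fun v hv => ?_) (fun v _ w _ hvw => ?_)
    · have hv := (hT v).1 hv
      refine (hF _).2 ⟨partner_mem_supp hp hv.1, ?_⟩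
      change σ v.1.1 ≠ !v.2
      rw [hv.2]
      simp
    · rw [← v.partner_partner, hvw, w.partner_partner]
  -- Following the clause-edge injects false vertices into true ones; by cardinality it is onto, so
  -- every true vertex faces a false one.
  have hsurj := Finset.surjOn_of_injOn_of_card_le (s := F) (t := T) f (fun v hv => by
      have hv := (hF v).1 hv
      exact (hT _).2 ⟨hcl hv.1 (hf v hv.1), (hsat hv.1 (hf v hv.1)).resolve_left hv.2⟩)
    (fun v hv w hw hvw => by
      have hv := (hF v).1 hv
      have hw := (hF w).1 hw
      have h1 := hf v hv.1
      have h2 := hf w hw.1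
      rw [← hvw] at h2
      exact IsPure.clauseAdj_unique hφ hp (fun a ha => ⟨_, hf a ha⟩) (hcl hv.1 h1) h1.symm h2.symm)
    hcard
  refine ⟨fun hta htb => ?_, fun htb => (hsat ha hab).resolve_right htb⟩
  obtain ⟨c, hc, rfl⟩ := hsurj ((hT b).2 ⟨hcl ha hab, htb⟩)
  have hc := (hF c).1 hc
  have : a = c := IsPure.clauseAdj_unique hφ hp (fun a ha => ⟨_, hf a ha⟩) (hcl ha hab)
    hab.symm (hf c hc.1).symm
  rw [← this] at hc
  exact hc.2 hta

/-- Along every edge the truth value of one literal determines that of the other, so agreement of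
two assignments at one variable spreads over the component. -/
theorem compDiffs_of_isPure (hφ : IsTwoTwoCNF φ) (hp : IsProper φ) {C : Component φ}
    (h : IsPure C) (hb : IsBalanced C) : compDiffs C = {0, (compVars C).card} := by
  ext μ
  constructor
  · rintro ⟨σ, τ, hσ, hτ, rfl⟩
    by_cases hall : ∃ a ∈ C.supp, σ a.1.1 = τ a.1.1
    · obtain ⟨a, ha, he⟩ := hall
      left
      simp only [diffCount, Finset.card_eq_zero, Finset.filter_eq_empty_iff, not_not]
      intro x hx
      obtain ⟨b, hb, rfl⟩ := exists_vertex_of_mem_compVars hx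
      refine mem_of_adj_closed (P := fun v => σ v.1.1 = τ v.1.1) ha he (fun b c hb hbe hbc => ?_) hb
      rcases (graph_adj hp).1 hbc with rfl | hbc
      · exact hbe
      · have h1 := h.exactly_one hφ hp hσ hb hbc
        have h2 := h.exactly_one hφ hp hτ hb hbc
        revert h1 h2 hbe
        cases σ b.1.1 <;> cases τ b.1.1 <;> cases σ c.1.1 <;> cases τ c.1.1 <;> cases b.2 <;>
          cases c.2 <;> simp
    · right
      simp only [not_exists, not_and] at hall
      rw [Set.mem_singleton_iff, diffCount_eq_card_iff]
      intro x hx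
      obtain ⟨a, ha, rfl⟩ := exists_vertex_of_mem_compVars hx
      exact hall a ha
  · rintro (rfl | rfl)
    · obtain ⟨σ, τ, hσ, -, -⟩ := (card_mem_compDiffs_iff hp).2 hb
      exact ⟨σ, σ, hσ, hσ, by simp [diffCount]⟩
    · exact (card_mem_compDiffs_iff hp).2 hb

end

end DifferSAT

namespace DifferSAT

/-! ### Walks -/

section Walks

open SimpleGraph

variable {V : Type*} {G : SimpleGraph V}

theorem walk_parity {c : V → Bool} {u v : V} (p : G.Walk u v)
    (hc : ∀ a b, s(a, b) ∈ p.edges → c a ≠ c b) : c u = c v ↔ Even p.length := by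
  induction p with
  | nil => simp
  | @cons u v w h q ih =>
    have h1 := hc u v (by simp)
    have h2 := ih fun a b hab => hc a b (by simp [hab])
    rw [Walk.length_cons, Nat.even_add_one, ← h2]
    revert h1
    cases c u <;> cases c v <;> cases c w <;> simp

theorem path_coloring {u v : V} (p : G.Walk u v) (hp : p.IsPath) :
    ∃ c : V → Bool, ∀ a b, s(a, b) ∈ p.edges → c a ≠ c b := by
  classical
  induction p with
  | nil => exact ⟨fun _ => true, by simp⟩
  | @cons u v w h q ih =>
    rw [Walk.cons_isPath_iff] at hp
    obtain ⟨c, hc⟩ := ih hp.1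
    have hne : v ≠ u := fun hvu => hp.2 (hvu ▸ q.start_mem_support)
    refine ⟨Function.update c u (!c v), fun a b hab => ?_⟩
    rw [Walk.edges_cons, List.mem_cons, Sym2.eq_iff] at hab
    rcases hab with (⟨rfl, rfl⟩ | ⟨rfl, rfl⟩) | hab
    · rw [Function.update_self, Function.update_of_ne hne]; simp
    · rw [Function.update_self, Function.update_of_ne hne]; simp
    · rw [Function.update_of_ne, Function.update_of_ne]
      · exact hc a b hab
      · rintro rfl; exact hp.2 (q.snd_mem_support_of_mem_edges hab)
      · rintro rfl; exact hp.2 (q.fst_mem_support_of_mem_edges hab)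

/-- Without its first edge the cycle is a path of odd length, so a colouring of that path gives the
ends of the missing edge different colours. -/
theorem even_cycle_coloring {u : V} (p : G.Walk u u) (hp : p.IsCycle) (he : Even p.length) :
    ∃ c : V → Bool, ∀ a b, s(a, b) ∈ p.edges → c a ≠ c b := by
  cases p with
  | nil => exact absurd rfl hp.ne_nil
  | @cons _ v _ h q =>
    rw [Walk.cons_isCycle_iff] at hp
    obtain ⟨c, hc⟩ := path_coloring q hp.1
    have hcuv : c v ≠ c u := by
      rw [Ne, walk_parity q hc]
      rwa [Walk.length_cons, Nat.even_add_one] at he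
    refine ⟨c, fun a b hab => ?_⟩
    rw [Walk.edges_cons, List.mem_cons, Sym2.eq_iff] at hab
    rcases hab with (⟨rfl, rfl⟩ | ⟨rfl, rfl⟩) | hab
    · exact hcuv.symm
    · exact hcuv
    · exact hc a b hab

theorem cycle_neighbors {u : V} {p : G.Walk u u} (hp : p.IsCycle) {a : V} (ha : a ∈ p.support) :
    ∃ c c', c ≠ c' ∧ s(a, c) ∈ p.edges ∧ s(a, c') ∈ p.edges := by
  obtain ⟨c, c', hne, h⟩ := Set.ncard_eq_two.1 (hp.ncard_neighborSet_toSubgraph_eq_two ha)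
  refine ⟨c, c', hne, ?_, ?_⟩ <;> rw [← Walk.adj_toSubgraph_iff_mem_edges,
    ← Subgraph.mem_neighborSet, h] <;> simp

theorem path_neighbors {u v : V} {p : G.Walk u v} (hp : p.IsPath) {a : V} (ha : a ∈ p.support)
    (hu : a ≠ u) (hv : a ≠ v) :
    ∃ c c', c ≠ c' ∧ s(a, c) ∈ p.edges ∧ s(a, c') ∈ p.edges := by
  obtain ⟨i, rfl, hi⟩ := Walk.mem_support_iff_exists_getVert.1 ha
  have h0 : i ≠ 0 := by rintro rfl; simp at hu
  have h1 : i ≠ p.length := by rintro rfl; simp at hv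
  obtain ⟨c, c', hne, h⟩ := Set.ncard_eq_two.1
    (hp.ncard_neighborSet_toSubgraph_internal_eq_two h0 (by omega))
  refine ⟨c, c', hne, ?_, ?_⟩ <;> rw [← Walk.adj_toSubgraph_iff_mem_edges,
    ← Subgraph.mem_neighborSet, h] <;> simp

theorem path_start_edge_unique {u v : V} {p : G.Walk u v} (hp : p.IsPath) {a b : V}
    (ha : s(u, a) ∈ p.edges) (hb : s(u, b) ∈ p.edges) : a = b := by
  cases p with
  | nil => simp at ha
  | @cons _ w _ h q =>
    rw [Walk.cons_isPath_iff] at hp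
    have key : ∀ x, s(u, x) ∈ (Walk.cons h q).edges → x = w := by
      intro x hx
      rw [Walk.edges_cons, List.mem_cons, Sym2.eq_iff] at hx
      rcases hx with (⟨-, rfl⟩ | ⟨rfl, rfl⟩) | hx
      · rfl
      · rfl
      · exact absurd (q.fst_mem_support_of_mem_edges hx) hp.2
    rw [key a ha, key b hb]

/-- Splitting the path at `a`, the vertex `b` lies in the front or the back part; in the former case
the segment is reversed. -/
theorem exists_subpath {u v : V} {p : G.Walk u v} (hp : p.IsPath) {a b : V}
    (ha : a ∈ p.support) (hb : b ∈ p.support) :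
    ∃ q : G.Walk a b, q.IsPath ∧ q.edges ⊆ p.edges ∧ q.support ⊆ p.support := by
  classical
  have hb' := hb
  rw [← p.take_spec ha, Walk.mem_support_append_iff] at hb'
  rcases hb' with h | h
  · refine ⟨((p.takeUntil a ha).dropUntil b h).reverse,
      ((hp.takeUntil ha).dropUntil h).reverse, ?_, ?_⟩
    · intro e he
      rw [Walk.edges_reverse, List.mem_reverse] at he
      exact p.edges_takeUntil_subset_edges ha (Walk.edges_dropUntil_subset_edges _ h he)
    · intro e he
      rw [Walk.support_reverse, List.mem_reverse] at he
      exact p.support_takeUntil_subset_support ha (Walk.support_dropUntil_subset_support _ h he)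
  · refine ⟨(p.dropUntil a ha).takeUntil b h, (hp.dropUntil ha).takeUntil h, ?_, ?_⟩
    · intro e he
      exact p.edges_dropUntil_subset_edges ha (Walk.edges_takeUntil_subset_edges _ h he)
    · intro e he
      exact p.support_dropUntil_subset_support ha (Walk.support_takeUntil_subset_support _ h he)

/-- An edge between two vertices of a path that is not an edge of the path closes a cycle. -/
theorem exists_cycle_of_chord {u v : V} {p : G.Walk u v} (hp : p.IsPath) {a b : V}
    (ha : a ∈ p.support) (hb : b ∈ p.support) (h : G.Adj a b) (hab : s(a, b) ∉ p.edges) :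
    ∃ q : G.Walk a a, q.IsCycle := by
  obtain ⟨q, hq, he, -⟩ := exists_subpath hp hb ha
  exact ⟨Walk.cons h q, (Walk.cons_isCycle_iff q h).2 ⟨hq, fun hm => hab (he hm)⟩⟩

/-- A vertex outside a path with two neighbours on the path lies on a cycle. -/
theorem exists_cycle_of_two_neighbors {u v : V} {p : G.Walk u v} (hp : p.IsPath) {w a b : V}
    (hw : w ∉ p.support) (ha : a ∈ p.support) (hb : b ∈ p.support) (hab : a ≠ b)
    (hwa : G.Adj w a) (hwb : G.Adj w b) : ∃ q : G.Walk w w, q.IsCycle := by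
  obtain ⟨q, hq, he, hs⟩ := exists_subpath hp ha hb
  refine ⟨Walk.cons hwa (q.concat hwb.symm), (Walk.cons_isCycle_iff _ _).2
    ⟨(Walk.concat_isPath_iff hwb.symm).2 ⟨hq, fun h => hw (hs h)⟩, fun hm => ?_⟩⟩
  rw [Walk.edges_concat, List.concat_eq_append, List.mem_append, List.mem_singleton,
    Sym2.eq_iff] at hm
  rcases hm with hm | ⟨rfl, -⟩ | ⟨-, h⟩
  · exact hw (hs (q.fst_mem_support_of_mem_edges hm))
  · exact hw hb
  · exact hab h

/-- The vertices of a cycle on which a fixed-point-free involution acts are even in number. -/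
theorem even_length_of_involution {u : V} {p : G.Walk u u} (hp : p.IsCycle) {f : V → V}
    (hf : ∀ a ∈ p.support, f a ∈ p.support) (hne : ∀ a, f a ≠ a) (hff : ∀ a, f (f a) = a) :
    Even p.length := by
  classical
  have htail : ∀ a, a ∈ p.support.tail ↔ a ∈ p.support := by
    intro a
    refine ⟨fun h => List.mem_of_mem_tail h, fun h => ?_⟩
    rw [← p.cons_tail_support, List.mem_cons] at h
    rcases h with rfl | h
    · exact Walk.end_mem_tail_support hp.not_nil
    · exact h
  have hcard : p.support.tail.toFinset.card = p.length := by
    rw [List.toFinset_card_of_nodup hp.support_nodup, List.length_tail, Walk.length_support]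
    rfl
  -- The involution pairs off the vertices, so their number vanishes modulo 2.
  have hsum : ∑ _a ∈ p.support.tail.toFinset, (1 : ZMod 2) = 0 :=
    Finset.sum_involution (fun a _ => f a) (fun _ _ => by decide) (fun a _ _ => hne a)
      (fun a ha => by simpa [htail] using hf a (by simpa [htail] using ha)) (fun a _ => hff a)
  rw [Finset.sum_const, hcard, nsmul_one] at hsum
  exact (ZMod.natCast_eq_zero_iff_even).1 hsum

end Walks

end DifferSAT

namespace DifferSAT

/-! ### Shapes of components -/

section Shapes

open SimpleGraph

variable {φ : CNF}

theorem support_subset_supp {C : Component φ} {u v : Vertex φ} {p : (graph φ).Walk u v}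
    (hu : u ∈ C.supp) {a : Vertex φ} (ha : a ∈ p.support) : a ∈ C.supp := by
  induction p with
  | nil =>
    rw [Walk.support_nil, List.mem_singleton] at ha
    exact ha ▸ hu
  | cons h q ih =>
    rw [Walk.support_cons, List.mem_cons] at ha
    rcases ha with rfl | ha
    · exact hu
    · exact ih (mem_supp_of_adj hu h) ha

theorem IsCore.clause_mem_edges (hp : IsProper φ) {C : Component φ} {u v : Vertex φ}
    {p : (graph φ).Walk u v} (hc : IsCore C p) {a b : Vertex φ} (ha : a ∈ C.supp)
    (hab : ClauseAdj a b) : s(a, b) ∈ p.edges :=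
  (hc.2 a ha b ((graph_adj hp).2 (.inr hab))).resolve_right
    fun h => hab.ne hp (by rw [h.1])

theorem IsCore.partner_mem_edges (hp : IsProper φ) {C : Component φ} {u v : Vertex φ}
    {p : (graph φ).Walk u v} (hc : IsCore C p) {a : Vertex φ}
    (ha : a ∈ p.support) (ha' : a.partner ∈ p.support) : s(a, a.partner) ∈ p.edges :=
  (hc.2 a (support_subset_supp hc.1 ha) _ ((graph_adj hp).2 (.inl rfl))).resolve_right
    fun h => h.2.elim (fun h => h.2 ha') (fun h => h.2 ha)

theorem IsCore.supp_subset_support (hp : IsProper φ) {C : Component φ} {u v : Vertex φ}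
    {p : (graph φ).Walk u v} (hc : IsCore C p) (h : IsPure C) {a : Vertex φ} (ha : a ∈ C.supp) :
    a ∈ p.support := by
  obtain ⟨b, hb⟩ := h a ha
  exact p.fst_mem_support_of_mem_edges (hc.clause_mem_edges hp ha hb)

/-- Colours are read as truth values of literals. A vertex off the walk gets the opposite colour of
its partner; two partners on the walk already have opposite colours, because their matching-edge
belongs to it. Every clause-edge is an edge of the walk, so its ends have different colours. -/
theorem IsCore.isBalanced (hp : IsProper φ) {C : Component φ} {u v : Vertex φ}
    {p : (graph φ).Walk u v} (hc : IsCore C p) {c : Vertex φ → Bool}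
    (hcol : ∀ a b, s(a, b) ∈ p.edges → c a ≠ c b) : IsBalanced C := by
  classical
  let c' : Vertex φ → Bool := fun a => if a ∈ p.support then c a else !c a.partner
  let σ : ℕ → Bool := fun x => if hx : x ∈ vars φ then c' (⟨x, hx⟩, true) else true
  have hσ : ∀ a ∈ p.support, (σ a.1.1 = a.2 ↔ c a = true) := by
    intro a ha
    have e : σ a.1.1 = c' (a.1, true) := dif_pos a.1.2
    rw [e]
    obtain ⟨x, s⟩ := a
    cases s
    · have hpart : ((x, true) : Vertex φ) = Vertex.partner (x, false) := rfl
      simp only [c']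
      split_ifs with hm
      · have := hcol _ _ (hc.partner_mem_edges hp ha (hpart ▸ hm))
        rw [hpart]
        revert this
        cases c (x, false) <;> cases c (Vertex.partner (x, false)) <;> simp
      · rw [hpart, Vertex.partner_partner]
        simp
    · simp only [c', if_pos ha]
  refine ⟨σ, fun a ha b hab => ?_⟩
  have he := hc.clause_mem_edges hp ha hab
  have h := hcol a b he
  rw [hσ a (p.fst_mem_support_of_mem_edges he), Ne, hσ b (p.snd_mem_support_of_mem_edges he)]
  revert h
  cases c a <;> cases c b <;> simp

theorem IsPathLike.isBalanced (hp : IsProper φ) {C : Component φ} (h : IsPathLike C) :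
    IsBalanced C := by
  obtain ⟨u, v, p, hpath, hc⟩ := h
  obtain ⟨c, hcol⟩ := path_coloring p hpath
  exact hc.isBalanced hp hcol

/-- In a pure component all vertices lie on the path, and its start would have both a clause-edge
and its matching-edge on the path, but it has only one edge there. -/
theorem IsPathLike.not_isPure (hp : IsProper φ) {C : Component φ} (h : IsPathLike C) :
    ¬ IsPure C := by
  obtain ⟨u, v, p, hpath, hc⟩ := h
  intro hpure
  obtain ⟨b, hb⟩ := hpure u hc.1
  have h1 := hc.clause_mem_edges hp hc.1 hb
  have h2 := hc.partner_mem_edges hp p.start_mem_support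
    (hc.supp_subset_support hp hpure (partner_mem_supp hp hc.1))
  rw [path_start_edge_unique hpath h1 h2] at hb
  exact hb.ne hp rfl

theorem IsPendantEvenCycleLike.isBalanced (hp : IsProper φ) {C : Component φ}
    (h : IsPendantEvenCycleLike C) : IsBalanced C := by
  obtain ⟨u, p, hcyc, hc, he, -⟩ := h
  obtain ⟨c, hcol⟩ := even_cycle_coloring p hcyc he
  exact hc.isBalanced hp hcol

theorem IsPendantEvenCycleLike.not_isPure (hp : IsProper φ) {C : Component φ}
    (h : IsPendantEvenCycleLike C) : ¬ IsPure C := by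
  obtain ⟨u, p, -, hc, -, a, ha, hna⟩ := h
  exact fun hpure => hna (hc.supp_subset_support hp hpure ha)

theorem IsPureEvenCycle.isBalanced (hp : IsProper φ) {C : Component φ}
    (h : IsPureEvenCycle C) : IsBalanced C := by
  obtain ⟨u, p, hcyc, hc, he, -⟩ := h
  obtain ⟨c, hcol⟩ := even_cycle_coloring p hcyc he
  exact hc.isBalanced hp hcol

theorem clauseAdj_of_mem_edges (hp : IsProper φ) {u v a b : Vertex φ} {p : (graph φ).Walk u v}
    (h : s(a, b) ∈ p.edges) (hb : b ≠ a.partner) : ClauseAdj a b :=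
  ((graph_adj hp).1 (p.adj_of_mem_edges h)).resolve_left hb

/-- Of the two neighbours of a vertex on the cycle, at most one is its partner; the other is joined
by a clause-edge. -/
theorem IsPureEvenCycle.isPure (hp : IsProper φ) {C : Component φ}
    (h : IsPureEvenCycle C) : IsPure C := by
  obtain ⟨u, p, hcyc, hc, he, hall⟩ := h
  intro a ha
  obtain ⟨c, c', hne, h1, h2⟩ := cycle_neighbors hcyc (hall a ha)
  by_cases hcp : c = a.partner
  · exact ⟨c', clauseAdj_of_mem_edges hp h2 fun h => hne (hcp.trans h.symm)⟩
  · exact ⟨c, clauseAdj_of_mem_edges hp h1 hcp⟩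

/-- The truth values of the literals under a balanced assignment alternate along clause-edges and
matching-edges alike, which is impossible on an odd closed walk. -/
theorem IsOddCycleLike.not_isBalanced (hp : IsProper φ) {C : Component φ}
    (h : IsOddCycleLike C) : ¬ IsBalanced C := by
  obtain ⟨u, p, -, hc, ho⟩ := h
  rintro ⟨σ, hσ⟩
  refine Nat.not_even_iff_odd.2 ho ((walk_parity (c := fun a => decide (σ a.1.1 = a.2)) p
    fun a b hab => ?_).1 rfl)
  have ha := support_subset_supp hc.1 (p.fst_mem_support_of_mem_edges hab)
  rcases (graph_adj hp).1 (p.adj_of_mem_edges hab) with rfl | hab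
  · rw [Ne, decide_eq_decide]
    change ¬ (σ a.1.1 = a.2 ↔ σ a.1.1 = !a.2)
    cases σ a.1.1 <;> cases a.2 <;> simp
  · have := hσ a ha b hab
    simp only [ne_eq, decide_eq_decide]
    tauto

/-- In a pure component the cycle contains all vertices, so it is closed under partners and has even
length. -/
theorem IsOddCycleLike.not_isPure (hp : IsProper φ) {C : Component φ}
    (h : IsOddCycleLike C) : ¬ IsPure C := by
  obtain ⟨u, p, hcyc, hc, ho⟩ := h
  intro hpure
  refine Nat.not_even_iff_odd.2 ho (even_length_of_involution hcyc (f := Vertex.partner)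
    (fun a ha => ?_) Vertex.partner_ne Vertex.partner_partner)
  exact hc.supp_subset_support hp hpure (partner_mem_supp hp (support_subset_supp hc.1 ha))

/-! ### Every component has one of the four shapes -/

/-- Once two distinct half-edges of a variable lie on the walk, no others are left. -/
theorem half_edge_mem_edges (hφ : IsTwoTwoCNF φ) (hp : IsProper φ) {u v : Vertex φ}
    {p : (graph φ).Walk u v} {a₁ b₁ a₂ b₂ a b : Vertex φ} (h₁ : ClauseAdj a₁ b₁)
    (h₂ : ClauseAdj a₂ b₂) (h : ClauseAdj a b) (e₁ : a₁.1.1 = a.1.1) (e₂ : a₂.1.1 = a.1.1)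
    (m₁ : s(a₁, b₁) ∈ p.edges) (m₂ : s(a₂, b₂) ∈ p.edges) (hne : ¬ (a₁ = a₂ ∧ b₁ = b₂)) :
    s(a, b) ∈ p.edges := by
  rcases half_edges hφ hp h h₁ h₂ e₁ e₂ with ⟨rfl, rfl⟩ | ⟨rfl, rfl⟩ | h
  · exact m₁
  · exact m₂
  · exact absurd h hne

/-- A walk is the core of its component if each of its vertices either has two neighbours along
the walk, or is an end without clause-edges, next to which no clause-edge leaves the walk. -/
theorem isCore_of_local (hφ : IsTwoTwoCNF φ) (hp : IsProper φ) {C : Component φ}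
    {u v : Vertex φ} (p : (graph φ).Walk u v) (hu : u ∈ C.supp)
    (h : ∀ a ∈ p.support, (∃ c c', c ≠ c' ∧ s(a, c) ∈ p.edges ∧ s(a, c') ∈ p.edges) ∨
      (a.partner ∈ p.support ∧ (∀ b, ¬ ClauseAdj a b) ∧
        ∀ b, ClauseAdj a.partner b → s(a.partner, b) ∈ p.edges))
    (hM : ∀ a, a ∈ p.support → a.partner ∈ p.support → s(a, a.partner) ∈ p.edges) :
    IsCore C p := by
  have key : ∀ a ∈ p.support, ∀ a', a'.1.1 = a.1.1 → ∀ b, ClauseAdj a' b →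
      s(a', b) ∈ p.edges := by
    intro a ha a' haa' b hab
    -- Here the walk passes through the matching-edge of `a`. The other neighbour `c'` supplies one
    -- half-edge; a second one comes from the partner, unless the partner is an end without
    -- clause-edges, where all clause-edges at `a` lie on the walk by hypothesis.
    have two : ∀ c c', c ≠ c' → s(a, c) ∈ p.edges → s(a, c') ∈ p.edges → c = a.partner →
        s(a', b) ∈ p.edges := by
      rintro c c' hne h1 h2 rfl
      have hac' := clauseAdj_of_mem_edges hp h2 hne.symm
      rcases h _ (p.snd_mem_support_of_mem_edges h1) with ⟨d, d', hdne, k1, k2⟩ | ⟨-, k1, k2⟩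
      · obtain ⟨e, he, hea⟩ : ∃ e, s(a.partner, e) ∈ p.edges ∧ e ≠ a := by
          by_cases hd : d = a
          · exact ⟨d', k2, fun h => hdne (hd.trans h.symm)⟩
          · exact ⟨d, k1, hd⟩
        exact half_edge_mem_edges hφ hp hac'
          (clauseAdj_of_mem_edges hp he (by rwa [Vertex.partner_partner])) hab haa'.symm
          haa'.symm h2 he fun h => a.partner_ne h.1.symm
      · rw [Vertex.partner_partner] at k2
        rcases Vertex.eq_or_eq_partner (Subtype.ext haa' : a'.1 = a.1) with rfl | rfl
        · exact k2 b hab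
        · exact absurd hab (k1 b)
    rcases h a ha with ⟨c, c', hne, h1, h2⟩ | ⟨-, h1, h2⟩
    · by_cases hc : c = a.partner
      · exact two c c' hne h1 h2 hc
      by_cases hc' : c' = a.partner
      · exact two c' c hne.symm h2 h1 hc'
      exact half_edge_mem_edges hφ hp (clauseAdj_of_mem_edges hp h1 hc)
        (clauseAdj_of_mem_edges hp h2 hc') hab haa'.symm haa'.symm h1 h2 fun h => hne h.2
    · rcases Vertex.eq_or_eq_partner (Subtype.ext haa' : a'.1 = a.1) with rfl | rfl
      · exact absurd hab (h1 b)
      · exact h2 b hab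
  have key' : ∀ a, (a ∈ p.support ∨ a.partner ∈ p.support) → ∀ b, ClauseAdj a b →
      s(a, b) ∈ p.edges := by
    rintro a (ha | ha) b hab
    · exact key a ha a rfl b hab
    · exact key _ ha a rfl b hab
  have hall : ∀ a ∈ C.supp, a ∈ p.support ∨ a.partner ∈ p.support := by
    intro a ha
    refine mem_of_adj_closed (P := fun a => a ∈ p.support ∨ a.partner ∈ p.support) hu
      (.inl p.start_mem_support) (fun b c _ hPb hbc => ?_) ha
    rcases (graph_adj hp).1 hbc with rfl | hbc
    · rw [Vertex.partner_partner]
      exact hPb.symm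
    · exact .inl (p.snd_mem_support_of_mem_edges (key' b hPb c hbc))
  refine ⟨hu, fun a ha b hab => ?_⟩
  rcases (graph_adj hp).1 hab with rfl | hab
  · by_cases h1 : a ∈ p.support
    · by_cases h2 : a.partner ∈ p.support
      · exact .inl (hM a h1 h2)
      · exact .inr ⟨rfl, .inl ⟨h1, h2⟩⟩
    · exact .inr ⟨rfl, .inr ⟨(hall a ha).resolve_left h1, h1⟩⟩
  · exact .inl (key' a (hall a ha) b hab)

/-- If the cycle contained two partners but not their matching-edge, each would have two
clause-edges on it, too many half-edges for one variable. -/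
theorem isCore_of_isCycle (hφ : IsTwoTwoCNF φ) (hp : IsProper φ) {C : Component φ}
    {u : Vertex φ} {p : (graph φ).Walk u u} (hu : u ∈ C.supp) (hcyc : p.IsCycle) :
    IsCore C p := by
  refine isCore_of_local hφ hp p hu (fun a ha => .inl (cycle_neighbors hcyc ha))
    fun a ha ha' => ?_
  obtain ⟨c, c', hne, h1, h2⟩ := cycle_neighbors hcyc ha
  obtain ⟨d, d', hdne, k1, k2⟩ := cycle_neighbors hcyc ha'
  by_contra hcon
  have hc : ∀ {x}, s(a, x) ∈ p.edges → ClauseAdj a x := fun {x} hx =>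
    clauseAdj_of_mem_edges hp hx (by rintro rfl; exact hcon hx)
  have hd : ClauseAdj a.partner d := clauseAdj_of_mem_edges hp k1 (by
    rintro rfl
    rw [Vertex.partner_partner, Sym2.eq_swap] at k1
    exact hcon k1)
  rcases half_edges hφ hp (hc h1) (hc h2) hd rfl rfl with h | h | h
  · exact hne h.2
  · exact a.partner_ne h.1.symm
  · exact a.partner_ne h.1.symm

/-- An end of a longest path in an acyclic component. -/
theorem longest_path_end (hp : IsProper φ) {C : Component φ}
    (hac : ∀ u ∈ C.supp, ∀ p : (graph φ).Walk u u, ¬ p.IsCycle)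
    {u v : Vertex φ} {p : (graph φ).Walk u v} (hu : u ∈ C.supp) (hpath : p.IsPath)
    (hmax : ∀ (u' v' : Vertex φ) (q : (graph φ).Walk u' v'), u' ∈ C.supp → q.IsPath →
      q.length ≤ p.length) :
    u.partner ∈ p.support ∧ (∀ b, ¬ ClauseAdj u b) ∧
      ∀ b, ClauseAdj u.partner b → s(u.partner, b) ∈ p.edges := by
  have chord : ∀ {a b}, a ∈ p.support → b ∈ p.support → (graph φ).Adj a b →
      s(a, b) ∈ p.edges := by
    intro a b ha hb hab
    by_contra hcon
    obtain ⟨q, hq⟩ := exists_cycle_of_chord hpath ha hb hab hcon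
    exact hac a (support_subset_supp hu ha) q hq
  -- A neighbour of `u` off the path would extend it, and one on the path is joined by a path edge,
  -- as there are no chords.
  have hnb : ∀ {w}, (graph φ).Adj u w → s(u, w) ∈ p.edges := by
    intro w hw
    refine chord p.start_mem_support ?_ hw
    by_contra hcon
    have := hmax _ _ (Walk.cons hw.symm p) (mem_supp_of_adj hu hw) (hpath.cons hcon)
    rw [Walk.length_cons] at this
    omega
  have hpart := hnb ((graph_adj hp).2 (.inl rfl))
  have hpm := p.snd_mem_support_of_mem_edges hpart
  refine ⟨hpm, fun b hb => ?_, fun b hb => ?_⟩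
  · have := path_start_edge_unique hpath (hnb ((graph_adj hp).2 (.inr hb))) hpart
    subst this
    exact hb.ne hp rfl
  · have hadj := (graph_adj hp).2 (.inr hb)
    refine chord hpm ?_ hadj
    by_contra hcon
    have hbs : b ∈ C.supp := mem_supp_of_adj (support_subset_supp hu hpm) hadj
    -- Otherwise `b` would have two neighbours on the path, which closes a cycle.
    have hbp : b.partner ∉ p.support := by
      intro hbp
      obtain ⟨q, hq⟩ := exists_cycle_of_two_neighbors hpath hcon hbp hpm
        (fun h => hb.ne hp (by rw [← h]; rfl)) ((graph_adj hp).2 (.inl rfl)) hadj.symm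
      exact hac b hbs q hq
    cases p with
    | nil => simp at hpart
    | @cons _ w _ h q =>
      have hw : w = u.partner := path_start_edge_unique hpath (by simp) hpart
      subst hw
      rw [Walk.cons_isPath_iff] at hpath
      simp only [Walk.support_cons, List.mem_cons, not_or] at hcon hbp
      -- Replacing the end `u` by the two vertices `b.partner` and `b` gives a path longer by one.
      have hpl : (Walk.cons ((graph_adj hp).2 (.inl b.partner_partner.symm))
          (Walk.cons hadj.symm q)).IsPath := by
        rw [Walk.cons_isPath_iff, Walk.cons_isPath_iff, Walk.support_cons, List.mem_cons, not_or]
        exact ⟨⟨hpath.1, hcon.2⟩, b.partner_ne, hbp.2⟩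
      have := hmax _ _ _ (partner_mem_supp hp hbs) hpl
      simp only [Walk.length_cons] at this
      omega

theorem exists_longest_path (C : Component φ) :
    ∃ (u v : Vertex φ) (p : (graph φ).Walk u v), u ∈ C.supp ∧ p.IsPath ∧
      ∀ (u' v' : Vertex φ) (q : (graph φ).Walk u' v'), u' ∈ C.supp → q.IsPath →
        q.length ≤ p.length := by
  classical
  let S : Set ℕ := {n | ∃ (u v : Vertex φ) (p : (graph φ).Walk u v),
    u ∈ C.supp ∧ p.IsPath ∧ p.length = n}
  have hbdd : BddAbove S := by
    refine ⟨Fintype.card (Vertex φ), ?_⟩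
    rintro n ⟨u, v, p, -, hpath, rfl⟩
    exact hpath.length_lt.le
  have hne : S.Nonempty := by
    obtain ⟨a, ha⟩ := C.nonempty_supp
    exact ⟨0, a, a, Walk.nil, ha, Walk.IsPath.nil, rfl⟩
  obtain ⟨u, v, p, hu, hpath, hlen⟩ := Nat.sSup_mem hne hbdd
  refine ⟨u, v, p, hu, hpath, fun u' v' q hu' hq => ?_⟩
  rw [hlen]
  exact le_csSup hbdd ⟨u', v', q, hu', hq, rfl⟩

/-- A longest path meets the local criterion: inner vertices have two neighbours along it, both ends
are covered by `longest_path_end` after a reversal, and a matching-edge off the path between two of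
its vertices would close a cycle. -/
theorem isPathLike_of_acyclic (hφ : IsTwoTwoCNF φ) (hp : IsProper φ) {C : Component φ}
    (hac : ∀ u ∈ C.supp, ∀ p : (graph φ).Walk u u, ¬ p.IsCycle) : IsPathLike C := by
  obtain ⟨u, v, p, hu, hpath, hmax⟩ := exists_longest_path C
  refine ⟨u, v, p, hpath, isCore_of_local hφ hp p hu (fun a ha => ?_) fun a ha ha' => ?_⟩
  · by_cases hau : a = u
    · subst hau
      exact .inr (longest_path_end hp hac hu hpath hmax)
    by_cases hav : a = v
    · subst hav
      have := longest_path_end hp hac (support_subset_supp hu ha) hpath.reverse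
        (by simpa only [Walk.length_reverse] using hmax)
      simp only [Walk.support_reverse, Walk.edges_reverse, List.mem_reverse] at this
      exact .inr this
    exact .inl (path_neighbors hpath ha hau hav)
  · by_contra hcon
    obtain ⟨q, hq⟩ := exists_cycle_of_chord hpath ha ha' ((graph_adj hp).2 (.inl rfl)) hcon
    exact hac a (support_subset_supp hu ha) q hq

theorem component_shape (hφ : IsTwoTwoCNF φ) (hp : IsProper φ) (C : Component φ) :
    IsPathLike C ∨ IsPendantEvenCycleLike C ∨ IsOddCycleLike C ∨ IsPureEvenCycle C := by
  by_cases hac : ∀ u ∈ C.supp, ∀ p : (graph φ).Walk u u, ¬ p.IsCycle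
  · exact .inl (isPathLike_of_acyclic hφ hp hac)
  · push Not at hac
    obtain ⟨u, hu, p, hcyc⟩ := hac
    have hc := isCore_of_isCycle hφ hp hu hcyc
    rcases Nat.even_or_odd p.length with he | ho
    · by_cases hall : ∀ a ∈ C.supp, a ∈ p.support
      · exact .inr (.inr (.inr ⟨u, p, hcyc, hc, he, hall⟩))
      · push Not at hall
        exact .inr (.inl ⟨u, p, hcyc, hc, he, hall⟩)
    · exact .inr (.inr (.inl ⟨u, p, hcyc, hc, ho⟩))

end Shapes

end DifferSAT

namespace DifferSAT

/-! ### Combining the components -/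

section Combine

variable {φ : CNF}

theorem satisfies_iff_satisfiesOn (hp : IsProper φ) {σ : ℕ → Bool} :
    Satisfies σ φ ↔ ∀ C : Component φ, SatisfiesOn σ C := by
  constructor
  · intro h C a _ b hab
    obtain ⟨l, hl, hσ⟩ := h _ hab
    rw [List.mem_pair] at hl
    rcases hl with rfl | rfl
    · exact .inl hσ
    · exact .inr hσ
  · intro h c hc
    obtain ⟨l, m, rfl, -⟩ := hp c hc
    have hl : l.1 ∈ vars φ := mem_vars.2 ⟨_, hc, by simp⟩
    have hm : m.1 ∈ vars φ := mem_vars.2 ⟨_, hc, by simp⟩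
    rcases h ((graph φ).connectedComponentMk (⟨l.1, hl⟩, l.2)) (⟨l.1, hl⟩, l.2) rfl
      (⟨m.1, hm⟩, m.2) hc with h | h
    · exact ⟨l, by simp, h⟩
    · exact ⟨m, by simp, h⟩

theorem diffCount_vars_eq_sum (hp : IsProper φ) (σ τ : ℕ → Bool) :
    diffCount (vars φ) σ τ = ∑ C : Component φ, diffCount (compVars C) σ τ := by
  classical
  have hU : vars φ = Finset.univ.biUnion (fun C : Component φ => compVars C) := by
    ext x
    simp only [Finset.mem_biUnion, Finset.mem_univ, true_and]
    constructor
    · intro hx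
      exact ⟨(graph φ).connectedComponentMk (⟨x, hx⟩, true),
        (mem_compVars hp (a := (⟨x, hx⟩, true))).2 rfl⟩
    · rintro ⟨C, hx⟩
      obtain ⟨a, -, rfl⟩ := exists_vertex_of_mem_compVars hx
      exact a.1.2
  rw [hU, diffCount, Finset.filter_biUnion, Finset.card_biUnion]
  · rfl
  · intro C _ C' _ hne
    refine Finset.disjoint_left.2 fun x hx hx' => hne ?_
    obtain ⟨a, ha, rfl⟩ := exists_vertex_of_mem_compVars (Finset.mem_of_mem_filter x hx)
    have ha' := (mem_compVars hp).1 (Finset.mem_of_mem_filter _ hx')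
    exact ha.symm.trans ha'

/-- Assignments chosen for the components combine to one assignment. -/
theorem exists_glue (hp : IsProper φ) (σ : Component φ → ℕ → Bool) :
    ∃ ρ : ℕ → Bool, ∀ C : Component φ, ∀ x ∈ compVars C, ρ x = σ C x := by
  classical
  refine ⟨fun x => if hx : x ∈ vars φ then
    σ ((graph φ).connectedComponentMk (⟨x, hx⟩, true)) x else true, fun C x hx => ?_⟩
  obtain ⟨a, ha, rfl⟩ := exists_vertex_of_mem_compVars hx
  have hmem : ((a.1, true) : Vertex φ) ∈ C.supp :=
    (mem_compVars hp).1 ((mem_compVars hp (a := a)).2 ha)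
  refine (dif_pos a.1.2).trans ?_
  exact congrArg (fun C => σ C a.1.1) hmem

theorem satisfiesWithin_congr {W : Finset ℕ} {σ σ' : ℕ → Bool} (h : ∀ x ∈ W, σ x = σ' x)
    (hσ : SatisfiesWithin φ σ' W) : SatisfiesWithin φ σ W := by
  intro a b hab ha hb
  rw [h _ ha, h _ hb]
  exact hσ a b hab ha hb

/-- Components partition the variables, and no clause joins two of them, so pairs of assignments can
be chosen independently on each. -/
theorem exactDiffer_iff_sum (hp : IsProper φ) (d : ℕ) :
    ExactDiffer φ d ↔ ∃ μ : Component φ → ℕ, (∀ C, μ C ∈ compDiffs C) ∧ ∑ C, μ C = d := by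
  constructor
  · rintro ⟨σ, τ, hσ, hτ, rfl⟩
    rw [satisfies_iff_satisfiesOn hp] at hσ hτ
    exact ⟨fun C => diffCount (compVars C) σ τ, fun C => ⟨σ, τ, hσ C, hτ C, rfl⟩,
      (diffCount_vars_eq_sum hp σ τ).symm⟩
  · rintro ⟨μ, hμ, rfl⟩
    choose σ τ hσ hτ hd using hμ
    obtain ⟨ρ, hρ⟩ := exists_glue hp σ
    obtain ⟨ρ', hρ'⟩ := exists_glue hp τ
    refine ⟨ρ, ρ', (satisfies_iff_satisfiesOn hp).2 fun C => ?_,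
      (satisfies_iff_satisfiesOn hp).2 fun C => ?_, ?_⟩
    · exact (satisfiesOn_iff hp).2 (satisfiesWithin_congr (hρ C) ((satisfiesOn_iff hp).1 (hσ C)))
    · exact (satisfiesOn_iff hp).2 (satisfiesWithin_congr (hρ' C) ((satisfiesOn_iff hp).1 (hτ C)))
    · rw [diffCount_vars_eq_sum hp]
      exact Finset.sum_congr rfl fun C _ => (diffCount_congr (hρ C) (hρ' C)).trans (hd C)

theorem exists_sum_eq_of_le {ι : Type*} (s : Finset ι) (f : ι → ℕ) {n : ℕ}
    (hn : n ≤ ∑ i ∈ s, f i) : ∃ m : ι → ℕ, (∀ i, m i ≤ f i) ∧ ∑ i ∈ s, m i = n := by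
  classical
  induction s using Finset.induction_on generalizing n with
  | empty =>
    rw [Finset.sum_empty, Nat.le_zero] at hn
    exact ⟨fun _ => 0, fun _ => Nat.zero_le _, by simp [hn]⟩
  | insert a s ha ih =>
    rw [Finset.sum_insert ha] at hn
    obtain ⟨m, hm, hs⟩ := ih (n := n - min n (f a)) (by omega)
    refine ⟨Function.update m a (min n (f a)), fun i => ?_, ?_⟩
    · by_cases hi : i = a
      · subst hi
        rw [Function.update_self]
        exact min_le_right _ _
      · rw [Function.update_of_ne hi]
        exact hm i
    · rw [Finset.sum_insert ha, Function.update_self, Finset.sum_update_of_notMem ha, hs]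
      omega

/-- The four shapes are told apart by purity and balance up to the overlap of the first two, which
have the same counts; so the shape predicates can be replaced by `IsPure` and `IsBalanced`. -/
theorem isPureEvenCycle_iff (hφ : IsTwoTwoCNF φ) (hp : IsProper φ) {C : Component φ} :
    IsPureEvenCycle C ↔ IsPure C := by
  refine ⟨fun h => h.isPure hp, fun h => ?_⟩
  rcases component_shape hφ hp C with h' | h' | h' | h'
  · exact absurd h (h'.not_isPure hp)
  · exact absurd h (h'.not_isPure hp)
  · exact absurd h (h'.not_isPure hp)
  · exact h'

theorem isOddCycleLike_iff (hφ : IsTwoTwoCNF φ) (hp : IsProper φ) {C : Component φ} :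
    IsOddCycleLike C ↔ ¬ IsBalanced C := by
  refine ⟨fun h => h.not_isBalanced hp, fun h => ?_⟩
  rcases component_shape hφ hp C with h' | h' | h' | h'
  · exact absurd (h'.isBalanced hp) h
  · exact absurd (h'.isBalanced hp) h
  · exact h'
  · exact absurd (h'.isBalanced hp) h

theorem isPathLike_or_isPendantEvenCycleLike_iff (hφ : IsTwoTwoCNF φ) (hp : IsProper φ)
    {C : Component φ} :
    IsPathLike C ∨ IsPendantEvenCycleLike C ↔ ¬ IsPure C ∧ IsBalanced C := by
  constructor
  · rintro (h | h)
    · exact ⟨h.not_isPure hp, h.isBalanced hp⟩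
    · exact ⟨h.not_isPure hp, h.isBalanced hp⟩
  · rintro ⟨h1, h2⟩
    rcases component_shape hφ hp C with h | h | h | h
    · exact .inl h
    · exact .inr h
    · exact absurd h2 (h.not_isBalanced hp)
    · exact absurd (h.isPure hp) h1

open Classical in
/-- The largest difference count on a component that is not a pure even cycle. -/
noncomputable def flexibility (C : Component φ) : ℕ :=
  if IsPure C then 0 else if IsBalanced C then (compVars C).card else (compVars C).card - 1

/-- Each component enters at most one of the two sums: path-like and pendant even ones are balanced,
odd ones are not. Pure even cycles enter neither, hence their flexibility 0. -/
theorem flexibleTotal_eq_sum (hφ : IsTwoTwoCNF φ) (hp : IsProper φ) :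
    flexibleTotal φ = ∑ C : Component φ, flexibility C := by
  classical
  rw [flexibleTotal, Finset.sum_filter, Finset.sum_filter, ← Finset.sum_add_distrib]
  refine Finset.sum_congr rfl fun C _ => ?_
  simp only [isPathLike_or_isPendantEvenCycleLike_iff hφ hp, isOddCycleLike_iff hφ hp,
    flexibility]
  by_cases h1 : IsPure C
  · have := ((isPureEvenCycle_iff hφ hp).2 h1).isBalanced hp
    simp [h1, this]
  · by_cases h2 : IsBalanced C <;> simp [h1, h2]

theorem mem_compDiffs_iff_of_not_isPure (hφ : IsTwoTwoCNF φ) (hp : IsProper φ) {C : Component φ}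
    (h : ¬ IsPure C) {μ : ℕ} : μ ∈ compDiffs C ↔ μ ≤ flexibility C := by
  by_cases hb : IsBalanced C
  · rw [compDiffs_of_isBalanced hφ hp h hb, flexibility, if_neg h, if_pos hb]
    rfl
  · rw [compDiffs_of_not_isBalanced hφ hp h hb, flexibility, if_neg h, if_neg hb]
    rfl

theorem mem_compDiffs_iff_of_isPure (hφ : IsTwoTwoCNF φ) (hp : IsProper φ) {C : Component φ}
    (h : IsPure C) {μ : ℕ} : μ ∈ compDiffs C ↔ μ = 0 ∨ μ = (compVars C).card := by
  rw [compDiffs_of_isPure hφ hp h (((isPureEvenCycle_iff hφ hp).2 h).isBalanced hp)]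
  rfl

theorem exactDiffer_iff_flexibleTotal (hφ : IsTwoTwoCNF φ) (hp : IsProper φ) (d : ℕ) :
    ExactDiffer φ d ↔
      ∃ d' ≤ flexibleTotal φ, ∃ S : Finset (Component φ),
        (∀ C ∈ S, IsPureEvenCycle C) ∧ d' + ∑ C ∈ S, (compVars C).card = d := by
  classical
  rw [exactDiffer_iff_sum hp, flexibleTotal_eq_sum hφ hp]
  simp only [isPureEvenCycle_iff hφ hp]
  constructor
  · rintro ⟨μ, hμ, rfl⟩
    -- `S` collects the pure components on which the assignments differ, and therefore differ on
    -- every variable; all other differences go into `d'`.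
    let S : Finset (Component φ) := Finset.univ.filter fun C => IsPure C ∧ μ C ≠ 0
    have hS : ∀ C, C ∈ S ↔ IsPure C ∧ μ C ≠ 0 := fun C => by simp [S]
    refine ⟨∑ C ∈ Sᶜ, μ C, ?_, S, fun C hC => ((hS C).1 hC).1, ?_⟩
    · refine (Finset.sum_le_sum fun C hC => ?_).trans
        (Finset.sum_le_sum_of_subset (Finset.subset_univ Sᶜ))
      rw [Finset.mem_compl, hS, not_and, not_not] at hC
      by_cases h : IsPure C
      · rw [hC h]
        exact Nat.zero_le _
      · exact (mem_compDiffs_iff_of_not_isPure hφ hp h).1 (hμ C)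
    · rw [← Finset.sum_compl_add_sum S μ]
      congr 1
      refine Finset.sum_congr rfl fun C hC => ?_
      obtain ⟨h1, h2⟩ := (hS C).1 hC
      exact (((mem_compDiffs_iff_of_isPure hφ hp h1).1 (hμ C)).resolve_left h2).symm
  · rintro ⟨d', hd', S, hS, rfl⟩
    obtain ⟨m, hm, rfl⟩ := exists_sum_eq_of_le Finset.univ flexibility hd'
    -- On pure components `m` vanishes, since their flexibility is 0, and the second summand
    -- vanishes on all others; so each count is achievable.
    refine ⟨fun C => m C + if C ∈ S then (compVars C).card else 0, fun C => ?_, ?_⟩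
    · dsimp only
      by_cases h : IsPure C
      · have h0 : m C = 0 := by
          have := hm C
          rwa [flexibility, if_pos h, Nat.le_zero] at this
        rw [mem_compDiffs_iff_of_isPure hφ hp h, h0, Nat.zero_add]
        split_ifs
        · exact .inr rfl
        · exact .inl rfl
      · rw [mem_compDiffs_iff_of_not_isPure hφ hp h, if_neg fun hC => h (hS C hC)]
        exact hm C
    · rw [Finset.sum_add_distrib, ← Finset.sum_filter, Finset.filter_univ_mem]

end Combine

end DifferSAT

theorem mainTheorem10 :
    DifferSAT.PolyTimeDecidable
      (fun I : {φ : DifferSAT.CNF // DifferSAT.IsTwoTwoCNF φ} × ℕ =>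
        DifferSAT.encodeInstance I.1.1 I.2)
      (fun I => DifferSAT.ExactDiffer I.1.1 I.2) ∧
    ∀ φ : DifferSAT.CNF, DifferSAT.IsTwoTwoCNF φ → DifferSAT.IsProper φ →
      (∀ C : DifferSAT.Component φ,
        (DifferSAT.IsPathLike C ∨ DifferSAT.IsPendantEvenCycleLike C ∨
          DifferSAT.IsOddCycleLike C ∨ DifferSAT.IsPureEvenCycle C) ∧
        (DifferSAT.IsPathLike C →
          DifferSAT.compDiffs C = {μ | μ ≤ (DifferSAT.compVars C).card}) ∧
        (DifferSAT.IsPendantEvenCycleLike C →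
          DifferSAT.compDiffs C = {μ | μ ≤ (DifferSAT.compVars C).card}) ∧
        (DifferSAT.IsOddCycleLike C →
          DifferSAT.compDiffs C = {μ | μ ≤ (DifferSAT.compVars C).card - 1}) ∧
        (DifferSAT.IsPureEvenCycle C →
          DifferSAT.compDiffs C = {0, (DifferSAT.compVars C).card})) ∧
      ∀ d : ℕ, DifferSAT.ExactDiffer φ d ↔
        ∃ d' ≤ DifferSAT.flexibleTotal φ, ∃ S : Finset (DifferSAT.Component φ),
          (∀ C ∈ S, DifferSAT.IsPureEvenCycle C) ∧
          d' + ∑ C ∈ S, (DifferSAT.compVars C).card = d := by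

  refine ⟨DifferSAT.polyTimeDecidable_exactDiffer, fun φ hφ hp =>
    ⟨fun C => ⟨DifferSAT.component_shape hφ hp C, ?_, ?_, ?_, ?_⟩,
      DifferSAT.exactDiffer_iff_flexibleTotal hφ hp⟩⟩
  · exact fun h => DifferSAT.compDiffs_of_isBalanced hφ hp (h.not_isPure hp) (h.isBalanced hp)
  · exact fun h => DifferSAT.compDiffs_of_isBalanced hφ hp (h.not_isPure hp) (h.isBalanced hp)
  · exact fun h =>
      DifferSAT.compDiffs_of_not_isBalanced hφ hp (h.not_isPure hp) (h.not_isBalanced hp)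
  · exact fun h => DifferSAT.compDiffs_of_isPure hφ hp (h.isPure hp) (h.isBalanced hp)
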